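/- **Setting.** Let $\mathcal T$ be a compact metric tree with vertices $v_0,\dots,v_m$ and edges $e_1,\dots,e_m$ ($m\ge1$), rooted at a boundary vertex $v_0$. Every edge $e_j=[v_{k_j},v_j]$ starts at $v_{k_j}$ (on the side of the root), ends at $v_j$, has length $T_j$ and is parametrized by $t\in[0,T_j]$; $k_1=0$, and $e_1$ is the only edge starting at $v_0$. Put $V_j=\{\nu: k_\nu=j\}$. For $j\ge1$ the vertex $v_j$ is a boundary vertex if $V_j=\varnothing$, and is inner otherwise. Let $n\ge 1$ be an integer and let $0<\tau<T_j$ for all $j$. Put $l_j=T_j$ if $v_j$ is inner and $l_j=T_j-\tau$ if $v_j$ is a boundary vertex. Let $b_{k,j},c_{k,j}$ ($0\le k\le n$, $1\le j\le m$) be complex-valued functions on $(0,T_j)$ with $b_{n,j},\,1/b_{n,j},\,c_{n,j}\in L_\infty(0,T_j)$ and $b_{k,j},c_{k,j}\in L_2(0,T_j)$ for $k<n$. Put $$W_2^n(\mathcal T_\tau)=W_2^n[-\tau,T_1]\oplus\bigoplus_{j=2}^m W_2^n[0,T_j],$$ with the norms $\|f\|^2_{W_2^n[a,b]}=\sum_{\nu=0}^n\|f^{(\nu)}\|^2_{L_2(a,b)}$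 and $\|y\|^2_{W_2^n(\mathcal T_\tau)}=\|y_1\|^2_{W_2^n[-\tau,T_1]}+\sum_{j\ge2}\|y_j\|^2_{W_2^n[0,T_j]}$. For $y=[y_1,\dots,y_m]\in W_2^n(\mathcal T_\tau)$ let $$\ell_jy(t)=\sum_{k=0}^n\big(b_{k,j}(t)y_j^{(k)}(t)+c_{k,j}(t)y_j^{(k)}(t-\tau)\big),\qquad 0<t<T_j,$$ where, for $j\ge2$ and $t\in(-\tau,0)$, one always reads $y_j(t)=y_{k_j}(t+T_{k_j})$. For $0\le k\le n$ and $0<t<l_j$ let $$\ell_{k,j}y(t)=\overline{b_{k,j}(t)}\,\ell_jy(t)+\begin{cases}\overline{c_{k,j}(t+\tau)}\,\ell_jy(t+\tau),&0<t<T_j-\tau,\\ \sum_{\nu\in V_j}\overline{c_{k,\nu}(t+\tau-T_j)}\,\ell_\nu y(t+\tau-T_j),&T_j-\tau<t<T_j,\ v_j\text{ inner},\end{cases}$$ and define the quasi-derivatives $y_j^{\langle n\rangle}=\ell_{n,j}y$, $\;y_j^{\langle n+l\rangle}=\ell_{n-l,j}y-(y_j^{\langle n+l-1\rangle})'$ for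 $l=1,\dots,n$. For $\varphi\in W_2^n[-\tau,0]$ consider the conditions 1. $y_j^{(k)}(0)=y_{k_j}^{(k)}(T_{k_j})$ for $0\le k<n$, $2\le j\le m$; 2. $y_1(t)=\varphi(t)$ on $(-\tau,0)$, and $y_1^{(k)}(0)=\varphi^{(k)}(0)$ for $0\le k<n$; 3. $y_j(t)=0$ on $[T_j-\tau,T_j]$ whenever $v_j$, $j\ge1$, is a boundary vertex. The *boundary value problem* $\mathcal B$ is to find $y\in W_2^n(\mathcal T_\tau)$ with $y_j^{\langle k\rangle}\in W_1^1[0,l_j]$ for $n\le k\le 2n-1$, $1\le j\le m$, such that conditions 1–3 hold, $y_j^{\langle 2n\rangle}=0$ on $(0,l_j)$ for all $j$, and $y_j^{\langle k\rangle}(l_j)=\sum_{\nu\in V_j}y_\nu^{\langle k\rangle}(0)$ for every inner vertex $v_j$ and $n\le k\le 2n-1$. The *variational (damping) problem* is to minimize $\mathcal J(y)=\sum_{j=1}^m\int_0^{T_j}|\ell_jy(t)|^2\,dt$ over all $y\in W_2^n(\mathcal T_\tau)$ that satisfy conditions 1–3. **Theorem.** For every $\varphi\in W_2^n[-\tau,0]$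 the boundary value problem $\mathcal B$ has a unique solution $y$, and $$\|y\|_{W_2^n(\mathcal T_\tau)}\le C\,\|\varphi\|_{W_2^n[-\tau,0]}$$ with a constant $C$ independent of $\varphi$. Moreover, this $y$ is also a solution of the variational problem, and that problem has no other solution. -/

import Mathlib

open MeasureTheory Set
open scoped ENNReal

noncomputable section

namespace TreeDamping

/-! ### The Sobolev spaces of an interval -/

/-- `f` belongs to `W_p^n[a,b]`, for `a < b`: the derivatives of order `0, …, n - 1` are absolutely
continuous on `[a,b]` and the derivative of order `n` (which exists almost everywhere) is in
`L_p(a,b)`. Derivatives at the end points are one-sided; only values on `[a,b]` matter. -/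
def MemSobolev (p : ℝ≥0∞) (n : ℕ) (a b : ℝ) (f : ℝ → ℂ) : Prop :=
  (∀ k < n, AbsolutelyContinuousOnInterval (iteratedDerivWithin k f (Icc a b)) a b) ∧
    MemLp (iteratedDerivWithin n f (Icc a b)) p (volume.restrict (Ioo a b))

/-- The square of the norm of `W_2^n[a,b]`: the sum of the squares of the `L_2(a,b)`-norms of the
derivatives of order `0, …, n`. -/
def sobolevNormSq (n : ℕ) (a b : ℝ) (f : ℝ → ℂ) : ℝ :=
  ∑ k ∈ Finset.range (n + 1), ∫ t in a..b, ‖iteratedDerivWithin k f (Icc a b) t‖ ^ 2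

/-- The norm of `W_2^n[a,b]`. -/
def sobolevNorm (n : ℕ) (a b : ℝ) (f : ℝ → ℂ) : ℝ :=
  Real.sqrt (sobolevNormSq n a b f)

/-! ### Compact rooted trees -/

/-- A compact metric tree whose root is a boundary vertex, with set of edges `E`. Every vertex other
than the root is the end of exactly one edge, so these vertices are labelled by the edges:
the edge `j` runs from the end of the edge `prev j` to the vertex `j`, except that the edge `root`
starts at the root vertex (where we put `prev root = root`). Going back from any edge one
reaches the edge `root`. The edge `j` is parametrized by `[0, T j]`. -/
structure TimeTree (E : Type*) where
  /-- the only edge that starts at the root vertex -/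
  root : E
  /-- the preceding edge -/
  prev : E → E
  /-- the lengths of the edges -/
  T : E → ℝ
  prev_root : prev root = root
  reach_root : ∀ j, ∃ N : ℕ, prev^[N] j = root
  T_pos : ∀ j, 0 < T j

/-- A control system of neutral type of order `n` with delay `τ` on a tree: for every edge `j`, an
equation `∑_{k ≤ n} (b k j (t) y_j^(k)(t) + c k j (t) y_j^(k)(t - τ)) = u_j(t)`, `0 < t < T j`. -/
structure DelaySystem (E : Type*) extends TimeTree E where
  /-- the order -/
  n : ℕ
  /-- the delay -/
  τ : ℝ
  /-- the coefficients of the terms without delay -/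
  b : ℕ → E → ℝ → ℂ
  /-- the coefficients of the terms with delay -/
  c : ℕ → E → ℝ → ℂ

variable {E : Type*} [Fintype E] [DecidableEq E]

/-- The edges that start at the end of the edge `j`. -/
def TimeTree.next (G : TimeTree E) (j : E) : Finset E :=
  Finset.univ.filter fun i => i ≠ G.root ∧ G.prev i = j

/-- The end of the edge `j` is a boundary vertex. -/
def TimeTree.IsLeaf (G : TimeTree E) (j : E) : Prop := G.next j = ∅

namespace DelaySystem

variable (S : DelaySystem E)

/-- The initial point of the parameter interval of the edge `j` in the extended tree, in which
the root edge is prolonged to `[-τ, T root]`. -/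
def lo (j : E) : ℝ := if j = S.root then -S.τ else 0

/-- The parameter interval `[-τ, T root]` or `[0, T j]` of the edge `j` in the extended tree. -/
def dom (j : E) : Set ℝ := Icc (S.lo j) (S.T j)

/-- `l_j`: the length of the edge `j`, cut by `τ` if it ends in a boundary vertex. -/
def len (j : E) : ℝ := if S.next j = ∅ then S.T j - S.τ else S.T j

/-- The conditions on the coefficients: `b_n`, `1 / b_n` and `c_n` are essentially
bounded on every edge, and `b_k`, `c_k` with `k < n` are square integrable on it. -/
structure RegularCoefficients : Prop where
  b_top : ∀ j, MemLp (S.b S.n j) ∞ (volume.restrict (Ioo 0 (S.T j)))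
  b_top_ne_zero : ∀ j, ∀ᵐ t ∂volume.restrict (Ioo 0 (S.T j)), S.b S.n j t ≠ 0
  b_top_inv : ∀ j, MemLp (fun t => 1 / S.b S.n j t) ∞ (volume.restrict (Ioo 0 (S.T j)))
  c_top : ∀ j, MemLp (S.c S.n j) ∞ (volume.restrict (Ioo 0 (S.T j)))
  b_low : ∀ j, ∀ k < S.n, MemLp (S.b k j) 2 (volume.restrict (Ioo 0 (S.T j)))
  c_low : ∀ j, ∀ k < S.n, MemLp (S.c k j) 2 (volume.restrict (Ioo 0 (S.T j)))

/-- `y = (y_j)` belongs to `W_2^n` of the extended tree. -/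
def MemW (y : E → ℝ → ℂ) : Prop := ∀ j, MemSobolev 2 S.n (S.lo j) (S.T j) (y j)

/-- The norm of `W_2^n` of the extended tree. -/
def normW (y : E → ℝ → ℂ) : ℝ :=
  Real.sqrt (∑ j, sobolevNormSq S.n (S.lo j) (S.T j) (y j))

/-- Two functions agree on the extended tree. -/
def EqOnTree (y z : E → ℝ → ℂ) : Prop := ∀ j, EqOn (y j) (z j) (S.dom j)

/-- The derivative `y_j^(k)` on the edge `j` of the extended tree. -/
def D (y : E → ℝ → ℂ) (k : ℕ) (j : E) (t : ℝ) : ℂ :=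
  iteratedDerivWithin k (y j) (S.dom j) t

/-- The value `y_j^(k)(t - τ)`, with the delay passing through the inner vertices:
`y_j(s) = y_{prev j}(s + T (prev j))` for `-τ < s < 0`, if `j` is not the root edge. -/
def delayed (y : E → ℝ → ℂ) (k : ℕ) (j : E) (t : ℝ) : ℂ :=
  if j = S.root ∨ S.τ ≤ t then S.D y k j (t - S.τ)
  else S.D y k (S.prev j) (t - S.τ + S.T (S.prev j))

/-- The expression `ℓ_j y(t) = ∑_{k ≤ n} (b_{k,j}(t) y_j^(k)(t) + c_{k,j}(t) y_j^(k)(t - τ))`. -/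
def ell (y : E → ℝ → ℂ) (j : E) (t : ℝ) : ℂ :=
  ∑ k ∈ Finset.range (S.n + 1), (S.b k j t * S.D y k j t + S.c k j t * S.delayed y k j t)

/-- `y ∈ W_2^n` satisfies the side conditions that are common to both problems. -/
structure Admissible (φ : ℝ → ℂ) (y : E → ℝ → ℂ) : Prop where
  memW : S.MemW y
  /-- continuity of `y` and its derivatives at the inner vertices -/
  glue : ∀ j, j ≠ S.root → ∀ k < S.n, S.D y k j 0 = S.D y k (S.prev j) (S.T (S.prev j))
  /-- the history -/
  history : ∀ t ∈ Ioo (-S.τ) 0, y S.root t = φ t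
  /-- the initial conditions -/
  initial : ∀ k < S.n, S.D y k S.root 0 = iteratedDerivWithin k φ (Icc (-S.τ) 0) 0
  /-- the equilibrium on the final parts of the boundary edges -/
  rest : ∀ j, S.IsLeaf j → ∀ t ∈ Icc (S.T j - S.τ) (S.T j), y j t = 0

/-! ### The variational problem -/

/-- The energy functional. -/
def energy (y : E → ℝ → ℂ) : ℝ := ∑ j, ∫ t in (0 : ℝ)..(S.T j), ‖S.ell y j t‖ ^ 2

/-- `y` is a solution of the variational problem. -/
def SolvesVariational (φ : ℝ → ℂ) (y : E → ℝ → ℂ) : Prop :=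
  S.Admissible φ y ∧ ∀ z, S.Admissible φ z → S.energy y ≤ S.energy z

/-! ### The boundary value problem -/

/-- The expressions `ℓ_{k,j} y(t)`, for `0 < t < l_j`. -/
def ellAdj (y : E → ℝ → ℂ) (k : ℕ) (j : E) (t : ℝ) : ℂ :=
  star (S.b k j t) * S.ell y j t +
    if t < S.T j - S.τ then star (S.c k j (t + S.τ)) * S.ell y j (t + S.τ)
    else ∑ i ∈ S.next j, star (S.c k i (t + S.τ - S.T j)) * S.ell y i (t + S.τ - S.T j)

/-- `q k j`, for `n ≤ k ≤ 2 n`, are the quasi-derivatives `y_j^⟨k⟩`, which are assumed to belong to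
`W_1^1[0, l_j]` for `k < 2 n`:
`y_j^⟨n⟩ = ℓ_{n,j} y` and `y_j^⟨n+l⟩ = ℓ_{n-l,j} y - (y_j^⟨n+l-1⟩)'` for `1 ≤ l ≤ n`.
Both equations are equalities almost everywhere on `(0, l_j)`; `q k j` with `k < 2 n` is the
absolutely continuous representative. -/
structure IsQuasiDerivatives (y : E → ℝ → ℂ) (q : ℕ → E → ℝ → ℂ) : Prop where
  memW11 : ∀ k, S.n ≤ k → k < 2 * S.n → ∀ j, MemSobolev 1 1 0 (S.len j) (q k j)
  base : ∀ j, ∀ᵐ t ∂volume.restrict (Ioo 0 (S.len j)), q S.n j t = S.ellAdj y S.n j t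
  step : ∀ l, 1 ≤ l → l ≤ S.n → ∀ j, ∀ᵐ t ∂volume.restrict (Ioo 0 (S.len j)),
    q (S.n + l) j t =
      S.ellAdj y (S.n - l) j t - derivWithin (q (S.n + l - 1) j) (Icc 0 (S.len j)) t

/-- `y` has absolutely continuous quasi-derivatives of order `n, …, 2 n - 1` and is a solution of
the boundary value problem: the quasi-derivatives of order `2 n` vanish, the side conditions hold,
and at the inner vertices so do the conditions of Kirchhoff type. -/
def SolvesBVP (φ : ℝ → ℂ) (y : E → ℝ → ℂ) : Prop :=
  S.Admissible φ y ∧ ∃ q : ℕ → E → ℝ → ℂ, S.IsQuasiDerivatives y q ∧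
    (∀ j, ∀ᵐ t ∂volume.restrict (Ioo 0 (S.len j)), q (2 * S.n) j t = 0) ∧
    ∀ j, ¬ S.IsLeaf j → ∀ k, S.n ≤ k → k < 2 * S.n →
      q k j (S.len j) = ∑ i ∈ S.next j, q k i 0

end DelaySystem

end TreeDamping

end

set_option linter.unusedSectionVars false

noncomputable section

namespace TreeDamping

/-! ### Absolutely continuous functions as primitives -/

/-! The energy of `y` is the squared norm of `ℓ y` in the Hilbert space `⊕ L_2(0, T_j)`, so the
variational problem asks for the point of least norm in an affine subspace. Its direction is
`controlSpace`, the set of all `ℓ w` with `w` admissible for the history `0`. If this subspace is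
closed, one extends `φ` to an admissible function (`exists_extension`) and subtracts the `w` for
which `ℓ w` is the orthogonal projection of `ℓ` of the extension. The result `y` is stationary: `ℓ
y` is orthogonal to `controlSpace`. By Pythagoras (`IsStationary.energy_eq`), every admissible `z`
has energy equal to that of `y` plus that of `z - y`.

Closedness, uniqueness and the norm estimate all rest on coercivity: for `w` with zero history, the
norm in `W_2^n` is controlled by `ℓ w` (`exists_topSq_le`, `exists_le_topSq`). To prove it, give a
point at distance `s` from the root the weight `exp (-2 r s)`. The terms of order below `n` then
carry a factor of order `1 / r`, and the delayed term of order `n` a factor `exp (-2 r τ)`. For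
large `r` both are absorbed by `b_n w^(n)`, since `1 / b_n` is bounded.

Stationary admissible functions are exactly the solutions of the boundary value problem. Moving the
delay from `w` to `ℓ y` turns the first variation into the integrals of `∑ ℓ_{k,j} y` times the
conjugate of `w_j^(k)` (`sum_integral_ell_mul_star`). Given quasi-derivatives, integration by parts
(`IsKirchhoff.sum_integral`) leaves only terms at the leaves, which vanish for admissible `w`. The
converse is a du Bois-Reymond argument. Solve the system of quasi-derivatives from the leaves to the
root, ignoring the equation of order `n`. The defect in that equation is orthogonal to everything
orthogonal to finitely many homogeneous solutions, hence is a combination of them, and adding this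
combination removes it. -/

theorem ac_of_dist_le {X Y : Type*} [PseudoMetricSpace X] [PseudoMetricSpace Y] {f : ℝ → X}
    {g : ℝ → Y} {a b : ℝ} (hg : AbsolutelyContinuousOnInterval g a b)
    (h : ∀ x ∈ uIcc a b, ∀ y ∈ uIcc a b, dist (f x) (f y) ≤ dist (g x) (g y)) :
    AbsolutelyContinuousOnInterval f a b := by
  rw [absolutelyContinuousOnInterval_iff] at hg ⊢
  intro ε hε
  obtain ⟨δ, hδ, H⟩ := hg ε hε
  refine ⟨δ, hδ, fun I hI hlen => lt_of_le_of_lt ?_ (H I hI hlen)⟩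
  exact Finset.sum_le_sum fun i hi => h _ (hI.1 i hi).1 _ (hI.1 i hi).2

/-- `u` is a primitive of `u'` on `[a, b]`. -/
structure IsPrim (a b : ℝ) (u u' : ℝ → ℂ) : Prop where
  int : IntervalIntegrable u' volume a b
  eq : ∀ x ∈ Icc a b, u x = u a + ∫ t in a..x, u' t

theorem derivWithin_Icc_eq_deriv {f : ℝ → ℂ} {a b x : ℝ} (hx : x ∈ Ioo a b) :
    derivWithin f (Icc a b) x = deriv f x :=
  derivWithin_of_mem_nhds (Icc_mem_nhds hx.1 hx.2)

theorem ae_restrict_Ioc_of_Ioo {a b : ℝ} {p : ℝ → Prop}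
    (h : ∀ᵐ x ∂volume.restrict (Ioo a b), p x) : ∀ᵐ x ∂volume.restrict (Ioc a b), p x := by
  rwa [← restrict_Ioo_eq_restrict_Ioc]

theorem intervalIntegral_congr_Ioo {F : Type*} [NormedAddCommGroup F] [NormedSpace ℝ F]
    {f g : ℝ → F} {a b : ℝ} (hab : a ≤ b)
    (h : ∀ᵐ x ∂volume.restrict (Ioo a b), f x = g x) :
    ∫ x in a..b, f x = ∫ x in a..b, g x := by
  rw [intervalIntegral.integral_of_le hab, intervalIntegral.integral_of_le hab]
  exact integral_congr_ae (ae_restrict_Ioc_of_Ioo h)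

theorem intervalIntegrable_congr_Ioo {f g : ℝ → ℂ} {a b : ℝ} (hab : a ≤ b)
    (hf : IntervalIntegrable f volume a b)
    (h : ∀ᵐ x ∂volume.restrict (Ioo a b), f x = g x) :
    IntervalIntegrable g volume a b := by
  rw [intervalIntegrable_iff_integrableOn_Ioc_of_le hab] at hf ⊢
  exact Integrable.congr hf (ae_restrict_Ioc_of_Ioo h)

theorem ae_Ioo_mono {a b c d : ℝ} {p : ℝ → Prop} (hc : a ≤ c) (hd : d ≤ b)
    (h : ∀ᵐ x ∂volume.restrict (Ioo a b), p x) : ∀ᵐ x ∂volume.restrict (Ioo c d), p x :=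
  ae_restrict_of_ae_restrict_of_subset (Ioo_subset_Ioo hc hd) h

theorem intervalIntegrable_iff_Ioo {f : ℝ → ℂ} {a b : ℝ} (hab : a ≤ b) :
    IntervalIntegrable f volume a b ↔ Integrable f (volume.restrict (Ioo a b)) := by
  rw [intervalIntegrable_iff_integrableOn_Ioc_of_le hab, IntegrableOn,
    restrict_Ioo_eq_restrict_Ioc]

theorem intervalIntegrable_ofReal {f : ℝ → ℝ} {a b : ℝ} (h : IntervalIntegrable f volume a b) :
    IntervalIntegrable (fun x => (f x : ℂ)) volume a b :=
  ⟨Integrable.ofReal h.1, Integrable.ofReal h.2⟩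

/-- An absolutely continuous function is a primitive of its derivative. -/
theorem IsPrim.of_ac {f : ℝ → ℂ} {a b : ℝ} (hab : a ≤ b)
    (hf : AbsolutelyContinuousOnInterval f a b) :
    IsPrim a b f (derivWithin f (Icc a b)) := by
  -- The fundamental theorem of calculus is applied to the real and the imaginary part; `g`
  -- reassembles their derivatives.
  have hre : AbsolutelyContinuousOnInterval (fun x => (f x).re) a b :=
    ac_of_dist_le hf fun x _ y _ => by
      rw [Real.dist_eq, dist_eq_norm, ← Complex.sub_re]; exact Complex.abs_re_le_norm _
  have him : AbsolutelyContinuousOnInterval (fun x => (f x).im) a b :=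
    ac_of_dist_le hf fun x _ y _ => by
      rw [Real.dist_eq, dist_eq_norm, ← Complex.sub_im]; exact Complex.abs_im_le_norm _
  set g : ℝ → ℂ := fun x =>
    ((deriv (fun x => (f x).re) x : ℝ) : ℂ) + ((deriv (fun x => (f x).im) x : ℝ) : ℂ) * Complex.I with hg
  have hd : ∀ᵐ x ∂volume.restrict (Ioo a b), g x = derivWithin f (Icc a b) x := by
    rw [ae_restrict_iff' measurableSet_Ioo]
    filter_upwards [hre.ae_differentiableAt, him.ae_differentiableAt] with x h1 h2 hx
    have hx' : x ∈ uIcc a b := by rw [uIcc_of_le hab]; exact Ioo_subset_Icc_self hx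
    have e1 := (h1 hx').hasDerivAt.ofReal_comp
    have e2 := ((h2 hx').hasDerivAt.ofReal_comp).mul_const Complex.I
    have e3 : HasDerivAt f (g x) x := by
      refine (e1.add e2).congr_of_eventuallyEq (Filter.Eventually.of_forall fun y => ?_)
      simp [Complex.re_add_im]
    rw [derivWithin_Icc_eq_deriv hx, e3.deriv]
  have i1 : IntervalIntegrable (fun x => ((deriv (fun x => (f x).re) x : ℝ) : ℂ)) volume a b :=
    intervalIntegrable_ofReal hre.intervalIntegrable_deriv
  have i2 : IntervalIntegrable (fun x => ((deriv (fun x => (f x).im) x : ℝ) : ℂ) * Complex.I)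
      volume a b := 
    (intervalIntegrable_ofReal him.intervalIntegrable_deriv).mul_const _
  refine ⟨intervalIntegrable_congr_Ioo hab (i1.add i2) hd, fun x hx => ?_⟩
  have hsub : uIcc a x ⊆ uIcc a b := by
    rw [uIcc_of_le hx.1, uIcc_of_le hab]; exact Icc_subset_Icc le_rfl hx.2
  rw [← intervalIntegral_congr_Ioo hx.1 (ae_Ioo_mono le_rfl hx.2 hd),
    intervalIntegral.integral_add (i1.mono_set hsub) (i2.mono_set hsub),
    intervalIntegral.integral_mul_const, intervalIntegral.integral_ofReal,
    intervalIntegral.integral_ofReal, (hre.mono hsub).integral_deriv_eq_sub,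
    (him.mono hsub).integral_deriv_eq_sub]
  apply Complex.ext <;> simp

namespace IsPrim

variable {a b : ℝ} {u u' v v' : ℝ → ℂ}

theorem int_sub (h : IsPrim a b u u') {x y : ℝ} (hx : x ∈ Icc a b) (hy : y ∈ Icc a b) :
    IntervalIntegrable u' volume x y :=
  h.int.mono_set (by
    have hab : a ≤ b := hx.1.trans hx.2
    rw [uIcc_of_le hab]; exact uIcc_subset_Icc hx hy)

theorem sub_eq (h : IsPrim a b u u') {x y : ℝ} (hx : x ∈ Icc a b) (hy : y ∈ Icc a b) :
    u y - u x = ∫ t in x..y, u' t := by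
  have ha : a ∈ Icc a b := ⟨le_rfl, hx.1.trans hx.2⟩
  rw [h.eq x hx, h.eq y hy, ← intervalIntegral.integral_add_adjacent_intervals
    (h.int_sub ha hx) (h.int_sub hx hy)]
  ring

/-- The base point may be anywhere in the interval: systems solved backwards start at the right end,
and glued functions at the gluing point. -/
theorem of_base {c : ℝ} (hc : c ∈ Icc a b) (hi : IntervalIntegrable u' volume a b)
    (h : ∀ x ∈ Icc a b, u x = u c + ∫ t in c..x, u' t) : IsPrim a b u u' := by
  have hab : a ≤ b := hc.1.trans hc.2
  have ha : a ∈ Icc a b := ⟨le_rfl, hab⟩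
  have hi' : ∀ x ∈ Icc a b, ∀ y ∈ Icc a b, IntervalIntegrable u' volume x y := fun x hx y hy =>
    hi.mono_set (by rw [uIcc_of_le hab]; exact uIcc_subset_Icc hx hy)
  refine ⟨hi, fun x hx => ?_⟩
  rw [h x hx, h a ha, ← intervalIntegral.integral_add_adjacent_intervals
    (hi' c hc a ha) (hi' a ha x hx)]
  ring

theorem primitive {f : ℝ → ℂ} {a b c : ℝ} (k : ℂ) (hc : c ∈ Icc a b)
    (hf : IntervalIntegrable f volume a b) :
    IsPrim a b (fun x => k + ∫ t in c..x, f t) f :=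
  of_base hc hf fun x _ => by simp

theorem mono (h : IsPrim a b u u') {c d : ℝ} (hc : a ≤ c) (hcd : c ≤ d) (hd : d ≤ b) :
    IsPrim c d u u' := by
  have hcm : c ∈ Icc a b := ⟨hc, hcd.trans hd⟩
  refine ⟨h.int_sub hcm ⟨hc.trans hcd, hd⟩, fun x hx => ?_⟩
  rw [← h.sub_eq hcm ⟨hc.trans hx.1, hx.2.trans hd⟩]
  ring

theorem congr (h : IsPrim a b u u') (hab : a ≤ b) (hu : EqOn v u (Icc a b))
    (hu' : ∀ᵐ x ∂volume.restrict (Ioo a b), u' x = v' x) : IsPrim a b v v' := by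
  refine ⟨intervalIntegrable_congr_Ioo hab h.int hu', fun x hx => ?_⟩
  rw [hu hx, hu ⟨le_rfl, hab⟩, h.eq x hx,
    intervalIntegral_congr_Ioo hx.1 (ae_Ioo_mono le_rfl hx.2 hu')]

theorem continuousOn (h : IsPrim a b u u') : ContinuousOn u (Icc a b) := by
  rcases lt_or_ge b a with hab | hab
  · rw [Icc_eq_empty (not_le.2 hab)]; exact continuousOn_empty _
  have h1 : ContinuousOn (fun x => ∫ t in a..x, u' t) (Icc a b) := by
    have := intervalIntegral.continuousOn_primitive_interval (μ := volume) (f := u') (a := a)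
      (b := b) (by
        rw [uIcc_of_le hab, integrableOn_Icc_iff_integrableOn_Ioc]
        exact (intervalIntegrable_iff_integrableOn_Ioc_of_le hab).1 h.int)
    rwa [uIcc_of_le hab] at this
  exact (continuousOn_const.add h1).congr fun x hx => h.eq x hx

theorem intervalIntegrable (h : IsPrim a b u u') (hab : a ≤ b) :
    IntervalIntegrable u volume a b :=
  ContinuousOn.intervalIntegrable (by rw [uIcc_of_le hab]; exact h.continuousOn)

theorem exists_bound (h : IsPrim a b u u') : ∃ C : ℝ, 0 ≤ C ∧ ∀ x ∈ Icc a b, ‖u x‖ ≤ C := by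
  obtain ⟨C, hC⟩ := isCompact_Icc.exists_bound_of_continuousOn h.continuousOn
  exact ⟨max C 0, le_max_right _ _, fun x hx => (hC x hx).trans (le_max_left _ _)⟩

theorem memLp (h : IsPrim a b u u') (p : ℝ≥0∞) :
    MemLp u p (volume.restrict (Ioo a b)) := by
  obtain ⟨C, -, hC⟩ := h.exists_bound
  exact MemLp.of_bound
    ((h.continuousOn.mono Ioo_subset_Icc_self).aestronglyMeasurable measurableSet_Ioo) C
    ((ae_restrict_iff' measurableSet_Ioo).2
      (Filter.Eventually.of_forall fun x hx => hC x (Ioo_subset_Icc_self hx)))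

/-- Increments of `u` are dominated by those of the primitive of `‖u'‖`, which is absolutely
continuous. -/
theorem ac (h : IsPrim a b u u') (hab : a ≤ b) : AbsolutelyContinuousOnInterval u a b := by
  have hG := h.int.norm.absolutelyContinuousOnInterval_intervalIntegral (c := a) (by simp)
  refine ac_of_dist_le hG fun x hx y hy => ?_
  rw [uIcc_of_le hab] at hx hy
  have ha : a ∈ Icc a b := ⟨le_rfl, hab⟩
  rw [dist_eq_norm, Real.dist_eq, h.sub_eq hy hx,
    intervalIntegral.integral_interval_sub_left (h.int_sub ha hx).norm (h.int_sub ha hy).norm]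
  exact intervalIntegral.norm_integral_le_abs_integral_norm

theorem ae_hasDerivAt (h : IsPrim a b u u') (hab : a ≤ b) :
    ∀ᵐ x ∂volume.restrict (Ioo a b), HasDerivAt u (u' x) x := by
  rw [ae_restrict_iff' measurableSet_Ioo]
  filter_upwards [h.int.ae_hasDerivAt_integral] with x hx hxm
  have hxi : x ∈ uIcc a b := by rw [uIcc_of_le hab]; exact Ioo_subset_Icc_self hxm
  have h1 := (hx hxi a (by simp)).const_add (u a)
  refine h1.congr_of_eventuallyEq ?_
  filter_upwards [Icc_mem_nhds hxm.1 hxm.2] with y hy using h.eq y hy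

theorem ae_derivWithin (h : IsPrim a b u u') (hab : a ≤ b) :
    ∀ᵐ x ∂volume.restrict (Ioo a b), u' x = derivWithin u (Icc a b) x := by
  filter_upwards [h.ae_hasDerivAt hab, ae_restrict_mem measurableSet_Ioo] with x hx hxm
  rw [derivWithin_Icc_eq_deriv hxm, hx.deriv]

theorem add (h : IsPrim a b u u') (h' : IsPrim a b v v') :
    IsPrim a b (fun x => u x + v x) (fun x => u' x + v' x) :=
  ⟨h.int.add h'.int, fun x hx => by
    have ha : a ∈ Icc a b := ⟨le_rfl, hx.1.trans hx.2⟩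
    rw [intervalIntegral.integral_add (h.int_sub ha hx) (h'.int_sub ha hx), h.eq x hx, h'.eq x hx]
    ring⟩

theorem const_mul (h : IsPrim a b u u') (c : ℂ) :
    IsPrim a b (fun x => c * u x) (fun x => c * u' x) :=
  ⟨h.int.const_mul c, fun x hx => by
    rw [intervalIntegral.integral_const_mul, h.eq x hx]; ring⟩

theorem zero : IsPrim a b (fun _ => 0) (fun _ => 0) :=
  ⟨intervalIntegrable_const, fun x _ => by simp⟩

theorem sum {ι : Type*} (s : Finset ι) {f f' : ι → ℝ → ℂ} (h : ∀ i ∈ s, IsPrim a b (f i) (f' i)) :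
    IsPrim a b (fun x => ∑ i ∈ s, f i x) (fun x => ∑ i ∈ s, f' i x) := by
  classical
  induction s using Finset.induction_on with
  | empty => simpa using zero
  | insert i s hi ih =>
    simp only [Finset.sum_insert hi]
    exact (h i (by simp)).add (ih fun j hj => h j (by simp [hj]))

theorem star (h : IsPrim a b u u') :
    IsPrim a b (fun x => star (u x)) (fun x => star (u' x)) := by
  refine ⟨?_, fun x hx => ?_⟩
  · have h1 := h.int
    rw [intervalIntegrable_iff] at h1 ⊢
    exact (Complex.conjCLE.toContinuousLinearMap).integrable_comp h1
  · have := intervalIntegral.intervalIntegral_eq_integral_uIoc (fun t => Star.star (u' t)) a x volume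
    rw [this, h.eq x hx, intervalIntegral.intervalIntegral_eq_integral_uIoc, star_add]
    congr 1
    simp only [Complex.star_def, Complex.real_smul, map_mul, Complex.conj_ofReal]
    rw [integral_conj]

/-- Integration by parts. -/
theorem mul (h : IsPrim a b u u') (h' : IsPrim a b v v') (hab : a ≤ b) :
    IsPrim a b (fun x => u x * v x) (fun x => u' x * v x + u x * v' x) := by
  -- A product of absolutely continuous functions is a primitive of its derivative, which the
  -- product rule identifies almost everywhere.
  have hac : AbsolutelyContinuousOnInterval (fun x => u x * v x) a b :=
    (h.ac hab).smul (h'.ac hab)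
  refine (IsPrim.of_ac hab hac).congr hab (fun _ _ => rfl) ?_
  filter_upwards [h.ae_hasDerivAt hab, h'.ae_hasDerivAt hab, ae_restrict_mem measurableSet_Ioo]
    with x hx hx' hxm
  rw [derivWithin_Icc_eq_deriv hxm]
  exact (hx.mul hx').deriv

end IsPrim

end TreeDamping

namespace TreeDamping

/-! ### Sobolev functions and chains of primitives -/

/-- Extending `u'` beyond the interval by its end values gives a continuous function on the line.
Its primitive is differentiable everywhere and agrees with `u` on `[a, b]`, which also covers the
one-sided derivatives at the ends. -/
theorem IsPrim.hasDerivWithinAt {a b : ℝ} {u u' : ℝ → ℂ} (h : IsPrim a b u u')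
    (hc : ContinuousOn u' (Icc a b)) {x : ℝ} (hx : x ∈ Icc a b) :
    HasDerivWithinAt u (u' x) (Icc a b) x := by
  have hab : a ≤ b := hx.1.trans hx.2
  set g : ℝ → ℂ := IccExtend hab ((Icc a b).domRestrict u')
  have hg : Continuous g := hc.domRestrict.Icc_extend'
  have hgu : EqOn g u' (Icc a b) := fun y hy => by
    simp only [g]; rw [IccExtend_of_mem hab _ hy]; rfl
  have h1 : HasDerivAt (fun y => u a + ∫ t in a..y, g t) (g x) x :=
    (hg.integral_hasStrictDerivAt a x).hasDerivAt.const_add _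
  rw [← hgu hx]
  refine h1.hasDerivWithinAt.congr (fun y hy => ?_) ?_ <;>
  · rw [h.eq _ (by assumption)]
    congr 1
    refine intervalIntegral_congr_Ioo (by first | exact hx.1 | exact hy.1) ?_
    rw [ae_restrict_iff' measurableSet_Ioo]
    refine Filter.Eventually.of_forall fun z hz => (hgu ⟨hz.1.le, hz.2.le.trans ?_⟩).symm
    first | exact hx.2 | exact hy.2

theorem MemSobolev.isPrim {p : ℝ≥0∞} {n : ℕ} {a b : ℝ} {f : ℝ → ℂ} (hab : a ≤ b)
    (hf : MemSobolev p n a b f) {k : ℕ} (hk : k < n) :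
    IsPrim a b (iteratedDerivWithin k f (Icc a b)) (iteratedDerivWithin (k + 1) f (Icc a b)) := by
  have := IsPrim.of_ac hab (hf.1 k hk)
  rwa [iteratedDerivWithin_succ]

/-- `F 0, …, F n` is a chain in which every function is a primitive of the next one. -/
def IsJet (n : ℕ) (a b : ℝ) (F : ℕ → ℝ → ℂ) : Prop := ∀ k < n, IsPrim a b (F k) (F (k + 1))

/-- Below the top order every member of the chain is continuous, so the derivatives are classical
and the identity holds at every point, end points included. At order `n` it is only available almost
everywhere. -/
theorem IsJet.eqOn_iteratedDerivWithin {n : ℕ} {a b : ℝ} {F : ℕ → ℝ → ℂ} {f : ℝ → ℂ}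
    (hab : a < b) (hF : IsJet n a b F) (hf : EqOn f (F 0) (Icc a b)) {k : ℕ} (hk : k < n) :
    EqOn (iteratedDerivWithin k f (Icc a b)) (F k) (Icc a b) := by
  induction k with
  | zero => simpa using hf
  | succ k ih =>
    intro x hx
    have ih' := ih (by omega)
    rw [iteratedDerivWithin_succ, derivWithin_congr ih' (ih' hx)]
    exact ((hF k (by omega)).hasDerivWithinAt (hF (k + 1) hk).continuousOn hx).derivWithin
      (uniqueDiffOn_Icc hab x hx)

theorem IsJet.ae_iteratedDerivWithin {n : ℕ} {a b : ℝ} {F : ℕ → ℝ → ℂ} {f : ℝ → ℂ}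
    (hab : a < b) (hF : IsJet n a b F) (hf : EqOn f (F 0) (Icc a b)) {k : ℕ} (hk : k ≤ n) :
    ∀ᵐ x ∂volume.restrict (Ioo a b), F k x = iteratedDerivWithin k f (Icc a b) x := by
  rcases Nat.eq_zero_or_pos k with rfl | hk0
  · rw [ae_restrict_iff' measurableSet_Ioo]
    exact Filter.Eventually.of_forall fun x hx => by
      simp [hf (Ioo_subset_Icc_self hx)]
  · obtain ⟨k, rfl⟩ : ∃ m, k = m + 1 := ⟨k - 1, by omega⟩
    filter_upwards [(hF k (by omega)).ae_derivWithin hab.le, ae_restrict_mem measurableSet_Ioo]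
      with x hx hxm
    have e := hF.eqOn_iteratedDerivWithin hab hf (k := k) (by omega)
    rw [hx, iteratedDerivWithin_succ, derivWithin_congr e (e (Ioo_subset_Icc_self hxm))]

theorem IsJet.memSobolev {p : ℝ≥0∞} {n : ℕ} {a b : ℝ} {F : ℕ → ℝ → ℂ} {f : ℝ → ℂ}
    (hab : a < b) (hF : IsJet n a b F) (hf : EqOn f (F 0) (Icc a b))
    (hp : MemLp (F n) p (volume.restrict (Ioo a b))) : MemSobolev p n a b f := by
  refine ⟨fun k hk => ?_, hp.ae_eq (hF.ae_iteratedDerivWithin hab hf le_rfl)⟩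
  exact ((hF k hk).congr hab.le (hF.eqOn_iteratedDerivWithin hab hf hk)
    (Filter.Eventually.of_forall fun _ => rfl)).ac hab.le

/-- Iterated derivatives in the interior only depend on the local behaviour. -/
theorem iteratedDerivWithin_eqOn_open {f g : ℝ → ℂ} {U s t : Set ℝ} (hU : IsOpen U) (hs : U ⊆ s)
    (ht : U ⊆ t) (h : EqOn f g U) (k : ℕ) :
    EqOn (iteratedDerivWithin k f s) (iteratedDerivWithin k g t) U := by
  induction k with
  | zero => simpa using h
  | succ k ih =>
    intro x hx
    have hxU := hU.mem_nhds hx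
    rw [iteratedDerivWithin_succ, iteratedDerivWithin_succ,
      derivWithin_of_mem_nhds (Filter.mem_of_superset hxU hs),
      derivWithin_of_mem_nhds (Filter.mem_of_superset hxU ht)]
    exact Filter.EventuallyEq.deriv_eq (Filter.mem_of_superset hxU ih)

/-- The chain obtained from the top function `v` by integrating from `c`. -/
def jetDown (n : ℕ) (c : ℝ) (a : ℕ → ℂ) (v : ℝ → ℂ) : ℕ → ℝ → ℂ
  | 0 => v
  | m + 1 => fun t => a (n - (m + 1)) + ∫ s in c..t, jetDown n c a v m s

/-- The chain with top function `v` and initial values `a` at `c`. -/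
def jetOf (n : ℕ) (c : ℝ) (a : ℕ → ℂ) (v : ℝ → ℂ) (k : ℕ) : ℝ → ℂ := jetDown n c a v (n - k)

theorem jetOf_top (n : ℕ) (c : ℝ) (a : ℕ → ℂ) (v : ℝ → ℂ) : jetOf n c a v n = v := by
  simp [jetOf, jetDown]

theorem jetOf_of_lt {n k : ℕ} (hk : k < n) (c : ℝ) (a : ℕ → ℂ) (v : ℝ → ℂ) (t : ℝ) :
    jetOf n c a v k t = a k + ∫ s in c..t, jetOf n c a v (k + 1) s := by
  obtain ⟨m, rfl⟩ : ∃ m, n = k + m + 1 := ⟨n - k - 1, by omega⟩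
  have e1 : k + m + 1 - k = m + 1 := by omega
  have e2 : k + m + 1 - (k + 1) = m := by omega
  have e3 : k + m + 1 - (m + 1) = k := by omega
  simp only [jetOf, e1, e2, jetDown, e3]

theorem isJet_jetOf {n : ℕ} {α β c : ℝ} (hc : c ∈ Icc α β) (a : ℕ → ℂ) {v : ℝ → ℂ}
    (hv : IntervalIntegrable v volume α β) : IsJet n α β (jetOf n c a v) := by
  have hαβ : α ≤ β := hc.1.trans hc.2
  -- Integrability descends from the top function, so the induction runs over the distance `m` to
  -- the order `n`.
  suffices H : ∀ m ≤ n, IntervalIntegrable (jetOf n c a v (n - m)) volume α β by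
    intro k hk
    have hi : IntervalIntegrable (jetOf n c a v (k + 1)) volume α β := by
      have := H (n - (k + 1)) (by omega)
      rwa [show n - (n - (k + 1)) = k + 1 by omega] at this
    have := IsPrim.primitive (a k) hc hi
    exact this.congr hαβ (fun t _ => jetOf_of_lt hk c a v t)
      (Filter.Eventually.of_forall fun _ => rfl)
  intro m
  induction m with
  | zero => intro _; simpa [jetOf_top] using hv
  | succ m ih =>
    intro hm
    have hi := ih (by omega)
    rw [show n - m = n - (m + 1) + 1 by omega] at hi
    refine ((IsPrim.primitive (a (n - (m + 1))) hc hi).congr hαβ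
      (fun t _ => jetOf_of_lt (by omega) c a v t)
      (Filter.Eventually.of_forall fun _ => rfl)).intervalIntegrable hαβ

theorem jetOf_base {n k : ℕ} (hk : k < n) (c : ℝ) (a : ℕ → ℂ) (v : ℝ → ℂ) :
    jetOf n c a v k c = a k := by
  rw [jetOf_of_lt hk]; simp

/-- A chain with zero initial values and zero top function vanishes. -/
theorem IsJet.eq_zero {n : ℕ} {a b c : ℝ} {F : ℕ → ℝ → ℂ} (hF : IsJet n a b F)
    (hc : c ∈ Icc a b) (hb : ∀ k < n, F k c = 0)
    (h : ∀ᵐ x ∂volume.restrict (Ioo a b), F n x = 0) {k : ℕ} (hk : k < n) :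
    ∀ x ∈ Icc a b, F k x = 0 := by
  suffices H : ∀ m, m < n → ∀ x ∈ Icc a b, F (n - (m + 1)) x = 0 by
    have := H (n - (k + 1)) (by omega)
    rwa [show n - (n - (k + 1) + 1) = k by omega] at this
  have key : ∀ k < n, (∀ᵐ x ∂volume.restrict (Ioo a b), F (k + 1) x = 0) →
      ∀ x ∈ Icc a b, F k x = 0 := by
    intro k hk h0
    have hab : a ≤ b := hc.1.trans hc.2
    have hz : ∀ x ∈ Icc a b, F k x = F k a := fun x hx => by
      rw [(hF k hk).eq x hx, intervalIntegral_congr_Ioo (g := fun _ => 0) hx.1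
        (ae_Ioo_mono le_rfl hx.2 h0)]
      simp
    intro x hx
    rw [hz x hx, ← hz c hc, hb k hk]
  intro m
  induction m with
  | zero => exact fun hm => key _ (by omega) (by rwa [show n - (0 + 1) + 1 = n by omega])
  | succ m ih =>
    intro hm
    refine key _ (by omega) ?_
    rw [ae_restrict_iff' measurableSet_Ioo, show n - (m + 1 + 1) + 1 = n - (m + 1) by omega]
    exact Filter.Eventually.of_forall fun x hx => ih (by omega) x (Ioo_subset_Icc_self hx)

/-! ### Inequalities -/

theorem memLp_two_integrable_sq {f : ℝ → ℂ} {μ : Measure ℝ} (hf : MemLp f 2 μ) :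
    Integrable (fun x => ‖f x‖ ^ 2) μ := hf.integrable_norm_pow (by norm_num)

/-- The Cauchy–Schwarz inequality. -/
theorem sq_integral_mul_le {μ : Measure ℝ} {f g : ℝ → ℝ} (hf : MemLp f 2 μ) (hg : MemLp g 2 μ) :
    (∫ x, |f x| * |g x| ∂μ) ^ 2 ≤ (∫ x, f x ^ 2 ∂μ) * ∫ x, g x ^ 2 ∂μ := by
  have h := integral_mul_le_Lp_mul_Lq_of_nonneg (μ := μ) (f := fun x => |f x|)
    (g := fun x => |g x|) Real.HolderConjugate.two_two
    (Filter.Eventually.of_forall fun x => abs_nonneg _)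
    (Filter.Eventually.of_forall fun x => abs_nonneg _)
    (by rw [ENNReal.ofReal_ofNat]; exact hf.abs) (by rw [ENNReal.ofReal_ofNat]; exact hg.abs)
  have e : ∀ u : ℝ → ℝ, (∫ x, |u x| ^ (2 : ℝ) ∂μ) = ∫ x, u x ^ 2 ∂μ := fun u => by
    congr 1; ext x; rw [Real.rpow_two, sq_abs]
  rw [e, e, ← Real.sqrt_eq_rpow, ← Real.sqrt_eq_rpow] at h
  have h0 : 0 ≤ ∫ x, |f x| * |g x| ∂μ := integral_nonneg fun x => by positivity
  calc _ ≤ (√(∫ x, f x ^ 2 ∂μ) * √(∫ x, g x ^ 2 ∂μ)) ^ 2 := by gcongr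
    _ = _ := by
      rw [mul_pow, Real.sq_sqrt (integral_nonneg fun x => sq_nonneg _),
        Real.sq_sqrt (integral_nonneg fun x => sq_nonneg _)]

/-- The Cauchy–Schwarz inequality against the constant `1`, followed by enlarging the interval to
`[a, b]`. -/
theorem sq_norm_integral_le {a b : ℝ} (hab : a ≤ b) {f : ℝ → ℂ}
    (hf : MemLp f 2 (volume.restrict (Ioo a b))) {x y : ℝ} (hx : a ≤ x) (hxy : x ≤ y)
    (hy : y ≤ b) : ‖∫ t in x..y, f t‖ ^ 2 ≤ (b - a) * ∫ t in a..b, ‖f t‖ ^ 2 := by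
  have hf' : MemLp f 2 (volume.restrict (Ioc x y)) := by
    rw [← restrict_Ioo_eq_restrict_Ioc]
    exact hf.mono_measure (Measure.restrict_mono (Ioo_subset_Ioo hx hy) le_rfl)
  have h := sq_integral_mul_le (memLp_const (1 : ℝ)) hf'.norm
  simp only [abs_one, one_mul, abs_norm, one_pow, integral_const, smul_eq_mul, mul_one,
    measureReal_restrict_apply MeasurableSet.univ, univ_inter, Real.volume_real_Ioc_of_le hxy] at h
  have h1 : ∫ t in Ioc x y, ‖f t‖ ^ 2 ≤ ∫ t in Ioc a b, ‖f t‖ ^ 2 := by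
    refine setIntegral_mono_set ?_ (Filter.Eventually.of_forall fun _ => by positivity)
      (Ioc_subset_Ioc hx hy).eventuallyLE
    rw [IntegrableOn, ← restrict_Ioo_eq_restrict_Ioc]
    exact memLp_two_integrable_sq hf
  rw [intervalIntegral.integral_of_le hxy, intervalIntegral.integral_of_le hab]
  calc ‖∫ t in Ioc x y, f t‖ ^ 2 ≤ (∫ t in Ioc x y, ‖f t‖) ^ 2 := by
        gcongr; exact norm_integral_le_integral_norm _
    _ ≤ _ := h
    _ ≤ _ := by
        gcongr

/-- The trace inequality. -/
theorem IsPrim.trace_sq_le {a b : ℝ} (hab : a < b) {u u' : ℝ → ℂ} (h : IsPrim a b u u')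
    (hu' : MemLp u' 2 (volume.restrict (Ioo a b))) {x : ℝ} (hx : x ∈ Icc a b) :
    ‖u x‖ ^ 2 ≤ (2 / (b - a) + 2 * (b - a)) *
      ((∫ t in a..b, ‖u t‖ ^ 2) + ∫ t in a..b, ‖u' t‖ ^ 2) := by
  set I := ∫ t in a..b, ‖u' t‖ ^ 2 with hI
  set J := ∫ t in a..b, ‖u t‖ ^ 2 with hJ
  have hI0 : 0 ≤ I := intervalIntegral.integral_nonneg hab.le fun _ _ => by positivity
  have hJ0 : 0 ≤ J := intervalIntegral.integral_nonneg hab.le fun _ _ => by positivity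
  have hd : 0 < b - a := sub_pos.2 hab
  -- Compare `u x` with `u s`, then average over `s` in `[a, b]`.
  have key : ∀ s ∈ Icc a b, ‖u x‖ ^ 2 ≤ 2 * ‖u s‖ ^ 2 + 2 * ((b - a) * I) := by
    intro s hs
    have h1 : ‖u x - u s‖ ^ 2 ≤ (b - a) * I := by
      rcases le_total s x with hsx | hsx
      · rw [h.sub_eq hs hx]; exact sq_norm_integral_le hab.le hu' hs.1 hsx hx.2
      · rw [norm_sub_rev, h.sub_eq hx hs]; exact sq_norm_integral_le hab.le hu' hx.1 hsx hs.2
    have h2 : ‖u x‖ ≤ ‖u s‖ + ‖u x - u s‖ := by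
      simpa using norm_add_le (u s) (u x - u s)
    have h3 : ‖u x‖ ^ 2 ≤ (‖u s‖ + ‖u x - u s‖) ^ 2 := by gcongr
    nlinarith [sq_nonneg (‖u s‖ - ‖u x - u s‖)]
  have hint : IntervalIntegrable (fun s => ‖u s‖ ^ 2) volume a b :=
    ContinuousOn.intervalIntegrable (by rw [uIcc_of_le hab.le]; exact h.continuousOn.norm.pow 2)
  have := intervalIntegral.integral_mono_on hab.le (intervalIntegrable_const (c := ‖u x‖ ^ 2))
    ((hint.const_mul 2).add (intervalIntegrable_const (c := 2 * ((b - a) * I)))) key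
  rw [intervalIntegral.integral_add (hint.const_mul 2) intervalIntegrable_const,
    intervalIntegral.integral_const_mul, intervalIntegral.integral_const,
    intervalIntegral.integral_const] at this
  simp only [smul_eq_mul] at this
  have h5 : ‖u x‖ ^ 2 ≤ 2 / (b - a) * J + 2 * (b - a) * I := by
    have e : (b - a) * (2 / (b - a) * J + 2 * (b - a) * I) =
      2 * J + (b - a) * (2 * ((b - a) * I)) := by field_simp
    exact le_of_mul_le_mul_left (by rw [e]; exact this) hd
  have h6 : 0 ≤ 2 / (b - a) * I := by positivity
  have h7 : 0 ≤ 2 * (b - a) * J := by positivity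
  linarith [add_mul (2 / (b - a)) (2 * (b - a)) (J + I), mul_add (2 / (b - a)) J I,
    mul_add (2 * (b - a)) J I]

/-- The exponentially weighted estimate of a primitive. -/
theorem IsPrim.weighted_le {l r : ℝ} (hr : 0 < r) {u u' : ℝ → ℂ} (h : IsPrim 0 l u u')
    (hu' : MemLp u' 2 (volume.restrict (Ioo 0 l))) {t : ℝ} (ht : t ∈ Icc 0 l) :
    Real.exp (-r * t) * ‖u t‖ ≤ ‖u 0‖ +
      √((∫ s in (0 : ℝ)..l, Real.exp (-2 * r * s) * ‖u' s‖ ^ 2) / (2 * r)) := by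
  have hsub : Ioo 0 t ⊆ Ioo 0 l := Ioo_subset_Ioo le_rfl ht.2
  have hl : 0 ≤ l := ht.1.trans ht.2
  have hf' : MemLp u' 2 (volume.restrict (Ioc 0 t)) := by
    rw [← restrict_Ioo_eq_restrict_Ioc]
    exact hu'.mono_measure (Measure.restrict_mono hsub le_rfl)
  have hexp : Continuous fun s : ℝ => Real.exp (-r * s) := by fun_prop
  have hexp' : Continuous fun s : ℝ => Real.exp (-r * (t - s)) := by fun_prop
  have hb : MemLp (fun s => Real.exp (-r * (t - s))) 2 (volume.restrict (Ioc 0 t)) := by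
    refine MemLp.of_bound hexp'.aestronglyMeasurable 1 ?_
    rw [ae_restrict_iff' measurableSet_Ioc]
    refine Filter.Eventually.of_forall fun s hs => ?_
    rw [Real.norm_eq_abs, abs_of_pos (Real.exp_pos _), Real.exp_le_one_iff]
    nlinarith [hs.2]
  have hw : ∀ l', 0 ≤ l' → MemLp u' 2 (volume.restrict (Ioc 0 l')) →
      MemLp (fun s => Real.exp (-r * s) * ‖u' s‖) 2 (volume.restrict (Ioc 0 l')) := by
    intro l' hl' hm
    refine hm.norm.of_le ?_ ?_
    · exact hexp.aestronglyMeasurable.mul hm.norm.aestronglyMeasurable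
    · rw [ae_restrict_iff' measurableSet_Ioc]
      refine Filter.Eventually.of_forall fun s hs => ?_
      rw [norm_mul, norm_norm, Real.norm_eq_abs, abs_of_pos (Real.exp_pos _)]
      refine mul_le_of_le_one_left (norm_nonneg _) (Real.exp_le_one_iff.2 ?_)
      nlinarith [hs.1]
  -- Split `exp (-r t)` as `exp (-r (t - s)) * exp (-r s)`. The square of the first factor has
  -- integral at most `1 / (2 r)`, and the second is the weight of `u'`.
  have hcs := sq_integral_mul_le hb (hw t ht.1 hf')
  have e1 : ∀ s, Real.exp (-r * (t - s)) ^ 2 = Real.exp (-2 * r * t) * Real.exp (2 * r * s) :=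
    fun s => by rw [← Real.exp_nat_mul, ← Real.exp_add]; congr 1; push_cast; ring
  have e2 : ∀ s, (Real.exp (-r * s) * ‖u' s‖) ^ 2 = Real.exp (-2 * r * s) * ‖u' s‖ ^ 2 :=
    fun s => by rw [mul_pow, ← Real.exp_nat_mul]; congr 2; push_cast; ring
  have e3 : ∀ s, |Real.exp (-r * (t - s))| * |Real.exp (-r * s) * ‖u' s‖| =
      Real.exp (-r * t) * ‖u' s‖ := fun s => by
    rw [abs_of_pos (Real.exp_pos _), abs_of_nonneg (by positivity), ← mul_assoc, ← Real.exp_add]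
    congr 2; ring
  simp only [e1, e2, e3] at hcs
  have i1 : ∫ s in Ioc 0 t, Real.exp (-2 * r * t) * Real.exp (2 * r * s) ≤ 1 / (2 * r) := by
    rw [integral_const_mul, ← intervalIntegral.integral_of_le ht.1,
      intervalIntegral.integral_comp_mul_left (f := Real.exp) (c := 2 * r) (by positivity),
      integral_exp, smul_eq_mul, mul_zero, Real.exp_zero]
    have : Real.exp (-2 * r * t) * Real.exp (2 * r * t) = 1 := by
      rw [← Real.exp_add]; simp
    have h2 : Real.exp (-2 * r * t) * ((2 * r)⁻¹ * (Real.exp (2 * r * t) - 1)) =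
      (1 - Real.exp (-2 * r * t)) / (2 * r) := by
      linear_combination (1 / (2 * r)) * this
    rw [h2]
    gcongr
    linarith [Real.exp_pos (-2 * r * t)]
  have i2 : ∫ s in Ioc 0 t, Real.exp (-2 * r * s) * ‖u' s‖ ^ 2 ≤
      ∫ s in (0 : ℝ)..l, Real.exp (-2 * r * s) * ‖u' s‖ ^ 2 := by
    rw [intervalIntegral.integral_of_le hl]
    refine setIntegral_mono_set ?_ (Filter.Eventually.of_forall fun _ => by positivity)
      (Ioc_subset_Ioc le_rfl ht.2).eventuallyLE
    have hm : MemLp u' 2 (volume.restrict (Ioc 0 l)) := by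
      rwa [← restrict_Ioo_eq_restrict_Ioc]
    have := (hw l hl hm).integrable_sq
    simp only [e2] at this
    exact this
  have i0 : 0 ≤ ∫ s in Ioc 0 t, Real.exp (-2 * r * s) * ‖u' s‖ ^ 2 :=
    integral_nonneg fun _ => by positivity
  have i3 : (∫ s in Ioc 0 t, Real.exp (-r * t) * ‖u' s‖) ^ 2 ≤
      (∫ s in (0 : ℝ)..l, Real.exp (-2 * r * s) * ‖u' s‖ ^ 2) / (2 * r) := by
    refine hcs.trans ((mul_le_mul i1 i2 i0 (by positivity)).trans_eq (by ring))
  have i4 := Real.le_sqrt_of_sq_le i3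
  rw [h.eq t ht]
  calc Real.exp (-r * t) * ‖u 0 + ∫ s in (0 : ℝ)..t, u' s‖
      ≤ Real.exp (-r * t) * (‖u 0‖ + ∫ s in Ioc 0 t, ‖u' s‖) := by
        gcongr
        refine (norm_add_le _ _).trans ?_
        gcongr
        rw [intervalIntegral.integral_of_le ht.1]
        exact norm_integral_le_integral_norm _
    _ = Real.exp (-r * t) * ‖u 0‖ + ∫ s in Ioc 0 t, Real.exp (-r * t) * ‖u' s‖ := by
        rw [mul_add, integral_const_mul]
    _ ≤ _ := by
        refine add_le_add (mul_le_of_le_one_left (norm_nonneg _) (Real.exp_le_one_iff.2 ?_)) i4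
        nlinarith [ht.1]

end TreeDamping

namespace TreeDamping

/-! ### Combinatorics of the tree -/

section Tree

variable {E : Type*} [DecidableEq E] (G : TimeTree E)

/-- The number of edges before the edge `j` on the path from the root. -/
def TimeTree.depth (j : E) : ℕ := Nat.find (G.reach_root j)

theorem TimeTree.depth_root : G.depth G.root = 0 := by
  rw [TimeTree.depth, Nat.find_eq_zero]; rfl

theorem TimeTree.depth_prev {j : E} (hj : j ≠ G.root) : G.depth j = G.depth (G.prev j) + 1 := by
  unfold TimeTree.depth
  rw [Nat.find_eq_iff]
  refine ⟨Nat.find_spec (G.reach_root (G.prev j)), fun m hm h => ?_⟩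
  cases m with
  | zero => exact hj h
  | succ m => exact Nat.find_min (G.reach_root (G.prev j)) (by omega) h

theorem TimeTree.induction {P : E → Prop} (h0 : P G.root)
    (hs : ∀ j, j ≠ G.root → P (G.prev j) → P j) (j : E) : P j := by
  induction h : G.depth j generalizing j with
  | zero =>
    have : j = G.root := by
      by_contra hj
      have := G.depth_prev hj
      omega
    exact this ▸ h0
  | succ m ih =>
    by_cases hj : j = G.root
    · exact hj ▸ h0
    · exact hs j hj (ih _ (by have := G.depth_prev hj; omega))

/-- Recursion from the root towards the leaves. -/
theorem TimeTree.exists_forward {α : Type*} (x : α) (step : E → α → α) :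
    ∃ a : E → α, a G.root = x ∧ ∀ j, j ≠ G.root → a j = step j (a (G.prev j)) := by
  -- `A N` unrolls the recursion `N` times starting from the constant `x`; at the edge `j` it is
  -- evaluated after `depth j` rounds.
  let A : ℕ → E → α := fun N => Nat.rec (fun _ => x) (fun _ B j => step j (B (G.prev j))) N
  refine ⟨fun j => A (G.depth j) j, by simp only [G.depth_root]; rfl, fun j hj => ?_⟩
  simp only [G.depth_prev hj]
  rfl

variable [Fintype E]

theorem TimeTree.mem_next {i j : E} : i ∈ G.next j ↔ i ≠ G.root ∧ G.prev i = j := by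
  simp [TimeTree.next]

/-- Recursion from the leaves towards the root. -/
theorem TimeTree.exists_backward {α : Type*} [Nonempty α] (g : E → (E → α) → α)
    (hg : ∀ j a a', (∀ i ∈ G.next j, a i = a' i) → g j a = g j a') :
    ∃ a : E → α, ∀ j, a j = g j a := by
  obtain ⟨N, hN⟩ : ∃ N, ∀ j, G.depth j ≤ N :=
    ⟨Finset.univ.sup G.depth, fun j => Finset.le_sup (Finset.mem_univ j)⟩
  let A : ℕ → E → α := fun m => Nat.rec (fun _ => Classical.arbitrary α) (fun _ B j => g j B) m
  have hA : ∀ m j, A (m + 1) j = g j (A m) := fun _ _ => rfl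
  -- The iteration stabilizes from the deepest edges upwards: `g j` only looks at edges one level
  -- deeper, where the values settled one round earlier. For `m = 0` the hypothesis is void, as no
  -- depth exceeds `N`.
  have key : ∀ m j, N < m + G.depth j → A (m + 1) j = A m j := by
    intro m
    induction m with
    | zero => intro j hj; have := hN j; omega
    | succ m ih =>
      intro j hj
      rw [hA (m + 1), hA m]
      refine hg j _ _ fun i hi => ih i ?_
      obtain ⟨hi1, hi2⟩ := (G.mem_next).1 hi
      have := G.depth_prev hi1
      rw [hi2] at this
      omega
  exact ⟨A (N + 1), fun j => by rw [← hA (N + 1), key (N + 1) j (by omega)]⟩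

/-- Every edge other than the root edge starts at the end of exactly one edge. This regroups terms
at the beginnings of edges by vertices. -/
theorem TimeTree.sum_ne_root {X : Type*} [AddCommMonoid X] (h : E → X) :
    ∑ j, (if j = G.root then 0 else h j) = ∑ i, ∑ j ∈ G.next i, h j := by
  rw [← Finset.sum_fiberwise (s := Finset.univ) (g := G.prev)]
  refine Finset.sum_congr rfl fun i _ => ?_
  rw [TimeTree.next, Finset.sum_filter, Finset.sum_filter]
  refine Finset.sum_congr rfl fun j _ => ?_
  by_cases h1 : j = G.root <;> by_cases h2 : G.prev j = i <;> simp [h1, h2]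

end Tree

/-! ### Shifts and the delay -/

theorem ae_Ioo_split {a b c : ℝ} {p : ℝ → Prop} (h1 : ∀ᵐ x ∂volume.restrict (Ioo a c), p x)
    (h2 : ∀ᵐ x ∂volume.restrict (Ioo c b), p x) : ∀ᵐ x ∂volume.restrict (Ioo a b), p x := by
  rw [ae_restrict_iff' measurableSet_Ioo] at *
  have h3 : ∀ᵐ x : ℝ, x ≠ c := by simp [ae_iff, measure_singleton]
  filter_upwards [h1, h2, h3] with x hx1 hx2 hx3 hx
  rcases lt_or_gt_of_ne hx3 with h | h
  · exact hx1 ⟨hx.1, h⟩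
  · exact hx2 ⟨h, hx.2⟩

theorem memLp_Ioo_union {a b c : ℝ} {f : ℝ → ℂ} {p : ℝ≥0∞}
    (h1 : MemLp f p (volume.restrict (Ioo a c))) (h2 : MemLp f p (volume.restrict (Ioo c b))) :
    MemLp f p (volume.restrict (Ioo a b)) := by
  have e1 := (memLp_indicator_iff_restrict measurableSet_Ioo).2 h1
  have e2 := (memLp_indicator_iff_restrict measurableSet_Ioo).2 h2
  refine ((e1.add e2).mono_measure Measure.restrict_le_self).ae_eq (ae_Ioo_split (c := c) ?_ ?_)
  · filter_upwards [ae_restrict_mem measurableSet_Ioo] with t ht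
    have : t ∉ Ioo c b := fun h => lt_asymm h.1 ht.2
    simp [ht, this]
  · filter_upwards [ae_restrict_mem measurableSet_Ioo] with t ht
    have : t ∉ Ioo a c := fun h => lt_asymm h.2 ht.1
    simp [ht, this]

theorem measurePreserving_shift_Ioo (a b s : ℝ) :
    MeasurePreserving (fun x => x + s) (volume.restrict (Ioo (a - s) (b - s)))
      (volume.restrict (Ioo a b)) := by
  have h := (measurePreserving_add_right (volume : Measure ℝ) s).restrict_preimage
    (s := Ioo a b) measurableSet_Ioo
  rwa [preimage_add_const_Ioo] at h

theorem ae_shift {a b : ℝ} (s : ℝ) {p : ℝ → Prop} (h : ∀ᵐ x ∂volume.restrict (Ioo a b), p x) :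
    ∀ᵐ x ∂volume.restrict (Ioo (a - s) (b - s)), p (x + s) :=
  (measurePreserving_shift_Ioo a b s).quasiMeasurePreserving.ae h

theorem memLp_shift {a b : ℝ} (s : ℝ) {p : ℝ≥0∞} {f : ℝ → ℂ}
    (h : MemLp f p (volume.restrict (Ioo a b))) :
    MemLp (fun x => f (x + s)) p (volume.restrict (Ioo (a - s) (b - s))) :=
  h.comp_measurePreserving (measurePreserving_shift_Ioo a b s)

theorem memLp_Ioo_mono {a b c d : ℝ} {f : ℝ → ℂ} {p : ℝ≥0∞} (hc : a ≤ c) (hd : d ≤ b)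
    (h : MemLp f p (volume.restrict (Ioo a b))) : MemLp f p (volume.restrict (Ioo c d)) :=
  h.mono_measure (Measure.restrict_mono (Ioo_subset_Ioo hc hd) le_rfl)

variable {E : Type*} [DecidableEq E]

namespace DelaySystem

variable (S : DelaySystem E)

/-- The delay of a family of functions on the edges, passing through the inner vertices. -/
def del {X : Type*} (F : E → ℝ → X) (j : E) (t : ℝ) : X :=
  if j = S.root ∨ S.τ ≤ t then F j (t - S.τ) else F (S.prev j) (t - S.τ + S.T (S.prev j))

theorem lo_root : S.lo S.root = -S.τ := if_pos rfl

theorem lo_of_ne {j : E} (hj : j ≠ S.root) : S.lo j = 0 := if_neg hj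

variable {S}

theorem lo_nonpos (hτ : 0 < S.τ) (j : E) : S.lo j ≤ 0 := by
  unfold lo; split_ifs <;> linarith

theorem lo_lt (hτ : 0 < S.τ) (j : E) : S.lo j < S.T j :=
  (lo_nonpos hτ j).trans_lt (S.T_pos j)

/-- On `(0, τ)` and on `(τ, T j)` the delay is a translation, into the preceding edge or the same
edge, and translations preserve null sets. On the root edge one translation into the prolonged edge
suffices. -/
theorem ae_del {X : Type*} (hτ : 0 < S.τ) (hT : ∀ j, S.τ < S.T j) {F G : E → ℝ → X}
    (h : ∀ j, ∀ᵐ t ∂volume.restrict (Ioo (S.lo j) (S.T j)), F j t = G j t) (j : E) :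
    ∀ᵐ t ∂volume.restrict (Ioo 0 (S.T j)), S.del F j t = S.del G j t := by
  have hsame : ∀ᵐ t ∂volume.restrict (Ioo (S.lo j + S.τ) (S.T j)),
      F j (t - S.τ) = G j (t - S.τ) := by
    have := ae_shift (-S.τ) (h j)
    simp only [← sub_eq_add_neg, sub_neg_eq_add] at this
    exact ae_Ioo_mono le_rfl (by linarith) this
  by_cases hj : j = S.root
  · have hlo : S.lo j + S.τ = 0 := by rw [hj, lo_root]; ring
    rw [hlo] at hsame
    filter_upwards [hsame] with t ht
    simp [del, hj ▸ ht, hj]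
  · rw [lo_of_ne S hj, zero_add] at hsame
    refine ae_Ioo_split (c := S.τ) ?_ ?_
    · have hp := ae_shift (-S.τ + S.T (S.prev j)) (h (S.prev j))
      have hp' := ae_Ioo_mono (c := 0) (d := S.τ)
        (by have := lo_nonpos hτ (S.prev j); have := hT (S.prev j); linarith) (by linarith) hp
      filter_upwards [hp', ae_restrict_mem measurableSet_Ioo] with t ht htm
      rw [← add_assoc, ← sub_eq_add_neg] at ht
      simp [del, hj, not_le.2 htm.2, ht]
    · filter_upwards [hsame, ae_restrict_mem measurableSet_Ioo] with t ht htm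
      simp [del, htm.1.le, ht]

theorem memLp_del (hτ : 0 < S.τ) (hT : ∀ j, S.τ < S.T j) {F : E → ℝ → ℂ}
    (h : ∀ j, MemLp (F j) 2 (volume.restrict (Ioo (S.lo j) (S.T j)))) (j : E) :
    MemLp (S.del F j) 2 (volume.restrict (Ioo 0 (S.T j))) := by
  have hsame : MemLp (fun t => F j (t - S.τ)) 2 (volume.restrict (Ioo (S.lo j + S.τ) (S.T j))) := by
    have := memLp_shift (-S.τ) (h j)
    simp only [← sub_eq_add_neg, sub_neg_eq_add] at this
    exact memLp_Ioo_mono le_rfl (by linarith) this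
  by_cases hj : j = S.root
  · have hlo : S.lo j + S.τ = 0 := by rw [hj, lo_root]; ring
    rw [hlo] at hsame
    refine hsame.ae_eq (Filter.Eventually.of_forall fun t => ?_)
    simp [del, hj]
  · rw [lo_of_ne S hj, zero_add] at hsame
    refine memLp_Ioo_union (c := S.τ) ?_ ?_
    · have hp := memLp_shift (-S.τ + S.T (S.prev j)) (h (S.prev j))
      have hp' := memLp_Ioo_mono (c := 0) (d := S.τ)
        (by have := lo_nonpos hτ (S.prev j); have := hT (S.prev j); linarith) (by linarith) hp
      refine hp'.ae_eq ?_
      filter_upwards [ae_restrict_mem measurableSet_Ioo] with t htm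
      simp [del, hj, not_le.2 htm.2, ← add_assoc, ← sub_eq_add_neg]
    · refine hsame.ae_eq ?_
      filter_upwards [ae_restrict_mem measurableSet_Ioo] with t htm
      simp [del, htm.1.le]

section Integral

variable {X : Type*} [NormedAddCommGroup X] [NormedSpace ℝ X] {Φ : ℝ → ℂ → X} {F : E → ℝ → ℂ}

theorem integral_del_root :
    ∫ t in (0 : ℝ)..(S.T S.root), Φ t (S.del F S.root t) =
      ∫ t in (-S.τ)..(S.T S.root - S.τ), Φ (t + S.τ) (F S.root t) := by
  have h1 := intervalIntegral.integral_comp_add_right (a := -S.τ) (b := S.T S.root - S.τ)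
    (fun t => Φ t (F S.root (t - S.τ))) S.τ
  simp only [add_sub_cancel_right, neg_add_cancel, sub_add_cancel] at h1
  rw [h1]
  simp [del]

/-- Substitution moves the shift from `F` to `Φ`. The part over `(τ, T j)` stays on the edge; the
part over `(0, τ)` becomes an integral over the final piece of the preceding edge. -/
theorem integral_del_of_ne (hτ : 0 < S.τ) (hT : ∀ j, S.τ < S.T j) {j : E} (hj : j ≠ S.root)
    (hi : IntervalIntegrable (fun t => Φ t (S.del F j t)) volume 0 (S.T j)) :
    ∫ t in (0 : ℝ)..(S.T j), Φ t (S.del F j t) =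
      (∫ t in (0 : ℝ)..(S.T j - S.τ), Φ (t + S.τ) (F j t)) +
      ∫ t in (S.T (S.prev j) - S.τ)..(S.T (S.prev j)),
        Φ (t + S.τ - S.T (S.prev j)) (F (S.prev j) t) := by
  have hTj := hT j
  have hsub : ∀ x ∈ Icc 0 (S.T j), ∀ y ∈ Icc 0 (S.T j),
      IntervalIntegrable (fun t => Φ t (S.del F j t)) volume x y := fun x hx y hy =>
    hi.mono_set (by rw [uIcc_of_le (S.T_pos j).le]; exact uIcc_subset_Icc hx hy)
  have m0 : (0 : ℝ) ∈ Icc 0 (S.T j) := ⟨le_rfl, (S.T_pos j).le⟩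
  have mτ : S.τ ∈ Icc 0 (S.T j) := ⟨hτ.le, hTj.le⟩
  have mT : S.T j ∈ Icc 0 (S.T j) := ⟨(S.T_pos j).le, le_rfl⟩
  rw [← intervalIntegral.integral_add_adjacent_intervals (hsub 0 m0 _ mτ) (hsub _ mτ _ mT),
    add_comm]
  congr 1
  · have h1 := intervalIntegral.integral_comp_add_right (a := 0) (b := S.T j - S.τ)
      (fun t => Φ t (F j (t - S.τ))) S.τ
    simp only [add_sub_cancel_right, zero_add, sub_add_cancel] at h1
    rw [h1]
    refine intervalIntegral_congr_Ioo hTj.le ?_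
    filter_upwards [ae_restrict_mem measurableSet_Ioo] with t htm
    simp [del, htm.1.le]
  · set p := S.prev j
    have h1 := intervalIntegral.integral_comp_add_right (a := S.T p - S.τ) (b := S.T p)
      (fun t => Φ t (F p (t - S.τ + S.T p))) (S.τ - S.T p)
    have e1 : S.T p - S.τ + (S.τ - S.T p) = 0 := by ring
    have e2 : S.T p + (S.τ - S.T p) = S.τ := by ring
    have e3 : ∀ t : ℝ, t + (S.τ - S.T p) - S.τ + S.T p = t := fun t => by ring
    simp only [e1, e2, e3] at h1
    simp only [add_sub_assoc]
    rw [h1]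
    refine intervalIntegral_congr_Ioo hτ.le ?_
    filter_upwards [ae_restrict_mem measurableSet_Ioo] with t htm
    simp [del, hj, not_le.2 htm.2, p]

/-- On the root edge the piece over `(-τ, 0)` drops out because `F` vanishes there. The formula
serves twice: with a weighted square for `Φ` in the coercivity estimate, and with a product with a
conjugate in the computation of the adjoint. -/
theorem integral_del (hτ : 0 < S.τ) (hT : ∀ j, S.τ < S.T j) (j : E)
    (hF : ∀ t ∈ Ioo (-S.τ) 0, F S.root t = 0) (hΦ : ∀ t, Φ t 0 = 0)
    (hi : IntervalIntegrable (fun t => Φ t (S.del F j t)) volume 0 (S.T j)) :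
    ∫ t in (0 : ℝ)..(S.T j), Φ t (S.del F j t) =
      (∫ t in (0 : ℝ)..(S.T j - S.τ), Φ (t + S.τ) (F j t)) +
      if j = S.root then 0 else ∫ t in (S.T (S.prev j) - S.τ)..(S.T (S.prev j)),
        Φ (t + S.τ - S.T (S.prev j)) (F (S.prev j) t) := by
  by_cases hj : j = S.root
  · subst hj
    have hTj := hT S.root
    rw [if_pos rfl, add_zero, integral_del_root]
    have hz : ∀ᵐ t ∂volume.restrict (Ioo (-S.τ) 0), Φ (t + S.τ) (F S.root t) = (fun _ => 0) t := by
      filter_upwards [ae_restrict_mem measurableSet_Ioo] with t htm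
      rw [hF t htm, hΦ]
    have i1 : IntervalIntegrable (fun t => Φ (t + S.τ) (F S.root t)) volume
        (-S.τ) (S.T S.root - S.τ) := by
      have := hi.comp_add_right S.τ
      simpa [del] using this
    have hsub : ∀ x ∈ Icc (-S.τ) (S.T S.root - S.τ), ∀ y ∈ Icc (-S.τ) (S.T S.root - S.τ),
        IntervalIntegrable (fun t => Φ (t + S.τ) (F S.root t)) volume x y := fun x hx y hy =>
      i1.mono_set ((uIcc_subset_Icc hx hy).trans Icc_subset_uIcc)
    have m0 : (0 : ℝ) ∈ Icc (-S.τ) (S.T S.root - S.τ) := ⟨by linarith, by linarith⟩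
    rw [← intervalIntegral.integral_add_adjacent_intervals
      (hsub _ ⟨le_rfl, by linarith⟩ 0 m0) (hsub 0 m0 _ ⟨by linarith, le_rfl⟩),
      intervalIntegral_congr_Ioo (by linarith) hz]
    simp
  · rw [if_neg hj, integral_del_of_ne hτ hT hj hi]

end Integral

end DelaySystem
end TreeDamping

namespace TreeDamping

variable {E : Type*} [DecidableEq E]

namespace DelaySystem

variable {S : DelaySystem E}

/-! ### Derivatives on the extended tree -/

theorem delayed_eq_del (y : E → ℝ → ℂ) (k : ℕ) (j : E) (t : ℝ) :
    S.delayed y k j t = S.del (S.D y k) j t := rfl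

theorem MemW.isPrim (hτ : 0 < S.τ) {y : E → ℝ → ℂ} (hy : S.MemW y) {k : ℕ} (hk : k < S.n) (j : E) :
    IsPrim (S.lo j) (S.T j) (S.D y k j) (S.D y (k + 1) j) :=
  (hy j).isPrim (lo_lt hτ j).le hk

theorem MemW.isPrim_zero (hτ : 0 < S.τ) {y : E → ℝ → ℂ} (hy : S.MemW y) {k : ℕ} (hk : k < S.n)
    (j : E) : IsPrim 0 (S.T j) (S.D y k j) (S.D y (k + 1) j) :=
  (hy.isPrim hτ hk j).mono (lo_nonpos hτ j) (S.T_pos j).le le_rfl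

theorem MemW.memLp (hτ : 0 < S.τ) {y : E → ℝ → ℂ} (hy : S.MemW y) {k : ℕ} (hk : k ≤ S.n) (j : E) :
    MemLp (S.D y k j) 2 (volume.restrict (Ioo (S.lo j) (S.T j))) := by
  rcases hk.lt_or_eq with hk | rfl
  · exact (hy.isPrim hτ hk j).memLp 2
  · exact (hy j).2

theorem MemW.memLp_zero (hτ : 0 < S.τ) {y : E → ℝ → ℂ} (hy : S.MemW y) {k : ℕ} (hk : k ≤ S.n)
    (j : E) : MemLp (S.D y k j) 2 (volume.restrict (Ioo 0 (S.T j))) :=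
  memLp_Ioo_mono (lo_nonpos hτ j) le_rfl (hy.memLp hτ hk j)

theorem MemW.memLp_delayed (hτ : 0 < S.τ) (hT : ∀ j, S.τ < S.T j) {y : E → ℝ → ℂ} (hy : S.MemW y)
    {k : ℕ} (hk : k ≤ S.n) (j : E) :
    MemLp (S.delayed y k j) 2 (volume.restrict (Ioo 0 (S.T j))) :=
  memLp_del hτ hT (fun j => hy.memLp hτ hk j) j

/-- Functions on the tree are constructed by giving all their derivatives as a chain of primitives.
Vertex and initial conditions need the pointwise identity below order `n`; integrals only need the
identity almost everywhere. -/
theorem memW_of_jet (hτ : 0 < S.τ) {y : E → ℝ → ℂ} {F : ℕ → E → ℝ → ℂ}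
    (hF : ∀ j, IsJet S.n (S.lo j) (S.T j) fun k => F k j)
    (hp : ∀ j, MemLp (F S.n j) 2 (volume.restrict (Ioo (S.lo j) (S.T j))))
    (hy : ∀ j, EqOn (y j) (F 0 j) (S.dom j)) :
    S.MemW y ∧ (∀ k < S.n, ∀ j, EqOn (S.D y k j) (F k j) (S.dom j)) ∧
      ∀ k ≤ S.n, ∀ j, ∀ᵐ t ∂volume.restrict (Ioo (S.lo j) (S.T j)), S.D y k j t = F k j t :=
  ⟨fun j => (hF j).memSobolev (lo_lt hτ j) (hy j) (hp j),
    fun k hk j => (hF j).eqOn_iteratedDerivWithin (lo_lt hτ j) (hy j) hk,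
    fun k hk j => by
      filter_upwards [(hF j).ae_iteratedDerivWithin (lo_lt hτ j) (hy j) hk] with t ht
      exact ht.symm⟩

theorem D_add_mul (hτ : 0 < S.τ) {y z : E → ℝ → ℂ} (hy : S.MemW y) (hz : S.MemW z) (c : ℂ) :
    S.MemW (fun j t => y j t + c * z j t) ∧
      (∀ k < S.n, ∀ j, ∀ t ∈ S.dom j,
        S.D (fun j t => y j t + c * z j t) k j t = S.D y k j t + c * S.D z k j t) ∧
      ∀ k ≤ S.n, ∀ j, ∀ᵐ t ∂volume.restrict (Ioo (S.lo j) (S.T j)),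
        S.D (fun j t => y j t + c * z j t) k j t = S.D y k j t + c * S.D z k j t :=
  memW_of_jet hτ (F := fun k j t => S.D y k j t + c * S.D z k j t)
    (fun j _ hk => (hy.isPrim hτ hk j).add ((hz.isPrim hτ hk j).const_mul c))
    (fun j => (hy.memLp hτ le_rfl j).add ((hz.memLp hτ le_rfl j).const_mul c))
    (fun j t _ => by simp [D])

/-- Linearity of `ℓ` holds only almost everywhere, because derivatives of order `n` may fail to
exist on a null set. -/
theorem ell_add_mul (hτ : 0 < S.τ) (hT : ∀ j, S.τ < S.T j) {y z : E → ℝ → ℂ}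
    (hy : S.MemW y) (hz : S.MemW z) (c : ℂ) (j : E) :
    ∀ᵐ t ∂volume.restrict (Ioo 0 (S.T j)),
      S.ell (fun j t => y j t + c * z j t) j t = S.ell y j t + c * S.ell z j t := by
  obtain ⟨-, -, h⟩ := D_add_mul hτ hy hz c
  have h1 : ∀ᵐ t ∂volume.restrict (Ioo 0 (S.T j)), ∀ k ∈ Finset.range (S.n + 1),
      S.D (fun j t => y j t + c * z j t) k j t = S.D y k j t + c * S.D z k j t :=
    (Finset.eventually_all _).2 fun k hk =>
      ae_Ioo_mono (lo_nonpos hτ j) le_rfl (h k (by simpa [Nat.lt_succ_iff] using hk) j)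
  have h2 : ∀ᵐ t ∂volume.restrict (Ioo 0 (S.T j)), ∀ k ∈ Finset.range (S.n + 1),
      S.delayed (fun j t => y j t + c * z j t) k j t = S.delayed y k j t + c * S.delayed z k j t :=
    (Finset.eventually_all _).2 fun k hk => by
      filter_upwards [ae_del hτ hT (h k (by simpa [Nat.lt_succ_iff] using hk)) j] with t ht
      rw [delayed_eq_del, delayed_eq_del, delayed_eq_del, ht]
      unfold del; split_ifs <;> rfl
  filter_upwards [h1, h2] with t ht1 ht2
  simp only [ell, Finset.mul_sum, ← Finset.sum_add_distrib]
  refine Finset.sum_congr rfl fun k hk => ?_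
  rw [ht1 k hk, ht2 k hk]; ring

theorem mem_dom_of_mem (hτ : 0 < S.τ) {j : E} {t : ℝ} (ht : t ∈ Icc 0 (S.T j)) : t ∈ S.dom j :=
  ⟨(lo_nonpos hτ j).trans ht.1, ht.2⟩

theorem Icc_neg_subset_dom {t : ℝ} (ht : t ∈ Icc (-S.τ) 0) : t ∈ S.dom S.root :=
  ⟨by rw [lo_root]; exact ht.1, ht.2.trans (S.T_pos _).le⟩

/-! ### Functions with vanishing history -/

/-- `w ∈ W_2^n` is continuous at the inner vertices and has a vanishing history. -/
structure ZeroHist (S : DelaySystem E) (w : E → ℝ → ℂ) : Prop where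
  memW : S.MemW w
  glue : ∀ j, j ≠ S.root → ∀ k < S.n, S.D w k j 0 = S.D w k (S.prev j) (S.T (S.prev j))
  history : ∀ t ∈ Ioo (-S.τ) 0, w S.root t = 0
  initial : ∀ k < S.n, S.D w k S.root 0 = 0

theorem ZeroHist.D_neg {w : E → ℝ → ℂ} (hw : S.ZeroHist w) (k : ℕ) {t : ℝ}
    (ht : t ∈ Ioo (-S.τ) 0) : S.D w k S.root t = 0 := by
  have := iteratedDerivWithin_eqOn_open (f := w S.root) (g := fun _ => 0) (s := S.dom S.root)
    (t := S.dom S.root) isOpen_Ioo (fun t ht => Icc_neg_subset_dom (Ioo_subset_Icc_self ht))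
    (fun t ht => Icc_neg_subset_dom (Ioo_subset_Icc_self ht)) hw.history k ht
  rw [D, this]
  simp

/-- The history is prescribed on an open interval only. The end points are reached by integrating
back from the zero initial values at `0`. -/
theorem ZeroHist.D_neg_closed (hτ : 0 < S.τ) {w : E → ℝ → ℂ} (hw : S.ZeroHist w) {k : ℕ}
    (hk : k < S.n) {t : ℝ} (ht : t ∈ Icc (-S.τ) 0) : S.D w k S.root t = 0 := by
  have hj : IsJet S.n (-S.τ) 0 fun k => S.D w k S.root := fun k hk => by
    have := hw.memW.isPrim hτ hk S.root
    rw [lo_root] at this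
    exact this.mono le_rfl (by linarith) (S.T_pos _).le
  refine hj.eq_zero (c := 0) ⟨by linarith, le_rfl⟩ hw.initial ?_ hk t ht
  filter_upwards [ae_restrict_mem measurableSet_Ioo] with t ht using hw.D_neg _ ht

theorem Admissible.zeroHist [Fintype E] {w : E → ℝ → ℂ} (hw : S.Admissible (fun _ => 0) w) :
    S.ZeroHist w :=
  ⟨hw.memW, hw.glue, hw.history, fun k hk => by
    rw [hw.initial k hk]; simp⟩

theorem ZeroHist.admissible [Fintype E] {w : E → ℝ → ℂ} (hw : S.ZeroHist w)
    (hr : ∀ j, S.IsLeaf j → ∀ t ∈ Icc (S.T j - S.τ) (S.T j), w j t = 0) :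
    S.Admissible (fun _ => 0) w :=
  ⟨hw.memW, hw.glue, hw.history, fun k hk => by
    rw [hw.initial k hk]; simp, hr⟩

theorem Admissible.add_mul [Fintype E] (hτ : 0 < S.τ) {φ : ℝ → ℂ} {y w : E → ℝ → ℂ}
    (hy : S.Admissible φ y) (hw : S.Admissible (fun _ => 0) w) (c : ℂ) :
    S.Admissible φ (fun j t => y j t + c * w j t) := by
  obtain ⟨h1, h2, -⟩ := D_add_mul hτ hy.memW hw.memW c
  have m0 : ∀ j, (0 : ℝ) ∈ S.dom j := fun j => mem_dom_of_mem hτ ⟨le_rfl, (S.T_pos j).le⟩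
  have mT : ∀ j, S.T j ∈ S.dom j := fun j => mem_dom_of_mem hτ ⟨(S.T_pos j).le, le_rfl⟩
  refine ⟨h1, fun j hj k hk => ?_, fun t ht => ?_, fun k hk => ?_, fun j hj t ht => ?_⟩
  · rw [h2 k hk j _ (m0 j), h2 k hk _ _ (mT _), hy.glue j hj k hk, hw.glue j hj k hk]
  · simp [hy.history t ht, hw.history t ht]
  · rw [h2 k hk _ _ (m0 _), hy.initial k hk, hw.zeroHist.initial k hk]; ring
  · simp [hy.rest j hj t ht, hw.rest j hj t ht]

theorem Admissible.sub [Fintype E] (hτ : 0 < S.τ) {φ : ℝ → ℂ} {y z : E → ℝ → ℂ}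
    (hy : S.Admissible φ y) (hz : S.Admissible φ z) :
    S.Admissible (fun _ => 0) (fun j t => y j t + (-1) * z j t) := by
  obtain ⟨h1, h2, -⟩ := D_add_mul hτ hy.memW hz.memW (-1)
  have m0 : ∀ j, (0 : ℝ) ∈ S.dom j := fun j => mem_dom_of_mem hτ ⟨le_rfl, (S.T_pos j).le⟩
  have mT : ∀ j, S.T j ∈ S.dom j := fun j => mem_dom_of_mem hτ ⟨(S.T_pos j).le, le_rfl⟩
  refine ZeroHist.admissible ⟨h1, fun j hj k hk => ?_, fun t ht => ?_, fun k hk => ?_⟩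
    (fun j hj t ht => ?_)
  · rw [h2 k hk j _ (m0 j), h2 k hk _ _ (mT _), hy.glue j hj k hk, hz.glue j hj k hk]
  · simp [hy.history t ht, hz.history t ht]
  · rw [h2 k hk _ _ (m0 _), hy.initial k hk, hz.initial k hk]; ring
  · simp [hy.rest j hj t ht, hz.rest j hj t ht]

theorem ZeroHist.sub (hτ : 0 < S.τ) {y z : E → ℝ → ℂ} (hy : S.ZeroHist y) (hz : S.ZeroHist z) :
    S.ZeroHist (fun j t => y j t + (-1) * z j t) := by
  obtain ⟨h1, h2, -⟩ := D_add_mul hτ hy.memW hz.memW (-1)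
  have m0 : ∀ j, (0 : ℝ) ∈ S.dom j := fun j => mem_dom_of_mem hτ ⟨le_rfl, (S.T_pos j).le⟩
  have mT : ∀ j, S.T j ∈ S.dom j := fun j => mem_dom_of_mem hτ ⟨(S.T_pos j).le, le_rfl⟩
  refine ⟨h1, fun j hj k hk => ?_, fun t ht => ?_, fun k hk => ?_⟩
  · rw [h2 k hk j _ (m0 j), h2 k hk _ _ (mT _), hy.glue j hj k hk, hz.glue j hj k hk]
  · simp [hy.history t ht, hz.history t ht]
  · rw [h2 k hk _ _ (m0 _), hy.initial k hk, hz.initial k hk]; ring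

theorem memLp_indicator_Ioo {v : ℝ → ℂ} {a b c d : ℝ}
    (hv : MemLp v 2 (volume.restrict (Ioo c d))) :
    MemLp ((Ioo c d).indicator v) 2 (volume.restrict (Ioo a b)) := by
  refine MemLp.mono_measure Measure.restrict_le_self ?_
  rwa [memLp_indicator_iff_restrict measurableSet_Ioo]

/-- A square integrable function is the highest derivative of a function with zero history. -/
theorem exists_zeroHist (hn : 1 ≤ S.n) (hτ : 0 < S.τ) {v : E → ℝ → ℂ}
    (hv : ∀ j, MemLp (v j) 2 (volume.restrict (Ioo 0 (S.T j)))) :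
    ∃ w, S.ZeroHist w ∧
      ∀ j, ∀ᵐ t ∂volume.restrict (Ioo 0 (S.T j)), S.D w S.n j t = v j t := by
  -- Extension by zero makes the chain based at `0` vanish on the history interval.
  set u : E → ℝ → ℂ := fun j => (Ioo 0 (S.T j)).indicator (v j) with hu
  -- `a j` collects the derivatives at the beginning of the edge `j`: zero at the root, otherwise
  -- the end values of the chain on the preceding edge.
  obtain ⟨a, ha0, ha⟩ := S.toTimeTree.exists_forward (α := ℕ → ℂ) (fun _ => 0)
    (fun j b k => jetOf S.n 0 b (u (S.prev j)) k (S.T (S.prev j)))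
  set F : ℕ → E → ℝ → ℂ := fun k j => jetOf S.n 0 (a j) (u j) k with hF
  have hu2 : ∀ j, MemLp (u j) 2 (volume.restrict (Ioo (S.lo j) (S.T j))) := fun j =>
    memLp_indicator_Ioo (hv j)
  have m0' : ∀ j, (0 : ℝ) ∈ S.dom j := fun j => mem_dom_of_mem hτ ⟨le_rfl, (S.T_pos j).le⟩
  have mT' : ∀ j, S.T j ∈ S.dom j := fun j => mem_dom_of_mem hτ ⟨(S.T_pos j).le, le_rfl⟩
  have hjet : ∀ j, IsJet S.n (S.lo j) (S.T j) fun k => F k j := fun j =>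
    isJet_jetOf (m0' j) _ ((intervalIntegrable_iff_Ioo (lo_lt hτ j).le).2
      ((hu2 j).integrable (by norm_num)))
  obtain ⟨h1, h2, h3⟩ := memW_of_jet hτ (y := F 0) hjet (by simpa [hF, jetOf_top] using hu2)
    (fun j t _ => rfl)
  have hz : IsJet S.n (-S.τ) 0 fun k => F k S.root := fun k hk => by
    have := hjet S.root k hk
    rw [lo_root] at this
    exact this.mono le_rfl (by linarith) (S.T_pos _).le
  refine ⟨F 0, ⟨h1, fun j hj k hk => ?_, fun t ht => ?_, fun k hk => ?_⟩, fun j => ?_⟩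
  · rw [h2 k hk j (m0' j), h2 k hk _ (mT' _)]
    simp only [hF]
    rw [jetOf_base hk, ha j hj]
  · refine hz.eq_zero (c := 0) ⟨by linarith, le_rfl⟩ (fun k hk => ?_) ?_ hn t
      (Ioo_subset_Icc_self ht)
    · simp only [hF]; rw [jetOf_base hk]; exact congrFun ha0 k
    · filter_upwards [ae_restrict_mem measurableSet_Ioo] with t ht
      simp only [hF, jetOf_top, hu]
      exact indicator_of_notMem (fun h => lt_asymm h.1 ht.2) _
  · rw [h2 k hk _ (m0' _)]
    simp only [hF]; rw [jetOf_base hk]; exact congrFun ha0 k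
  · filter_upwards [ae_Ioo_mono (lo_nonpos hτ j) le_rfl (h3 S.n le_rfl j),
      ae_restrict_mem measurableSet_Ioo] with t ht htm
    rw [ht]
    simp only [hF, jetOf_top, hu]
    exact indicator_of_mem htm _

end DelaySystem
end TreeDamping

namespace TreeDamping

/-! ### Square integrability of `ℓ y` and boundedness of the energy -/

theorem exists_ae_bound {f : ℝ → ℂ} {μ : Measure ℝ} (hf : MemLp f ∞ μ) :
    ∃ C : ℝ, 0 ≤ C ∧ ∀ᵐ t ∂μ, ‖f t‖ ≤ C := by
  refine ⟨(eLpNormEssSup f μ).toReal, ENNReal.toReal_nonneg, ?_⟩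
  have h : eLpNormEssSup f μ ≠ ∞ := by
    have := hf.2; rw [eLpNorm_exponent_top] at this; exact this.ne
  filter_upwards [ae_le_eLpNormEssSup (f := f) (μ := μ)] with t ht
  rw [← toReal_enorm]
  exact ENNReal.toReal_mono h ht

theorem intervalIntegral_mono_Ioo {f g : ℝ → ℝ} {a b : ℝ} (hab : a ≤ b)
    (hf : ∀ᵐ t ∂volume.restrict (Ioo a b), 0 ≤ f t)
    (hg : Integrable g (volume.restrict (Ioo a b)))
    (h : ∀ᵐ t ∂volume.restrict (Ioo a b), f t ≤ g t) :
    ∫ t in a..b, f t ≤ ∫ t in a..b, g t := by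
  rw [intervalIntegral.integral_of_le hab, intervalIntegral.integral_of_le hab,
    ← restrict_Ioo_eq_restrict_Ioc]
  exact integral_mono_of_nonneg hf hg h

theorem norm_add_three_sq_le (x y z : ℂ) :
    ‖x + y + z‖ ^ 2 ≤ 3 * (‖x‖ ^ 2 + ‖y‖ ^ 2 + ‖z‖ ^ 2) := by
  have h1 : ‖x + y + z‖ ≤ ‖x‖ + ‖y‖ + ‖z‖ := norm_add₃_le
  have h2 : ‖x + y + z‖ ^ 2 ≤ (‖x‖ + ‖y‖ + ‖z‖) ^ 2 := by gcongr
  nlinarith [sq_nonneg (‖x‖ - ‖y‖), sq_nonneg (‖x‖ - ‖z‖), sq_nonneg (‖y‖ - ‖z‖)]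

theorem norm_add_sq_le (x y : ℂ) : ‖x + y‖ ^ 2 ≤ 2 * (‖x‖ ^ 2 + ‖y‖ ^ 2) := by
  have h2 : ‖x + y‖ ^ 2 ≤ (‖x‖ + ‖y‖) ^ 2 := by gcongr; exact norm_add_le _ _
  nlinarith [sq_nonneg (‖x‖ - ‖y‖)]

theorem norm_sum_range_sq_le (n : ℕ) (f : ℕ → ℂ) :
    ‖∑ k ∈ Finset.range n, f k‖ ^ 2 ≤ n * ∑ k ∈ Finset.range n, ‖f k‖ ^ 2 := by
  have h1 : ‖∑ k ∈ Finset.range n, f k‖ ^ 2 ≤ (∑ k ∈ Finset.range n, ‖f k‖) ^ 2 := by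
    gcongr; exact norm_sum_le _ _
  refine h1.trans ?_
  simpa using sq_sum_le_card_mul_sum_sq (s := Finset.range n) (f := fun k => ‖f k‖)

variable {E : Type*} [DecidableEq E]

namespace DelaySystem

variable {S : DelaySystem E}

theorem del_of_forall {X : Type*} (hτ : 0 < S.τ) (hT : ∀ j, S.τ < S.T j) {F : E → ℝ → X}
    {P : X → Prop} (h : ∀ j, ∀ t ∈ S.dom j, P (F j t)) {j : E} {t : ℝ} (ht : t ∈ Icc 0 (S.T j)) :
    P (S.del F j t) := by
  unfold del
  split_ifs with hc
  · refine h j _ ⟨?_, by linarith [ht.2]⟩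
    by_cases hj : j = S.root
    · rw [hj, lo_root]; linarith [ht.1]
    · rw [lo_of_ne S hj]; linarith [hc.resolve_left hj]
  · rw [not_or, not_le] at hc
    exact h _ _ (mem_dom_of_mem hτ ⟨by linarith [ht.1, hT (S.prev j)], by linarith [hc.2]⟩)

/-- The terms of `ℓ_j y` of order less than `n`. -/
def ellLow (S : DelaySystem E) (y : E → ℝ → ℂ) (j : E) (t : ℝ) : ℂ :=
  ∑ k ∈ Finset.range S.n, (S.b k j t * S.D y k j t + S.c k j t * S.delayed y k j t)

theorem ell_eq (y : E → ℝ → ℂ) (j : E) (t : ℝ) : S.ell y j t =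
    S.ellLow y j t + S.b S.n j t * S.D y S.n j t + S.c S.n j t * S.delayed y S.n j t := by
  rw [ell, Finset.sum_range_succ, ellLow, add_assoc]

theorem MemW.exists_bound [Fintype E] (hτ : 0 < S.τ) {y : E → ℝ → ℂ} (hy : S.MemW y) {k : ℕ}
    (hk : k < S.n) : ∃ C : ℝ, ∀ j, ∀ t ∈ S.dom j, ‖S.D y k j t‖ ≤ C := by
  choose C hC0 hC using fun j => (hy.isPrim hτ hk j).exists_bound
  exact ⟨∑ j, C j, fun j t ht => (hC j t ht).trans
    (Finset.single_le_sum (fun i _ => hC0 i) (Finset.mem_univ j))⟩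

theorem MemW.memLp_top [Fintype E] (hτ : 0 < S.τ) {y : E → ℝ → ℂ}
    (hy : S.MemW y) {k : ℕ} (hk : k < S.n) (j : E) :
    MemLp (S.D y k j) ∞ (volume.restrict (Ioo 0 (S.T j))) :=
  (hy.isPrim_zero hτ hk j).memLp ∞

theorem MemW.memLp_top_delayed [Fintype E] (hτ : 0 < S.τ) (hT : ∀ j, S.τ < S.T j) {y : E → ℝ → ℂ}
    (hy : S.MemW y) {k : ℕ} (hk : k < S.n) (j : E) :
    MemLp (S.delayed y k j) ∞ (volume.restrict (Ioo 0 (S.T j))) := by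
  obtain ⟨C, hC⟩ := hy.exists_bound hτ hk
  refine MemLp.of_bound (hy.memLp_delayed hτ hT hk.le j).1 C ?_
  filter_upwards [ae_restrict_mem measurableSet_Ioo] with t ht
  exact del_of_forall (P := fun x => ‖x‖ ≤ C) hτ hT hC (Ioo_subset_Icc_self ht)

/-- For `k < n` an `L_2` coefficient multiplies a bounded derivative; for `k = n` an `L_∞`
coefficient multiplies an `L_2` derivative. -/
theorem memLp_b_mul [Fintype E] (hτ : 0 < S.τ) (hS : S.RegularCoefficients) {y : E → ℝ → ℂ}
    (hy : S.MemW y) {k : ℕ} (hk : k ≤ S.n) (j : E) :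
    MemLp (fun t => S.b k j t * S.D y k j t) 2 (volume.restrict (Ioo 0 (S.T j))) := by
  rcases hk.lt_or_eq with hk | rfl
  · exact (hy.memLp_top hτ hk j).mul (hS.b_low j k hk)
  · exact (hy.memLp_zero hτ le_rfl j).mul (hS.b_top j)

theorem memLp_c_mul [Fintype E] (hτ : 0 < S.τ) (hT : ∀ j, S.τ < S.T j) (hS : S.RegularCoefficients)
    {y : E → ℝ → ℂ} (hy : S.MemW y) {k : ℕ} (hk : k ≤ S.n) (j : E) :
    MemLp (fun t => S.c k j t * S.delayed y k j t) 2 (volume.restrict (Ioo 0 (S.T j))) := by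
  rcases hk.lt_or_eq with hk | rfl
  · exact (hy.memLp_top_delayed hτ hT hk j).mul (hS.c_low j k hk)
  · exact (hy.memLp_delayed hτ hT le_rfl j).mul (hS.c_top j)

theorem memLp_ell [Fintype E] (hτ : 0 < S.τ) (hT : ∀ j, S.τ < S.T j) (hS : S.RegularCoefficients)
    {y : E → ℝ → ℂ} (hy : S.MemW y) (j : E) :
    MemLp (S.ell y j) 2 (volume.restrict (Ioo 0 (S.T j))) := by
  have := memLp_finsetSum (Finset.range (S.n + 1)) (μ := volume.restrict (Ioo 0 (S.T j))) (p := 2)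
    (f := fun k t => S.b k j t * S.D y k j t + S.c k j t * S.delayed y k j t) fun k hk => by
      have hk' : k ≤ S.n := by simpa [Nat.lt_succ_iff] using hk
      exact (memLp_b_mul hτ hS hy hk' j).add (memLp_c_mul hτ hT hS hy hk' j)
  exact this

theorem memLp_ellLow [Fintype E] (hτ : 0 < S.τ) (hT : ∀ j, S.τ < S.T j)
    (hS : S.RegularCoefficients) {y : E → ℝ → ℂ} (hy : S.MemW y) (j : E) :
    MemLp (S.ellLow y j) 2 (volume.restrict (Ioo 0 (S.T j))) := by
  have := memLp_finsetSum (Finset.range S.n) (μ := volume.restrict (Ioo 0 (S.T j))) (p := 2)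
    (f := fun k t => S.b k j t * S.D y k j t + S.c k j t * S.delayed y k j t) fun k hk => by
      have hk' : k ≤ S.n := (Finset.mem_range.1 hk).le
      exact (memLp_b_mul hτ hS hy hk' j).add (memLp_c_mul hτ hT hS hy hk' j)
  exact this

/-- The bound of `1 / b_n` is stored as `1 ≤ B * ‖b_n‖`. This requires `b_n ≠ 0` almost everywhere,
since `1 / 0 = 0` would satisfy any bound of the quotient. -/
theorem exists_coeff_bound [Fintype E] (hS : S.RegularCoefficients) :
    ∃ B : ℝ, 0 < B ∧ ∀ j, ∀ᵐ t ∂volume.restrict (Ioo 0 (S.T j)),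
      ‖S.b S.n j t‖ ≤ B ∧ ‖S.c S.n j t‖ ≤ B ∧ 1 ≤ B * ‖S.b S.n j t‖ := by
  choose B1 h10 h1 using fun j => exists_ae_bound (hS.b_top j)
  choose B2 h20 h2 using fun j => exists_ae_bound (hS.c_top j)
  choose B3 h30 h3 using fun j => exists_ae_bound (hS.b_top_inv j)
  have h0 : 0 ≤ ∑ j, (B1 j + B2 j + B3 j) :=
    Finset.sum_nonneg fun j _ => by have := h10 j; have := h20 j; have := h30 j; positivity
  refine ⟨1 + ∑ j, (B1 j + B2 j + B3 j), by linarith, fun j => ?_⟩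
  have hle : B1 j + B2 j + B3 j ≤ ∑ j, (B1 j + B2 j + B3 j) :=
    Finset.single_le_sum (f := fun j => B1 j + B2 j + B3 j)
      (fun i _ => by have := h10 i; have := h20 i; have := h30 i; positivity) (Finset.mem_univ j)
  have := h10 j; have := h20 j; have := h30 j
  filter_upwards [h1 j, h2 j, h3 j, hS.b_top_ne_zero j] with t e1 e2 e3 e4
  refine ⟨by linarith, by linarith, ?_⟩
  rw [norm_div, norm_one, div_le_iff₀ (norm_pos_iff.2 e4)] at e3
  refine e3.trans ?_
  gcongr
  linarith

/-- The constant in the estimate of the terms of low order. -/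
def lowConst (S : DelaySystem E) (j : E) : ℝ :=
  ∫ t in (0 : ℝ)..(S.T j), 2 * S.n * ∑ k ∈ Finset.range S.n, (‖S.b k j t‖ ^ 2 + ‖S.c k j t‖ ^ 2)

theorem lowConst_nonneg (j : E) : 0 ≤ S.lowConst j :=
  intervalIntegral.integral_nonneg (S.T_pos j).le fun _ _ => by positivity

/-- Low-order derivatives enter through a pointwise bound and the coefficients through their `L_2`
norms. The weight `ω` is `1` for boundedness of the energy and exponential for coercivity. -/
theorem integral_ellLow_le (hS : S.RegularCoefficients) {y : E → ℝ → ℂ} {j : E} {ω : ℝ → ℝ}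
    (hω : ∀ t, 0 ≤ ω t) {s : ℝ}
    (h : ∀ k < S.n, ∀ t ∈ Ioo 0 (S.T j), ω t * ‖S.D y k j t‖ ^ 2 ≤ s ∧
      ω t * ‖S.delayed y k j t‖ ^ 2 ≤ s) :
    ∫ t in (0 : ℝ)..(S.T j), ω t * ‖S.ellLow y j t‖ ^ 2 ≤ s * S.lowConst j := by
  rw [lowConst, ← intervalIntegral.integral_const_mul]
  refine intervalIntegral_mono_Ioo (S.T_pos j).le
    (Filter.Eventually.of_forall fun t => mul_nonneg (hω t) (by positivity)) ?_ ?_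
  · refine Integrable.const_mul (Integrable.const_mul (integrable_finsetSum _ fun k hk => ?_) _) _
    have hk := Finset.mem_range.1 hk
    exact (memLp_two_integrable_sq (hS.b_low j k hk)).add (memLp_two_integrable_sq (hS.c_low j k hk))
  · filter_upwards [ae_restrict_mem measurableSet_Ioo] with t ht
    calc ω t * ‖S.ellLow y j t‖ ^ 2
        ≤ ω t * (S.n * ∑ k ∈ Finset.range S.n,
            ‖S.b k j t * S.D y k j t + S.c k j t * S.delayed y k j t‖ ^ 2) :=
          mul_le_mul_of_nonneg_left (norm_sum_range_sq_le _ _) (hω t)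
      _ = S.n * ∑ k ∈ Finset.range S.n,
            ω t * ‖S.b k j t * S.D y k j t + S.c k j t * S.delayed y k j t‖ ^ 2 := by
          rw [Finset.mul_sum, Finset.mul_sum, Finset.mul_sum]
          exact Finset.sum_congr rfl fun k _ => by ring
      _ ≤ S.n * ∑ k ∈ Finset.range S.n, 2 * s * (‖S.b k j t‖ ^ 2 + ‖S.c k j t‖ ^ 2) := by
          refine mul_le_mul_of_nonneg_left (Finset.sum_le_sum fun k hk => ?_) (Nat.cast_nonneg _)
          obtain ⟨e1, e2⟩ := h k (Finset.mem_range.1 hk) t ht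
          have e3 := mul_le_mul_of_nonneg_left
            (norm_add_sq_le (S.b k j t * S.D y k j t) (S.c k j t * S.delayed y k j t)) (hω t)
          rw [norm_mul, norm_mul, mul_pow, mul_pow] at e3
          have e4 := mul_le_mul_of_nonneg_left e1 (sq_nonneg ‖S.b k j t‖)
          have e5 := mul_le_mul_of_nonneg_left e2 (sq_nonneg ‖S.c k j t‖)
          linarith
      _ = _ := by rw [← Finset.mul_sum]; ring

/-- The delayed argument runs at most once through a piece of the edge `j` and once through a piece
of the preceding edge. On the root edge the second term is superfluous. -/
theorem integral_sq_delayed_le (hτ : 0 < S.τ) (hT : ∀ j, S.τ < S.T j) {y : E → ℝ → ℂ}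
    (hy : S.MemW y) (j : E) :
    ∫ t in (0 : ℝ)..(S.T j), ‖S.delayed y S.n j t‖ ^ 2 ≤
      (∫ t in (S.lo j)..(S.T j), ‖S.D y S.n j t‖ ^ 2) +
      ∫ t in (S.lo (S.prev j))..(S.T (S.prev j)), ‖S.D y S.n (S.prev j) t‖ ^ 2 := by
  have hmono : ∀ i, ∀ a b : ℝ, S.lo i ≤ a → a ≤ b → b ≤ S.T i →
      ∫ t in a..b, ‖S.D y S.n i t‖ ^ 2 ≤ ∫ t in (S.lo i)..(S.T i), ‖S.D y S.n i t‖ ^ 2 := by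
    intro i a b ha hab hb
    refine intervalIntegral.integral_mono_interval ha hab hb
      (Filter.Eventually.of_forall fun _ => by positivity) ?_
    rw [intervalIntegrable_iff_integrableOn_Ioc_of_le (lo_lt hτ i).le, IntegrableOn,
      ← restrict_Ioo_eq_restrict_Ioc]
    exact memLp_two_integrable_sq (hy.memLp hτ le_rfl i)
  have hpos : ∀ i, 0 ≤ ∫ t in (S.lo i)..(S.T i), ‖S.D y S.n i t‖ ^ 2 := fun i =>
    intervalIntegral.integral_nonneg (lo_lt hτ i).le fun _ _ => by positivity
  by_cases hj : j = S.root
  · have h := integral_del_root (S := S) (Φ := fun _ x => ‖x‖ ^ 2) (F := S.D y S.n)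
    have hlt := hT S.root
    rw [hj]
    simp only [delayed_eq_del]
    rw [h, ← lo_root]
    have := hmono S.root (S.lo S.root) (S.T S.root - S.τ) le_rfl
      (by rw [lo_root]; linarith) (by linarith)
    linarith [hpos (S.prev S.root)]
  · have hi : IntervalIntegrable (fun t => ‖S.del (S.D y S.n) j t‖ ^ 2) volume 0 (S.T j) := by
      rw [intervalIntegrable_iff_integrableOn_Ioc_of_le (S.T_pos j).le, IntegrableOn,
        ← restrict_Ioo_eq_restrict_Ioc]
      exact memLp_two_integrable_sq (hy.memLp_delayed hτ hT le_rfl j)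
    have h := integral_del_of_ne (S := S) (Φ := fun _ x => ‖x‖ ^ 2) (F := S.D y S.n) hτ hT hj hi
    simp only [delayed_eq_del]
    rw [h]
    have h1 := hT j
    have h2 := hT (S.prev j)
    have h3 := lo_nonpos hτ (S.prev j)
    exact add_le_add (hmono j _ _ (lo_nonpos hτ j) (by linarith) (by linarith))
      (hmono _ _ _ (by linarith) (by linarith) le_rfl)

/-- The square of the norm of `W_2^n` of the extended tree. -/
def normSqW [Fintype E] (S : DelaySystem E) (y : E → ℝ → ℂ) : ℝ :=
  ∑ j, sobolevNormSq S.n (S.lo j) (S.T j) (y j)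

theorem integral_sq_nonneg {f : ℝ → ℂ} {a b : ℝ} (hab : a ≤ b) : 0 ≤ ∫ t in a..b, ‖f t‖ ^ 2 :=
  intervalIntegral.integral_nonneg hab fun _ _ => by positivity

theorem sobolevNormSq_nonneg {n : ℕ} {a b : ℝ} (hab : a ≤ b) (f : ℝ → ℂ) :
    0 ≤ sobolevNormSq n a b f :=
  Finset.sum_nonneg fun _ _ => integral_sq_nonneg hab

theorem integral_sq_D_le_normSqW [Fintype E] (hτ : 0 < S.τ) (y : E → ℝ → ℂ) (j : E) {k : ℕ}
    (hk : k ≤ S.n) : ∫ t in (S.lo j)..(S.T j), ‖S.D y k j t‖ ^ 2 ≤ S.normSqW y := by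
  refine le_trans ?_ (Finset.single_le_sum
    (fun i _ => sobolevNormSq_nonneg (lo_lt hτ i).le (y i)) (Finset.mem_univ j))
  exact Finset.single_le_sum
    (f := fun k => ∫ t in (S.lo j)..(S.T j), ‖iteratedDerivWithin k (y j) (S.dom j) t‖ ^ 2)
    (fun i _ => integral_sq_nonneg (lo_lt hτ j).le)
    (Finset.mem_range.2 (Nat.lt_succ_of_le hk))

theorem exists_trace_bound {n : ℕ} {a b : ℝ} (hab : a < b) :
    ∃ K : ℝ, 0 ≤ K ∧ ∀ f, MemSobolev 2 n a b f → ∀ k < n, ∀ t ∈ Icc a b,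
      ‖iteratedDerivWithin k f (Icc a b) t‖ ^ 2 ≤ K * sobolevNormSq n a b f := by
  have hd := sub_pos.2 hab
  refine ⟨2 * (2 / (b - a) + 2 * (b - a)), by positivity, fun f hf k hk t ht => ?_⟩
  have hm : MemLp (iteratedDerivWithin (k + 1) f (Icc a b)) 2 (volume.restrict (Ioo a b)) := by
    rcases (Nat.succ_le_of_lt hk).lt_or_eq with h | h
    · exact (hf.isPrim hab.le h).memLp 2
    · rw [← h] at hf; exact hf.2
  refine ((hf.isPrim hab.le hk).trace_sq_le hab hm ht).trans ?_
  have hle : ∀ i ≤ n, ∫ t in a..b, ‖iteratedDerivWithin i f (Icc a b) t‖ ^ 2 ≤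
      sobolevNormSq n a b f := fun i hi =>
    Finset.single_le_sum (f := fun k => ∫ t in a..b, ‖iteratedDerivWithin k f (Icc a b) t‖ ^ 2)
      (fun i _ => integral_sq_nonneg hab.le) (Finset.mem_range.2 (Nat.lt_succ_of_le hi))
  calc _ ≤ (2 / (b - a) + 2 * (b - a)) * (sobolevNormSq n a b f + sobolevNormSq n a b f) := by
        gcongr
        · exact hle k hk.le
        · exact hle (k + 1) hk
    _ = _ := by ring

theorem exists_sup_bound [Fintype E] (hτ : 0 < S.τ) :
    ∃ K : ℝ, 0 ≤ K ∧ ∀ y, S.MemW y → ∀ k < S.n, ∀ j, ∀ t ∈ S.dom j,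
      ‖S.D y k j t‖ ^ 2 ≤ K * S.normSqW y := by
  choose K hK0 hK using fun j => exists_trace_bound (n := S.n) (lo_lt hτ j)
  refine ⟨∑ j, K j, Finset.sum_nonneg fun j _ => hK0 j, fun y hy k hk j t ht => ?_⟩
  refine (hK j (y j) (hy j) k hk t ht).trans ?_
  refine mul_le_mul (Finset.single_le_sum (fun i _ => hK0 i) (Finset.mem_univ j))
    (Finset.single_le_sum (fun i _ => sobolevNormSq_nonneg (lo_lt hτ i).le (y i))
      (Finset.mem_univ j)) (sobolevNormSq_nonneg (lo_lt hτ j).le _)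
    (Finset.sum_nonneg fun j _ => hK0 j)

/-- The energy functional is bounded on `W_2^n`. -/
theorem exists_energy_le [Fintype E] (hτ : 0 < S.τ) (hT : ∀ j, S.τ < S.T j)
    (hS : S.RegularCoefficients) :
    ∃ C : ℝ, 0 ≤ C ∧ ∀ y, S.MemW y → S.energy y ≤ C * S.normSqW y := by
  obtain ⟨B, hB0, hB⟩ := exists_coeff_bound hS
  obtain ⟨K, hK0, hK⟩ := exists_sup_bound (S := S) hτ
  -- The factor `3` comes from squaring three terms; the last factor `2` counts the two edges
  -- visited by the delay.
  refine ⟨∑ j, 3 * (K * S.lowConst j + B ^ 2 + B ^ 2 * 2), Finset.sum_nonneg fun j _ => by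
    have := lowConst_nonneg (S := S) j; positivity, fun y hy => ?_⟩
  rw [energy, Finset.sum_mul]
  refine Finset.sum_le_sum fun j _ => ?_
  have hT0 := (S.T_pos j).le
  have I0 : ∫ t in (0 : ℝ)..(S.T j), ‖S.ellLow y j t‖ ^ 2 ≤ K * S.normSqW y * S.lowConst j := by
    have := integral_ellLow_le hS (y := y) (j := j) (ω := fun _ => 1) (s := K * S.normSqW y)
      (fun _ => zero_le_one) fun k hk t ht => ?_
    · simpa using this
    · rw [one_mul, one_mul]
      exact ⟨hK y hy k hk j t (mem_dom_of_mem hτ (Ioo_subset_Icc_self ht)),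
        del_of_forall (P := fun x => ‖x‖ ^ 2 ≤ K * S.normSqW y) hτ hT (hK y hy k hk)
          (Ioo_subset_Icc_self ht)⟩
  have I1 : ∫ t in (0 : ℝ)..(S.T j), ‖S.D y S.n j t‖ ^ 2 ≤ S.normSqW y := by
    refine le_trans ?_ (integral_sq_D_le_normSqW hτ y j le_rfl)
    refine intervalIntegral.integral_mono_interval (lo_nonpos hτ j) hT0 le_rfl
      (Filter.Eventually.of_forall fun _ => by positivity) ?_
    rw [intervalIntegrable_iff_integrableOn_Ioc_of_le (lo_lt hτ j).le, IntegrableOn,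
      ← restrict_Ioo_eq_restrict_Ioc]
    exact memLp_two_integrable_sq (hy.memLp hτ le_rfl j)
  have I2 : ∫ t in (0 : ℝ)..(S.T j), ‖S.delayed y S.n j t‖ ^ 2 ≤ S.normSqW y + S.normSqW y :=
    (integral_sq_delayed_le hτ hT hy j).trans
      (add_le_add (integral_sq_D_le_normSqW hτ y j le_rfl)
        (integral_sq_D_le_normSqW hτ y _ le_rfl))
  have i0 := memLp_two_integrable_sq (memLp_ellLow hτ hT hS hy j)
  have i1 := memLp_two_integrable_sq (hy.memLp_zero hτ le_rfl j)
  have i2 := memLp_two_integrable_sq (hy.memLp_delayed hτ hT le_rfl j)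
  have hii : ∀ {f : ℝ → ℝ}, Integrable f (volume.restrict (Ioo 0 (S.T j))) →
      IntervalIntegrable f volume 0 (S.T j) := fun h => by
    rw [intervalIntegrable_iff_integrableOn_Ioc_of_le hT0, IntegrableOn,
      ← restrict_Ioo_eq_restrict_Ioc]
    exact h
  calc ∫ t in (0 : ℝ)..(S.T j), ‖S.ell y j t‖ ^ 2
      ≤ ∫ t in (0 : ℝ)..(S.T j), 3 * (‖S.ellLow y j t‖ ^ 2 + B ^ 2 * ‖S.D y S.n j t‖ ^ 2 +
          B ^ 2 * ‖S.delayed y S.n j t‖ ^ 2) := by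
        refine intervalIntegral_mono_Ioo hT0 (Filter.Eventually.of_forall fun _ => by positivity)
          (((i0.add (i1.const_mul _)).add (i2.const_mul _)).const_mul _) ?_
        filter_upwards [hB j] with t ht
        obtain ⟨h1, h2, -⟩ := ht
        rw [ell_eq]
        refine (norm_add_three_sq_le _ _ _).trans ?_
        rw [norm_mul, norm_mul, mul_pow, mul_pow]
        gcongr
    _ = 3 * ((∫ t in (0 : ℝ)..(S.T j), ‖S.ellLow y j t‖ ^ 2) +
          B ^ 2 * (∫ t in (0 : ℝ)..(S.T j), ‖S.D y S.n j t‖ ^ 2) +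
          B ^ 2 * ∫ t in (0 : ℝ)..(S.T j), ‖S.delayed y S.n j t‖ ^ 2) := by
        rw [intervalIntegral.integral_const_mul, intervalIntegral.integral_add
          ((hii i0).add ((hii i1).const_mul _)) ((hii i2).const_mul _),
          intervalIntegral.integral_add (hii i0) ((hii i1).const_mul _),
          intervalIntegral.integral_const_mul, intervalIntegral.integral_const_mul]
    _ ≤ 3 * (K * S.normSqW y * S.lowConst j + B ^ 2 * S.normSqW y +
          B ^ 2 * (S.normSqW y + S.normSqW y)) := by gcongr
    _ = _ := by ring

end DelaySystem
end TreeDamping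

namespace TreeDamping

variable {E : Type*} [Fintype E] [DecidableEq E]

namespace DelaySystem

variable {S : DelaySystem E}

/-! ### The weighted estimates -/

/-- `d j` is the distance from the root to the beginning of the edge `j`. -/
structure IsDist (S : DelaySystem E) (d : E → ℝ) : Prop where
  root : d S.root = 0
  step : ∀ j, j ≠ S.root → d j = d (S.prev j) + S.T (S.prev j)

theorem exists_isDist (S : DelaySystem E) : ∃ d, S.IsDist d := by
  obtain ⟨d, h1, h2⟩ := S.toTimeTree.exists_forward (0 : ℝ) (fun j x => x + S.T (S.prev j))
  exact ⟨d, h1, h2⟩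

theorem IsDist.nonneg {d : E → ℝ} (hd : S.IsDist d) (j : E) : 0 ≤ d j := by
  induction j using S.toTimeTree.induction with
  | h0 => rw [hd.root]
  | hs j hj ih => rw [hd.step j hj]; linarith [S.T_pos (S.prev j)]

/-- The exponential weight. -/
def weight (d : E → ℝ) (r : ℝ) (j : E) (t : ℝ) : ℝ := Real.exp (-2 * r * (d j + t))

theorem weight_pos (d : E → ℝ) (r : ℝ) (j : E) (t : ℝ) : 0 < weight d r j t := Real.exp_pos _

theorem weight_continuous (d : E → ℝ) (r : ℝ) (j : E) : Continuous (weight d r j) := by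
  unfold weight; fun_prop

/-- The square of the weighted norm. -/
def weightedSq (S : DelaySystem E) (d : E → ℝ) (r : ℝ) (F : E → ℝ → ℂ) : ℝ :=
  ∑ j, ∫ t in (0 : ℝ)..(S.T j), weight d r j t * ‖F j t‖ ^ 2

theorem weight_le_one {d : E → ℝ} (hd : S.IsDist d) {r : ℝ} (hr : 0 ≤ r) {j : E} {t : ℝ}
    (ht : 0 ≤ t) : weight d r j t ≤ 1 := by
  rw [weight, Real.exp_le_one_iff]
  have := mul_nonneg hr (add_nonneg (hd.nonneg j) ht)
  linarith

theorem integrable_weight_mul {d : E → ℝ} (hd : S.IsDist d) {r : ℝ} (hr : 0 ≤ r) {j : E}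
    {f : ℝ → ℂ} {a : ℝ} (hf : MemLp f 2 (volume.restrict (Ioo 0 a))) :
    Integrable (fun t => weight d r j t * ‖f t‖ ^ 2) (volume.restrict (Ioo 0 a)) := by
  have h := memLp_two_integrable_sq hf
  refine h.mono ((weight_continuous d r j).aestronglyMeasurable.mul h.1) ?_
  filter_upwards [ae_restrict_mem measurableSet_Ioo] with t ht
  rw [norm_mul, Real.norm_of_nonneg (weight_pos d r j t).le]
  exact mul_le_of_le_one_left (norm_nonneg _) (weight_le_one hd hr ht.1.le)

theorem intervalIntegrable_real_iff {f : ℝ → ℝ} {a b : ℝ} (hab : a ≤ b) :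
    IntervalIntegrable f volume a b ↔ Integrable f (volume.restrict (Ioo a b)) := by
  rw [intervalIntegrable_iff_integrableOn_Ioc_of_le hab, IntegrableOn,
    restrict_Ioo_eq_restrict_Ioc]

theorem integral_weight_nonneg (d : E → ℝ) (r : ℝ) (i j : E) (f : ℝ → ℂ) :
    0 ≤ ∫ t in (0 : ℝ)..(S.T j), weight d r i t * ‖f t‖ ^ 2 :=
  intervalIntegral.integral_nonneg (S.T_pos j).le fun t _ =>
    mul_nonneg (weight_pos d r i t).le (by positivity)

theorem weightedSq_nonneg (d : E → ℝ) (r : ℝ) (F : E → ℝ → ℂ) : 0 ≤ S.weightedSq d r F :=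
  Finset.sum_nonneg fun j _ => integral_weight_nonneg d r j j _

theorem integral_le_weightedSq (d : E → ℝ) (r : ℝ) (F : E → ℝ → ℂ) (j : E) :
    ∫ t in (0 : ℝ)..(S.T j), weight d r j t * ‖F j t‖ ^ 2 ≤ S.weightedSq d r F :=
  Finset.single_le_sum (f := fun j => ∫ t in (0 : ℝ)..(S.T j), weight d r j t * ‖F j t‖ ^ 2)
    (fun j _ => integral_weight_nonneg d r j j _) (Finset.mem_univ j)

theorem MemW.memLp_succ (hτ : 0 < S.τ) {y : E → ℝ → ℂ} (hy : S.MemW y) {k : ℕ} (hk : k < S.n)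
    (j : E) : MemLp (S.D y (k + 1) j) 2 (volume.restrict (Ioo 0 (S.T j))) :=
  hy.memLp_zero hτ hk j

/-- The one-edge estimate `IsPrim.weighted_le` bounds the value at `t` by the value at the beginning
of the edge plus one square root. The beginning is the end of the preceding edge, so each edge on
the path from the root contributes one more square root; the path starts from zero initial values.
-/
theorem ZeroHist.exp_mul_norm_le (hτ : 0 < S.τ) {d : E → ℝ} (hd : S.IsDist d) {r : ℝ} (hr : 0 < r)
    {w : E → ℝ → ℂ} (hw : S.ZeroHist w) {k : ℕ} (hk : k < S.n) (j : E) :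
    ∀ t ∈ Icc 0 (S.T j), Real.exp (-r * (d j + t)) * ‖S.D w k j t‖ ≤
      (S.depth j + 1) * √(S.weightedSq d r (S.D w (k + 1)) / (2 * r)) := by
  have key : ∀ j, ∀ t ∈ Icc 0 (S.T j), Real.exp (-r * (d j + t)) * ‖S.D w k j t‖ ≤
      Real.exp (-r * d j) * ‖S.D w k j 0‖ +
        √(S.weightedSq d r (S.D w (k + 1)) / (2 * r)) := by
    intro j t ht
    have h := (hw.memW.isPrim_zero hτ hk j).weighted_le hr (hw.memW.memLp_succ hτ hk j) ht
    have h2 := mul_le_mul_of_nonneg_left h (Real.exp_pos (-r * d j)).le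
    rw [← mul_assoc, ← Real.exp_add, mul_add] at h2
    rw [mul_add]
    refine h2.trans (add_le_add le_rfl ?_)
    -- Under the root, the square of `exp (-r * d j)` turns the weight in the local parameter into
    -- the weight in the distance from the root.
    rw [← Real.sqrt_sq (Real.exp_pos (-r * d j)).le, ← Real.sqrt_mul (sq_nonneg _)]
    refine Real.sqrt_le_sqrt ?_
    rw [← mul_div_assoc]
    refine div_le_div_of_nonneg_right ?_ (by positivity)
    rw [← intervalIntegral.integral_const_mul]
    refine le_trans (le_of_eq ?_) (integral_le_weightedSq d r _ j)
    congr 1; ext s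
    rw [← mul_assoc, ← Real.exp_nat_mul, ← Real.exp_add, weight]
    congr 2; push_cast; ring
  induction j using S.toTimeTree.induction with
  | h0 =>
    intro t ht
    refine (key _ t ht).trans (le_of_eq ?_)
    rw [hw.initial k hk, S.toTimeTree.depth_root]; simp
  | hs j hj ih =>
    intro t ht
    refine (key j t ht).trans ?_
    have := ih (S.T (S.prev j)) ⟨(S.T_pos _).le, le_rfl⟩
    rw [hw.glue j hj k hk, S.toTimeTree.depth_prev hj, hd.step j hj]
    push_cast
    linarith

/-- A bound of the number of edges of a path from the root. -/
def maxDepth (S : DelaySystem E) : ℝ := ∑ j, ((S.depth j : ℝ) + 1)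

theorem depth_le (j : E) : (S.depth j : ℝ) + 1 ≤ S.maxDepth :=
  Finset.single_le_sum (f := fun j => (S.depth j : ℝ) + 1) (fun _ _ => by positivity)
    (Finset.mem_univ j)

/-- Squaring `ZeroHist.exp_mul_norm_le` produces the factor `1 / r` that makes low-order terms small
for large `r`. -/
theorem ZeroHist.weight_mul_le (hτ : 0 < S.τ) {d : E → ℝ} (hd : S.IsDist d) {r : ℝ} (hr : 0 < r)
    {w : E → ℝ → ℂ} (hw : S.ZeroHist w) {k : ℕ} (hk : k < S.n) (j : E) {t : ℝ}
    (ht : t ∈ Icc 0 (S.T j)) : weight d r j t * ‖S.D w k j t‖ ^ 2 ≤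
      S.maxDepth ^ 2 / (2 * r) * S.weightedSq d r (S.D w (k + 1)) := by
  have h := hw.exp_mul_norm_le hτ hd hr hk j t ht
  have h0 : 0 ≤ Real.exp (-r * (d j + t)) * ‖S.D w k j t‖ := by positivity
  have h1 : 0 ≤ S.weightedSq d r (S.D w (k + 1)) / (2 * r) :=
    div_nonneg (weightedSq_nonneg d r _) (by positivity)
  calc weight d r j t * ‖S.D w k j t‖ ^ 2 = (Real.exp (-r * (d j + t)) * ‖S.D w k j t‖) ^ 2 := by
        rw [mul_pow, ← Real.exp_nat_mul, weight]; congr 2; push_cast; ring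
    _ ≤ ((S.depth j + 1) * √(S.weightedSq d r (S.D w (k + 1)) / (2 * r))) ^ 2 := by gcongr
    _ ≤ (S.maxDepth * √(S.weightedSq d r (S.D w (k + 1)) / (2 * r))) ^ 2 := by
        gcongr; exact depth_le j
    _ = _ := by rw [mul_pow, Real.sq_sqrt h1]; ring

/-- Integrating the pointwise bound over the tree costs its total length. The assumption on `r`
makes the resulting constant at most `1`, so the weighted norm cannot decrease from one derivative
to the next. -/
theorem ZeroHist.weightedSq_le (hτ : 0 < S.τ) {d : E → ℝ} (hd : S.IsDist d) {r : ℝ} (hr : 0 < r)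
    (hr' : (∑ j, S.T j) * S.maxDepth ^ 2 ≤ 2 * r)
    {w : E → ℝ → ℂ} (hw : S.ZeroHist w) {k : ℕ} (hk : k ≤ S.n) :
    S.weightedSq d r (S.D w k) ≤ S.weightedSq d r (S.D w S.n) := by
  have step : ∀ k < S.n, S.weightedSq d r (S.D w k) ≤ S.weightedSq d r (S.D w (k + 1)) := by
    intro k hk
    set Q := S.weightedSq d r (S.D w (k + 1))
    have hQ : 0 ≤ Q := weightedSq_nonneg d r _
    calc S.weightedSq d r (S.D w k)
        ≤ ∑ j, ∫ t in (0 : ℝ)..(S.T j), S.maxDepth ^ 2 / (2 * r) * Q := by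
          refine Finset.sum_le_sum fun j _ => ?_
          refine intervalIntegral_mono_Ioo (S.T_pos j).le (Filter.Eventually.of_forall fun t =>
            mul_nonneg (weight_pos d r j t).le (by positivity)) (integrable_const _) ?_
          filter_upwards [ae_restrict_mem measurableSet_Ioo] with t ht
          exact hw.weight_mul_le hτ hd hr hk j (Ioo_subset_Icc_self ht)
      _ = ((∑ j, S.T j) * S.maxDepth ^ 2) / (2 * r) * Q := by
          simp only [intervalIntegral.integral_const, smul_eq_mul, sub_zero]
          rw [← Finset.sum_mul]; ring
      _ ≤ 1 * Q := by
          gcongr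
          rw [div_le_one (by positivity)]; exact hr'
      _ = Q := one_mul Q
  induction hm : S.n - k generalizing k with
  | zero => rw [show k = S.n by omega]
  | succ m ih => exact (step k (by omega)).trans (ih (by omega) (by omega))

theorem ZeroHist.weight_mul_top_le (hτ : 0 < S.τ) {d : E → ℝ} (hd : S.IsDist d) {r : ℝ}
    (hr : 0 < r) (hr' : (∑ j, S.T j) * S.maxDepth ^ 2 ≤ 2 * r)
    {w : E → ℝ → ℂ} (hw : S.ZeroHist w) {k : ℕ} (hk : k < S.n) (j : E) {t : ℝ}
    (ht : t ∈ Icc 0 (S.T j)) : weight d r j t * ‖S.D w k j t‖ ^ 2 ≤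
      S.maxDepth ^ 2 / (2 * r) * S.weightedSq d r (S.D w S.n) :=
  (hw.weight_mul_le hτ hd hr hk j ht).trans
    (mul_le_mul_of_nonneg_left (hw.weightedSq_le hτ hd hr hr' hk) (by positivity))

theorem weight_anti {d : E → ℝ} {r : ℝ} (hr : 0 ≤ r) {i j : E} {s t : ℝ}
    (h : d i + s ≤ d j + t) : weight d r j t ≤ weight d r i s := by
  rw [weight, weight, Real.exp_le_exp]
  nlinarith

/-- The delayed point lies closer to the root, where the weight is larger, so the undelayed bound
applies there; in the history the value is zero. -/
theorem ZeroHist.weight_mul_delayed_le (hτ : 0 < S.τ) (hT : ∀ j, S.τ < S.T j) {d : E → ℝ}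
    (hd : S.IsDist d) {r : ℝ} (hr : 0 < r) (hr' : (∑ j, S.T j) * S.maxDepth ^ 2 ≤ 2 * r)
    {w : E → ℝ → ℂ} (hw : S.ZeroHist w) {k : ℕ} (hk : k < S.n) (j : E) {t : ℝ}
    (ht : t ∈ Ioo 0 (S.T j)) : weight d r j t * ‖S.delayed w k j t‖ ^ 2 ≤
      S.maxDepth ^ 2 / (2 * r) * S.weightedSq d r (S.D w S.n) := by
  have key : ∀ i s, s ∈ Icc 0 (S.T i) → d i + s ≤ d j + t →
      weight d r j t * ‖S.D w k i s‖ ^ 2 ≤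
        S.maxDepth ^ 2 / (2 * r) * S.weightedSq d r (S.D w S.n) := fun i s hs h =>
    (mul_le_mul_of_nonneg_right (weight_anti hr.le h) (by positivity)).trans
      (hw.weight_mul_top_le hτ hd hr hr' hk i hs)
  have hTj := ht.2
  unfold delayed
  split_ifs with hc
  · rcases lt_or_ge (t - S.τ) 0 with hneg | hnn
    · have hj : j = S.root := hc.resolve_right (by linarith)
      rw [hj, hw.D_neg k ⟨by linarith [ht.1], hneg⟩]
      have := weightedSq_nonneg (S := S) d r (S.D w S.n)
      simp only [norm_zero, ne_eq, OfNat.ofNat_ne_zero, not_false_eq_true, zero_pow, mul_zero]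
      positivity
    · exact key j _ ⟨hnn, by linarith⟩ (by linarith)
  · rw [not_or, not_le] at hc
    have := hT (S.prev j)
    refine key _ _ ⟨by linarith [ht.1], by linarith⟩ ?_
    rw [hd.step j hc.1]; linarith

/-- Going back by `τ` along the tree changes the weight by exactly `exp (-2 r τ)`. For each edge the
integral splits into at most two pieces, each bounded by the whole weighted norm; this gives the
factor `2` and, after summing over the edges, their number. -/
theorem ZeroHist.weightedSq_delayed_le (hτ : 0 < S.τ) (hT : ∀ j, S.τ < S.T j) {d : E → ℝ}
    (hd : S.IsDist d) {r : ℝ} (hr : 0 < r) {w : E → ℝ → ℂ} (hw : S.ZeroHist w) :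
    S.weightedSq d r (S.delayed w S.n) ≤
      2 * Fintype.card E * Real.exp (-2 * r * S.τ) * S.weightedSq d r (S.D w S.n) := by
  set Q := S.weightedSq d r (S.D w S.n)
  set ε := Real.exp (-2 * r * S.τ)
  have hε : 0 ≤ ε := (Real.exp_pos _).le
  have hQ : 0 ≤ Q := weightedSq_nonneg d r _
  have hle : ∀ i, ∀ a b : ℝ, 0 ≤ a → a ≤ b → b ≤ S.T i →
      ∫ t in a..b, ε * (weight d r i t * ‖S.D w S.n i t‖ ^ 2) ≤ ε * Q := by
    intro i a b ha hab hb
    rw [intervalIntegral.integral_const_mul]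
    refine mul_le_mul_of_nonneg_left (le_trans ?_ (integral_le_weightedSq d r _ i)) hε
    refine intervalIntegral.integral_mono_interval ha hab hb
      (Filter.Eventually.of_forall fun t => mul_nonneg (weight_pos d r i t).le (by positivity)) ?_
    rw [intervalIntegrable_real_iff (S.T_pos i).le]
    exact integrable_weight_mul hd hr.le (hw.memW.memLp_zero hτ le_rfl i)
  have main : ∀ j, ∫ t in (0 : ℝ)..(S.T j), weight d r j t * ‖S.delayed w S.n j t‖ ^ 2 ≤
      2 * (ε * Q) := by
    intro j
    have h := integral_del (S := S) (Φ := fun t x => weight d r j t * ‖x‖ ^ 2) (F := S.D w S.n)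
      hτ hT j (fun t ht => hw.D_neg S.n ht) (fun t => by simp)
      ((intervalIntegrable_real_iff (S.T_pos j).le).2
        (integrable_weight_mul hd hr.le (hw.memW.memLp_delayed hτ hT le_rfl j)))
    have hTj := hT j
    simp only [delayed_eq_del]
    rw [h, two_mul]
    refine add_le_add ?_ ?_
    · refine le_trans (le_of_eq ?_) (hle j 0 (S.T j - S.τ) le_rfl (by linarith) (by linarith))
      congr 1; ext t
      rw [← mul_assoc, weight, weight, ← Real.exp_add]
      congr 2; ring
    · split_ifs with hj
      · positivity
      · have hTp := hT (S.prev j)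
        refine le_trans (le_of_eq ?_) (hle (S.prev j) (S.T (S.prev j) - S.τ) (S.T (S.prev j))
          (by linarith) (by linarith) le_rfl)
        congr 1; ext t
        rw [← mul_assoc, weight, weight, ← Real.exp_add, hd.step j hj]
        congr 2; ring
  calc S.weightedSq d r (S.delayed w S.n) ≤ ∑ j : E, 2 * (ε * Q) :=
        Finset.sum_le_sum fun j _ => main j
    _ = _ := by rw [Finset.sum_const, Finset.card_univ, nsmul_eq_mul]; ring

/-- The square of the `L_2`-norm of the derivatives of highest order. -/
def topSq (S : DelaySystem E) (w : E → ℝ → ℂ) : ℝ :=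
  ∑ j, ∫ t in (0 : ℝ)..(S.T j), ‖S.D w S.n j t‖ ^ 2

theorem weightedSq_le_sum {d : E → ℝ} (hd : S.IsDist d) {r : ℝ} (hr : 0 ≤ r) {F : E → ℝ → ℂ}
    (hF : ∀ j, MemLp (F j) 2 (volume.restrict (Ioo 0 (S.T j)))) :
    S.weightedSq d r F ≤ ∑ j, ∫ t in (0 : ℝ)..(S.T j), ‖F j t‖ ^ 2 := by
  refine Finset.sum_le_sum fun j _ => intervalIntegral_mono_Ioo (S.T_pos j).le
    (Filter.Eventually.of_forall fun t => mul_nonneg (weight_pos d r j t).le (by positivity))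
    (memLp_two_integrable_sq (hF j)) ?_
  filter_upwards [ae_restrict_mem measurableSet_Ioo] with t ht
  exact mul_le_of_le_one_left (by positivity) (weight_le_one hd hr ht.1.le)

theorem exists_weight_ge {d : E → ℝ} (hd : S.IsDist d) {r : ℝ} (hr : 0 ≤ r) :
    ∃ C : ℝ, 0 < C ∧ ∀ j, ∀ t ∈ Icc 0 (S.T j), 1 ≤ C * weight d r j t := by
  refine ⟨Real.exp (2 * r * ∑ j, (d j + S.T j)), Real.exp_pos _, fun j t ht => ?_⟩
  rw [weight, ← Real.exp_add, Real.one_le_exp_iff]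
  have h1 : d j + S.T j ≤ ∑ j, (d j + S.T j) :=
    Finset.single_le_sum (f := fun j => d j + S.T j)
      (fun i _ => add_nonneg (hd.nonneg i) (S.T_pos i).le) (Finset.mem_univ j)
  have h2 : d j + t ≤ ∑ j, (d j + S.T j) := by linarith [ht.2]
  nlinarith

theorem sum_le_weightedSq {d : E → ℝ} (hd : S.IsDist d) {r : ℝ} (hr : 0 ≤ r) {C : ℝ}
    (hC : ∀ j, ∀ t ∈ Icc 0 (S.T j), 1 ≤ C * weight d r j t)
    {F : E → ℝ → ℂ} (hF : ∀ j, MemLp (F j) 2 (volume.restrict (Ioo 0 (S.T j)))) :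
    ∑ j, ∫ t in (0 : ℝ)..(S.T j), ‖F j t‖ ^ 2 ≤ C * S.weightedSq d r F := by
  rw [weightedSq, Finset.mul_sum]
  refine Finset.sum_le_sum fun j _ => ?_
  rw [← intervalIntegral.integral_const_mul]
  refine intervalIntegral_mono_Ioo (S.T_pos j).le
    (Filter.Eventually.of_forall fun t => by positivity)
    ((integrable_weight_mul hd hr (hF j)).const_mul _) ?_
  filter_upwards [ae_restrict_mem measurableSet_Ioo] with t ht
  rw [← mul_assoc]
  exact le_mul_of_one_le_left (by positivity) (hC j t (Ioo_subset_Icc_self ht))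

/-- The energy functional is coercive on functions with zero history. -/
theorem exists_topSq_le (hτ : 0 < S.τ) (hT : ∀ j, S.τ < S.T j) (hS : S.RegularCoefficients) :
    ∃ C : ℝ, 0 ≤ C ∧ ∀ w, S.ZeroHist w → S.topSq w ≤ C * S.energy w := by
  obtain ⟨d, hd⟩ := S.exists_isDist
  obtain ⟨B, hB0, hB⟩ := exists_coeff_bound hS
  set M := S.maxDepth with hM
  set A := ∑ j, S.lowConst j with hA
  have hA0 : 0 ≤ A := Finset.sum_nonneg fun j _ => lowConst_nonneg j
  set N : ℝ := (Fintype.card E : ℝ) with hN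
  have hN0 : 0 ≤ N := Nat.cast_nonneg _
  set T0 := ∑ j, S.T j with hT0
  have hT00 : 0 ≤ T0 := Finset.sum_nonneg fun j _ => (S.T_pos j).le
  -- `P / r` is the total constant of the terms to be absorbed: `A * M ^ 2 / 2` from the low orders
  -- and `B ^ 2 * (N / τ)` from the delayed top order.
  set P : ℝ := 3 * B ^ 2 * (A * M ^ 2 / 2 + B ^ 2 * (N / S.τ)) with hP
  have hP0 : 0 ≤ P := by positivity
  -- Large enough for `P / r ≤ 1 / 2` and for `ZeroHist.weightedSq_le`.
  set r : ℝ := 1 + T0 * M ^ 2 + 2 * P with hr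
  have hr0 : 0 < r := by positivity
  have hr1 : T0 * M ^ 2 ≤ 2 * r := by
    have : 0 ≤ T0 * M ^ 2 := by positivity
    rw [hr]; linarith
  have hPr : P / r ≤ 1 / 2 := by
    rw [div_le_iff₀ hr0, hr]
    have : 0 ≤ T0 * M ^ 2 := by positivity
    linarith
  obtain ⟨C, hC0, hC⟩ := exists_weight_ge hd hr0.le
  refine ⟨C * (6 * B ^ 2), by positivity, fun w hw => ?_⟩
  set Q := S.weightedSq d r (S.D w S.n) with hQ
  have hQ0 : 0 ≤ Q := weightedSq_nonneg d r _
  have hexp : Real.exp (-2 * r * S.τ) ≤ 1 / (2 * r * S.τ) := by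
    have h1 := Real.add_one_le_exp (2 * r * S.τ)
    rw [show -2 * r * S.τ = -(2 * r * S.τ) by ring, Real.exp_neg, ← one_div]
    exact one_div_le_one_div_of_le (by positivity) (by linarith)
  have hdel : S.weightedSq d r (S.delayed w S.n) ≤ N / S.τ / r * Q := by
    refine (hw.weightedSq_delayed_le hτ hT hd hr0).trans ?_
    gcongr
    calc 2 * N * Real.exp (-2 * r * S.τ) ≤ 2 * N * (1 / (2 * r * S.τ)) := by gcongr
      _ = _ := by field_simp
  have hlow : S.weightedSq d r (S.ellLow w) ≤ A * M ^ 2 / 2 / r * Q := by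
    calc S.weightedSq d r (S.ellLow w) ≤ ∑ j, M ^ 2 / (2 * r) * Q * S.lowConst j :=
          Finset.sum_le_sum fun j _ => integral_ellLow_le hS (fun t => (weight_pos d r j t).le)
            fun k hk t ht => ⟨hw.weight_mul_top_le hτ hd hr0 hr1 hk j (Ioo_subset_Icc_self ht),
              hw.weight_mul_delayed_le hτ hT hd hr0 hr1 hk j ht⟩
      _ = _ := by rw [← Finset.mul_sum]; field_simp; rw [hA]
  -- Solve `ℓ w` for `b_n w^(n)` and divide by `b_n`, at the cost of the factor `B ^ 2`.
  have hmain : Q ≤ 3 * B ^ 2 * (S.weightedSq d r (S.ell w) + S.weightedSq d r (S.ellLow w) +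
      B ^ 2 * S.weightedSq d r (S.delayed w S.n)) := by
    rw [hQ, weightedSq, weightedSq, weightedSq, weightedSq, Finset.mul_sum,
      ← Finset.sum_add_distrib, ← Finset.sum_add_distrib, Finset.mul_sum]
    refine Finset.sum_le_sum fun j _ => ?_
    have i0 := integrable_weight_mul hd hr0.le (j := j) (memLp_ell hτ hT hS hw.memW j)
    have i1 := integrable_weight_mul hd hr0.le (j := j) (memLp_ellLow hτ hT hS hw.memW j)
    have i2 := integrable_weight_mul hd hr0.le (j := j) (hw.memW.memLp_delayed hτ hT le_rfl j)
    have hii : ∀ {f : ℝ → ℝ}, Integrable f (volume.restrict (Ioo 0 (S.T j))) →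
      IntervalIntegrable f volume 0 (S.T j) := (intervalIntegrable_real_iff (S.T_pos j).le).2
    rw [← intervalIntegral.integral_const_mul (B ^ 2),
      ← intervalIntegral.integral_add (hii i0) (hii i1),
      ← intervalIntegral.integral_add ((hii i0).add (hii i1)) ((hii i2).const_mul _),
      ← intervalIntegral.integral_const_mul]
    refine intervalIntegral_mono_Ioo (S.T_pos j).le (Filter.Eventually.of_forall fun t =>
      mul_nonneg (weight_pos d r j t).le (by positivity))
      (((i0.add i1).add (i2.const_mul _)).const_mul _) ?_
    filter_upwards [hB j] with t ht
    obtain ⟨-, h2, h3⟩ := ht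
    have e1 : S.b S.n j t * S.D w S.n j t = S.ell w j t + -S.ellLow w j t +
        -(S.c S.n j t * S.delayed w S.n j t) := by rw [ell_eq]; ring
    have e2 := norm_add_three_sq_le (S.ell w j t) (-S.ellLow w j t)
      (-(S.c S.n j t * S.delayed w S.n j t))
    rw [← e1, norm_neg, norm_neg, norm_mul, norm_mul, mul_pow, mul_pow] at e2
    have e3 : ‖S.D w S.n j t‖ ^ 2 ≤ B ^ 2 * (‖S.b S.n j t‖ ^ 2 * ‖S.D w S.n j t‖ ^ 2) := by
      rw [← mul_assoc, ← mul_pow]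
      exact le_mul_of_one_le_left (by positivity) (one_le_pow₀ h3)
    have e4 : ‖S.c S.n j t‖ ^ 2 * ‖S.delayed w S.n j t‖ ^ 2 ≤
        B ^ 2 * ‖S.delayed w S.n j t‖ ^ 2 := by gcongr
    have e5 : ‖S.D w S.n j t‖ ^ 2 ≤ B ^ 2 * (3 * (‖S.ell w j t‖ ^ 2 + ‖S.ellLow w j t‖ ^ 2 +
        B ^ 2 * ‖S.delayed w S.n j t‖ ^ 2)) :=
      e3.trans (mul_le_mul_of_nonneg_left (e2.trans (by linarith)) (by positivity))
    have e6 := mul_le_mul_of_nonneg_left e5 (weight_pos d r j t).le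
    refine e6.trans (le_of_eq ?_)
    ring
  have h1 : Q ≤ 3 * B ^ 2 * S.weightedSq d r (S.ell w) + P / r * Q := by
    refine hmain.trans ?_
    have : 3 * B ^ 2 * (S.weightedSq d r (S.ell w) + S.weightedSq d r (S.ellLow w) +
      B ^ 2 * S.weightedSq d r (S.delayed w S.n)) ≤
      3 * B ^ 2 * (S.weightedSq d r (S.ell w) + A * M ^ 2 / 2 / r * Q +
      B ^ 2 * (N / S.τ / r * Q)) := by gcongr
    refine this.trans (le_of_eq ?_)
    rw [hP]; ring
  -- Half of `Q` is absorbed into the left-hand side.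
  have h2 : Q ≤ 6 * B ^ 2 * S.weightedSq d r (S.ell w) := by
    have := mul_le_mul_of_nonneg_right hPr hQ0
    linarith
  calc S.topSq w ≤ C * Q := sum_le_weightedSq hd hr0.le hC fun j => hw.memW.memLp_zero hτ le_rfl j
    _ ≤ C * (6 * B ^ 2 * S.weightedSq d r (S.ell w)) := by gcongr
    _ ≤ C * (6 * B ^ 2 * S.energy w) := by
        gcongr
        exact weightedSq_le_sum hd hr0.le fun j => memLp_ell hτ hT hS hw.memW j
    _ = _ := by ring

/-- The highest derivatives control a function with zero history. -/
theorem exists_le_topSq (hτ : 0 < S.τ) :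
    ∃ C : ℝ, 0 ≤ C ∧ ∀ w, S.ZeroHist w →
      (∀ k < S.n, ∀ j, ∀ t ∈ Icc 0 (S.T j), ‖S.D w k j t‖ ^ 2 ≤ C * S.topSq w) ∧
      S.normSqW w ≤ C * S.topSq w := by
  obtain ⟨d, hd⟩ := S.exists_isDist
  set M := S.maxDepth with hM
  set T0 := ∑ j, S.T j with hT0
  have hT00 : 0 ≤ T0 := Finset.sum_nonneg fun j _ => (S.T_pos j).le
  set r : ℝ := 1 + T0 * M ^ 2 with hr
  have hr0 : 0 < r := by positivity
  have hr1 : T0 * M ^ 2 ≤ 2 * r := by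
    have : 0 ≤ T0 * M ^ 2 := by positivity
    rw [hr]; linarith
  obtain ⟨C, hC0, hC⟩ := exists_weight_ge hd hr0.le
  set K : ℝ := C * (M ^ 2 / (2 * r)) with hK
  have hK0 : 0 ≤ K := by positivity
  have hpt : ∀ w, S.ZeroHist w → ∀ k < S.n, ∀ j, ∀ t ∈ Icc 0 (S.T j),
      ‖S.D w k j t‖ ^ 2 ≤ K * S.topSq w := by
    intro w hw k hk j t ht
    have h1 := hw.weight_mul_top_le hτ hd hr0 hr1 hk j ht
    calc ‖S.D w k j t‖ ^ 2 ≤ C * weight d r j t * ‖S.D w k j t‖ ^ 2 :=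
          le_mul_of_one_le_left (by positivity) (hC j t ht)
      _ = C * (weight d r j t * ‖S.D w k j t‖ ^ 2) := by ring
      _ ≤ C * (M ^ 2 / (2 * r) * S.weightedSq d r (S.D w S.n)) := by gcongr
      _ ≤ C * (M ^ 2 / (2 * r) * S.topSq w) := by
          gcongr
          exact weightedSq_le_sum hd hr0.le fun j => hw.memW.memLp_zero hτ le_rfl j
      _ = _ := by rw [hK]; ring
  refine ⟨K + ∑ j, ∑ k ∈ Finset.range (S.n + 1), (S.T j * K + 1), ?_, fun w hw => ?_⟩
  · have : 0 ≤ ∑ j, ∑ k ∈ Finset.range (S.n + 1), (S.T j * K + 1) :=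
      Finset.sum_nonneg fun j _ => Finset.sum_nonneg fun k _ => by
        have := S.T_pos j; positivity
    linarith
  have htop : 0 ≤ S.topSq w := Finset.sum_nonneg fun j _ => integral_sq_nonneg (S.T_pos j).le
  have hsum : 0 ≤ ∑ j, ∑ k ∈ Finset.range (S.n + 1), (S.T j * K + 1) :=
      Finset.sum_nonneg fun j _ => Finset.sum_nonneg fun k _ => by
        have := S.T_pos j; positivity
  refine ⟨fun k hk j t ht => (hpt w hw k hk j t ht).trans ?_, ?_⟩
  · gcongr; linarith
  have hcut : ∀ j, ∀ k ≤ S.n, ∫ t in (S.lo j)..(S.T j), ‖S.D w k j t‖ ^ 2 =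
      ∫ t in (0 : ℝ)..(S.T j), ‖S.D w k j t‖ ^ 2 := by
    intro j k hk
    have hi : IntervalIntegrable (fun t => ‖S.D w k j t‖ ^ 2) volume (S.lo j) (S.T j) :=
      (intervalIntegrable_real_iff (lo_lt hτ j).le).2
        (memLp_two_integrable_sq (hw.memW.memLp hτ hk j))
    have hsub : ∀ x ∈ Icc (S.lo j) (S.T j), ∀ y ∈ Icc (S.lo j) (S.T j),
        IntervalIntegrable (fun t => ‖S.D w k j t‖ ^ 2) volume x y := fun x hx y hy =>
      hi.mono_set ((uIcc_subset_Icc hx hy).trans Icc_subset_uIcc)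
    have m0 : (0 : ℝ) ∈ Icc (S.lo j) (S.T j) := ⟨lo_nonpos hτ j, (S.T_pos j).le⟩
    rw [← intervalIntegral.integral_add_adjacent_intervals
      (hsub _ ⟨le_rfl, (lo_lt hτ j).le⟩ 0 m0) (hsub 0 m0 _ ⟨(lo_lt hτ j).le, le_rfl⟩)]
    by_cases hj : j = S.root
    · subst hj
      rw [lo_root, intervalIntegral_congr_Ioo (g := fun _ => 0) (by linarith) ?_]
      · simp
      · filter_upwards [ae_restrict_mem measurableSet_Ioo] with t ht
        rw [hw.D_neg k ht]; simp
    · rw [lo_of_ne S hj]; simp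
  have hterm : ∀ j, ∀ k ∈ Finset.range (S.n + 1),
      ∫ t in (S.lo j)..(S.T j), ‖S.D w k j t‖ ^ 2 ≤ (S.T j * K + 1) * S.topSq w := by
    intro j k hk
    have hk : k ≤ S.n := by simpa [Nat.lt_succ_iff] using hk
    have hTj := S.T_pos j
    rw [hcut j k hk]
    rcases hk.lt_or_eq with hk | rfl
    · have : ∫ t in (0 : ℝ)..(S.T j), ‖S.D w k j t‖ ^ 2 ≤
          ∫ t in (0 : ℝ)..(S.T j), K * S.topSq w := by
        refine intervalIntegral_mono_Ioo hTj.le (Filter.Eventually.of_forall fun t => by positivity)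
          (integrable_const _) ?_
        filter_upwards [ae_restrict_mem measurableSet_Ioo] with t ht
        exact hpt w hw k hk j t (Ioo_subset_Icc_self ht)
      rw [intervalIntegral.integral_const, smul_eq_mul, sub_zero] at this
      linarith
    · have : ∫ t in (0 : ℝ)..(S.T j), ‖S.D w S.n j t‖ ^ 2 ≤ S.topSq w :=
        Finset.single_le_sum (f := fun j => ∫ t in (0 : ℝ)..(S.T j), ‖S.D w S.n j t‖ ^ 2)
          (fun i _ => integral_sq_nonneg (S.T_pos i).le) (Finset.mem_univ j)
      have h2 : 0 ≤ S.T j * K * S.topSq w := by positivity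
      linarith
  calc S.normSqW w ≤ ∑ j, ∑ k ∈ Finset.range (S.n + 1), (S.T j * K + 1) * S.topSq w :=
        Finset.sum_le_sum fun j _ => Finset.sum_le_sum fun k hk => hterm j k hk
    _ = (∑ j, ∑ k ∈ Finset.range (S.n + 1), (S.T j * K + 1)) * S.topSq w := by
        rw [Finset.sum_mul]
        exact Finset.sum_congr rfl fun j _ => by rw [Finset.sum_mul]
    _ ≤ _ := by gcongr; linarith

end DelaySystem
end TreeDamping

namespace TreeDamping

/-! ### The adjoint expressions `ℓ_{k,j} y` -/

theorem MemLp.star' {f : ℝ → ℂ} {p : ℝ≥0∞} {μ : Measure ℝ} (hf : MemLp f p μ) :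
    MemLp (fun t => star (f t)) p μ :=
  hf.of_le (continuous_star.comp_aestronglyMeasurable hf.1)
    (Filter.Eventually.of_forall fun t => by rw [norm_star])

variable {E : Type*} [Fintype E] [DecidableEq E]

namespace DelaySystem

variable {S : DelaySystem E}

theorem len_of_leaf {j : E} (hj : S.IsLeaf j) : S.len j = S.T j - S.τ := if_pos hj

theorem len_of_not_leaf {j : E} (hj : ¬ S.IsLeaf j) : S.len j = S.T j := if_neg hj

theorem len_pos (hT : ∀ j, S.τ < S.T j) (j : E) : 0 < S.len j := by
  unfold len; split_ifs
  · linarith [hT j]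
  · exact S.T_pos j

theorem len_le (hτ : 0 < S.τ) (j : E) : S.len j ≤ S.T j := by
  unfold len; split_ifs <;> linarith

/-- The integrability exponent of the products of coefficients of order `k` with `ℓ y`. -/
def expo (S : DelaySystem E) (k : ℕ) : ℝ≥0∞ := if k < S.n then 1 else 2

theorem memLp_b_ell (hτ : 0 < S.τ) (hT : ∀ j, S.τ < S.T j) (hS : S.RegularCoefficients)
    {y : E → ℝ → ℂ} (hy : S.MemW y) {k : ℕ} (hk : k ≤ S.n) (j : E) :
    MemLp (fun t => star (S.b k j t) * S.ell y j t) (S.expo k)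
      (volume.restrict (Ioo 0 (S.T j))) := by
  have he := memLp_ell hτ hT hS hy j
  unfold expo
  split_ifs with h
  · exact he.mul (MemLp.star' (hS.b_low j k h))
  · obtain rfl : k = S.n := by omega
    exact he.mul (MemLp.star' (hS.b_top j))

theorem memLp_c_ell (hτ : 0 < S.τ) (hT : ∀ j, S.τ < S.T j) (hS : S.RegularCoefficients)
    {y : E → ℝ → ℂ} (hy : S.MemW y) {k : ℕ} (hk : k ≤ S.n) (j : E) :
    MemLp (fun t => star (S.c k j t) * S.ell y j t) (S.expo k)
      (volume.restrict (Ioo 0 (S.T j))) := by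
  have he := memLp_ell hτ hT hS hy j
  unfold expo
  split_ifs with h
  · exact he.mul (MemLp.star' (hS.c_low j k h))
  · obtain rfl : k = S.n := by omega
    exact he.mul (MemLp.star' (hS.c_top j))

/-- For `k < n` this pairs `L_1` with a bounded derivative, for `k = n` it pairs `L_2` with `L_2`.
-/
theorem integrable_mul_star_D (hτ : 0 < S.τ) {w : E → ℝ → ℂ} (hw : S.MemW w) {k : ℕ}
    (hk : k ≤ S.n) {j : E} {a b : ℝ} (ha : 0 ≤ a) (hb : b ≤ S.T j) {f : ℝ → ℂ}
    (hf : MemLp f (S.expo k) (volume.restrict (Ioo a b))) :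
    Integrable (fun t => f t * star (S.D w k j t)) (volume.restrict (Ioo a b)) := by
  unfold expo at hf
  split_ifs at hf with h
  · rw [← memLp_one_iff_integrable]
    exact (MemLp.star' (memLp_Ioo_mono ha hb (hw.memLp_top hτ h j))).mul hf
  · rw [← memLp_one_iff_integrable]
    exact (MemLp.star' (memLp_Ioo_mono ha hb (hw.memLp_zero hτ hk j))).mul hf

/-- The part of `ℓ_{k,j} y` that comes from the delay. -/
def adjDel (S : DelaySystem E) (y : E → ℝ → ℂ) (k : ℕ) (j : E) (t : ℝ) : ℂ :=
  if t < S.T j - S.τ then star (S.c k j (t + S.τ)) * S.ell y j (t + S.τ)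
  else ∑ i ∈ S.next j, star (S.c k i (t + S.τ - S.T j)) * S.ell y i (t + S.τ - S.T j)

theorem ellAdj_eq (y : E → ℝ → ℂ) (k : ℕ) (j : E) (t : ℝ) :
    S.ellAdj y k j t = star (S.b k j t) * S.ell y j t + S.adjDel y k j t := rfl

section Adjoint

variable {y : E → ℝ → ℂ} {k : ℕ}

theorem memLp_adj_fst (hτ : 0 < S.τ) (hT : ∀ j, S.τ < S.T j) (hS : S.RegularCoefficients)
    (hy : S.MemW y) (hk : k ≤ S.n) (j : E) :
    MemLp (fun t => star (S.c k j (t + S.τ)) * S.ell y j (t + S.τ)) (S.expo k)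
      (volume.restrict (Ioo 0 (S.T j - S.τ))) :=
  memLp_Ioo_mono (by linarith) le_rfl (memLp_shift S.τ (memLp_c_ell hτ hT hS hy hk j))

theorem memLp_adj_snd (hτ : 0 < S.τ) (hT : ∀ j, S.τ < S.T j) (hS : S.RegularCoefficients)
    (hy : S.MemW y) (hk : k ≤ S.n) (i j : E) :
    MemLp (fun t => star (S.c k i (t + S.τ - S.T j)) * S.ell y i (t + S.τ - S.T j)) (S.expo k)
      (volume.restrict (Ioo (S.T j - S.τ) (S.T j))) := by
  have := memLp_shift (S.τ - S.T j) (memLp_c_ell hτ hT hS hy hk i)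
  simp only [← add_sub_assoc] at this
  exact memLp_Ioo_mono (by linarith) (by linarith [hT i]) this

theorem memLp_adjDel (hτ : 0 < S.τ) (hT : ∀ j, S.τ < S.T j) (hS : S.RegularCoefficients)
    (hy : S.MemW y) (hk : k ≤ S.n) (j : E) :
    MemLp (S.adjDel y k j) (S.expo k) (volume.restrict (Ioo 0 (S.T j))) := by
  refine memLp_Ioo_union (c := S.T j - S.τ) ?_ ?_
  · refine (memLp_adj_fst hτ hT hS hy hk j).ae_eq ?_
    filter_upwards [ae_restrict_mem measurableSet_Ioo] with t ht
    rw [adjDel, if_pos ht.2]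
  · refine (memLp_finsetSum (S.next j) fun i _ => memLp_adj_snd hτ hT hS hy hk i j).ae_eq ?_
    filter_upwards [ae_restrict_mem measurableSet_Ioo] with t ht
    rw [adjDel, if_neg (not_lt.2 ht.1.le)]

theorem memLp_ellAdj (hτ : 0 < S.τ) (hT : ∀ j, S.τ < S.T j) (hS : S.RegularCoefficients)
    (hy : S.MemW y) (hk : k ≤ S.n) (j : E) :
    MemLp (S.ellAdj y k j) (S.expo k) (volume.restrict (Ioo 0 (S.len j))) :=
  memLp_Ioo_mono le_rfl (len_le hτ j)
    ((memLp_b_ell hτ hT hS hy hk j).add (memLp_adjDel hτ hT hS hy hk j))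

theorem Admissible.D_rest {φ : ℝ → ℂ} {w : E → ℝ → ℂ} (hτ : 0 < S.τ) (hT : ∀ j, S.τ < S.T j)
    (hw : S.Admissible φ w) {j : E} (hj : S.IsLeaf j) (k : ℕ) {t : ℝ}
    (ht : t ∈ Ioo (S.T j - S.τ) (S.T j)) : S.D w k j t = 0 := by
  have hsub : Ioo (S.T j - S.τ) (S.T j) ⊆ S.dom j := fun t ht =>
    mem_dom_of_mem hτ ⟨by linarith [ht.1, hT j], ht.2.le⟩
  have := iteratedDerivWithin_eqOn_open (f := w j) (g := fun _ => 0) (s := S.dom j)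
    (t := S.dom j) isOpen_Ioo hsub hsub (fun t ht => hw.rest j hj t (Ioo_subset_Icc_self ht)) k ht
  rw [D, this]
  simp

/-- The derivatives vanish inside the rest interval, hence by continuity at its left end `T j - τ`.
This removes the boundary terms at the leaves. -/
theorem Admissible.D_len {φ : ℝ → ℂ} {w : E → ℝ → ℂ} (hτ : 0 < S.τ) (hT : ∀ j, S.τ < S.T j)
    (hw : S.Admissible φ w) {j : E} (hj : S.IsLeaf j) {k : ℕ} (hk : k < S.n) :
    S.D w k j (S.len j) = 0 := by
  have hTj := hT j
  have hc : ContinuousOn (S.D w k j) (Icc (S.T j - S.τ) (S.T j)) :=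
    (hw.memW.isPrim_zero hτ hk j).continuousOn.mono (Icc_subset_Icc (by linarith) le_rfl)
  have hz : EqOn (S.D w k j) (fun _ => 0) (closure (Ioo (S.T j - S.τ) (S.T j))) :=
    EqOn.of_subset_closure (s := Ioo (S.T j - S.τ) (S.T j))
      (fun t ht => hw.D_rest hτ hT hj k ht)
      (by rw [closure_Ioo (by linarith)]; exact hc) continuousOn_const
      subset_closure le_rfl
  rw [len_of_leaf hj]
  exact hz (by rw [closure_Ioo (by linarith)]; exact ⟨le_rfl, by linarith⟩)

theorem integral_len_eq (hτ : 0 < S.τ) (hT : ∀ j, S.τ < S.T j) {φ : ℝ → ℂ} {w : E → ℝ → ℂ}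
    (hw : S.Admissible φ w) (j : E) {f : ℝ → ℂ}
    (hi : IntervalIntegrable (fun t => f t * star (S.D w k j t)) volume 0 (S.T j)) :
    ∫ t in (0 : ℝ)..(S.T j), f t * star (S.D w k j t) =
      ∫ t in (0 : ℝ)..(S.len j), f t * star (S.D w k j t) := by
  by_cases hj : S.IsLeaf j
  · have hTj := hT j
    have hsub : ∀ x ∈ Icc 0 (S.T j), ∀ y ∈ Icc 0 (S.T j),
        IntervalIntegrable (fun t => f t * star (S.D w k j t)) volume x y := fun x hx y hy =>
      hi.mono_set ((uIcc_subset_Icc hx hy).trans Icc_subset_uIcc)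
    have m1 : S.T j - S.τ ∈ Icc 0 (S.T j) := ⟨by linarith, by linarith⟩
    rw [len_of_leaf hj, ← intervalIntegral.integral_add_adjacent_intervals
      (hsub 0 ⟨le_rfl, by linarith⟩ _ m1) (hsub _ m1 _ ⟨by linarith, le_rfl⟩)]
    rw [intervalIntegral_congr_Ioo (a := S.T j - S.τ) (g := fun _ => 0) (by linarith)]
    · simp
    · filter_upwards [ae_restrict_mem measurableSet_Ioo] with t ht
      rw [hw.D_rest hτ hT hj k ht]; simp
  · rw [len_of_not_leaf hj]

/-- Substitution moves the delay onto `ℓ y` and the coefficient. The initial pieces of all edges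
leaving a vertex land on the final piece of the edge entering it, which explains the sum over `next
j` in the adjoint. The history of `w` contributes nothing. -/
theorem sum_integral_delayed (hτ : 0 < S.τ) (hT : ∀ j, S.τ < S.T j) (hS : S.RegularCoefficients)
    (hy : S.MemW y) {w : E → ℝ → ℂ} (hw : S.Admissible (fun _ => 0) w) (hk : k ≤ S.n) :
    ∑ j, ∫ t in (0 : ℝ)..(S.T j), S.ell y j t * star (S.c k j t * S.delayed w k j t) =
      ∑ j, ∫ t in (0 : ℝ)..(S.T j), S.adjDel y k j t * star (S.D w k j t) := by
  have hsnd : ∀ i j, Integrable (fun t => star (S.c k i (t + S.τ - S.T j)) *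
      S.ell y i (t + S.τ - S.T j) * star (S.D w k j t))
      (volume.restrict (Ioo (S.T j - S.τ) (S.T j))) := fun i j =>
    integrable_mul_star_D hτ hw.memW hk (by linarith [hT j]) le_rfl
      (memLp_adj_snd hτ hT hS hy hk i j)
  have h1 : ∀ j, ∫ t in (0 : ℝ)..(S.T j), S.ell y j t * star (S.c k j t * S.delayed w k j t) =
      (∫ t in (0 : ℝ)..(S.T j - S.τ),
        star (S.c k j (t + S.τ)) * S.ell y j (t + S.τ) * star (S.D w k j t)) +
      if j = S.root then 0 else ∫ t in (S.T (S.prev j) - S.τ)..(S.T (S.prev j)),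
        star (S.c k j (t + S.τ - S.T (S.prev j))) * S.ell y j (t + S.τ - S.T (S.prev j)) *
          star (S.D w k (S.prev j) t) := by
    intro j
    have hi : Integrable (fun t => S.ell y j t * star (S.c k j t * S.delayed w k j t))
        (volume.restrict (Ioo 0 (S.T j))) := by
      rw [← memLp_one_iff_integrable]
      exact (MemLp.star' (memLp_c_mul hτ hT hS hw.memW hk j)).mul (memLp_ell hτ hT hS hy j)
    have e : ∀ t x, S.ell y j t * star (S.c k j t * x) = star (S.c k j t) * S.ell y j t * star x :=
      fun t x => by rw [star_mul']; ring
    simp only [e] at hi ⊢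
    exact integral_del (S := S) (Φ := fun t x => star (S.c k j t) * S.ell y j t * star x)
      (F := S.D w k) hτ hT j (fun t ht => hw.zeroHist.D_neg k ht) (fun t => by simp)
      ((intervalIntegrable_iff_Ioo (S.T_pos j).le).2 hi)
  rw [Finset.sum_congr rfl fun j _ => h1 j, Finset.sum_add_distrib, S.toTimeTree.sum_ne_root
    (fun j => ∫ t in (S.T (S.prev j) - S.τ)..(S.T (S.prev j)),
        star (S.c k j (t + S.τ - S.T (S.prev j))) * S.ell y j (t + S.τ - S.T (S.prev j)) *
          star (S.D w k (S.prev j) t)), ← Finset.sum_add_distrib]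
  refine Finset.sum_congr rfl fun j _ => ?_
  have hTj := hT j
  have hi : IntervalIntegrable (fun t => S.adjDel y k j t * star (S.D w k j t)) volume
      0 (S.T j) := (intervalIntegrable_iff_Ioo (S.T_pos j).le).2
    (integrable_mul_star_D hτ hw.memW hk le_rfl le_rfl (memLp_adjDel hτ hT hS hy hk j))
  have hsub : ∀ x ∈ Icc 0 (S.T j), ∀ z ∈ Icc 0 (S.T j),
      IntervalIntegrable (fun t => S.adjDel y k j t * star (S.D w k j t)) volume x z :=
    fun x hx z hz => hi.mono_set ((uIcc_subset_Icc hx hz).trans Icc_subset_uIcc)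
  have m1 : S.T j - S.τ ∈ Icc 0 (S.T j) := ⟨by linarith, by linarith⟩
  rw [← intervalIntegral.integral_add_adjacent_intervals
    (hsub 0 ⟨le_rfl, by linarith⟩ _ m1) (hsub _ m1 _ ⟨by linarith, le_rfl⟩)]
  congr 1
  · refine intervalIntegral_congr_Ioo (by linarith) ?_
    filter_upwards [ae_restrict_mem measurableSet_Ioo] with t ht
    rw [adjDel, if_pos ht.2]
  · have h2 : ∀ i ∈ S.next j, ∫ t in (S.T (S.prev i) - S.τ)..(S.T (S.prev i)),
        star (S.c k i (t + S.τ - S.T (S.prev i))) * S.ell y i (t + S.τ - S.T (S.prev i)) *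
          star (S.D w k (S.prev i) t) = ∫ t in (S.T j - S.τ)..(S.T j),
        star (S.c k i (t + S.τ - S.T j)) * S.ell y i (t + S.τ - S.T j) * star (S.D w k j t) := by
      intro i hi
      rw [(S.toTimeTree.mem_next.1 hi).2]
    rw [Finset.sum_congr rfl h2, ← intervalIntegral.integral_finsetSum fun i _ =>
      (intervalIntegrable_iff_Ioo (by linarith)).2 (hsnd i j)]
    refine intervalIntegral_congr_Ioo (by linarith) ?_
    filter_upwards [ae_restrict_mem measurableSet_Ioo] with t ht
    rw [adjDel, if_neg (not_lt.2 ht.1.le), Finset.sum_mul]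

/-- The sesquilinear form of the energy, expressed by the adjoint expressions. -/
theorem sum_integral_ell_mul_star (hτ : 0 < S.τ) (hT : ∀ j, S.τ < S.T j)
    (hS : S.RegularCoefficients) (hy : S.MemW y) {w : E → ℝ → ℂ}
    (hw : S.Admissible (fun _ => 0) w) :
    ∑ j, ∫ t in (0 : ℝ)..(S.T j), S.ell y j t * star (S.ell w j t) =
      ∑ j, ∫ t in (0 : ℝ)..(S.len j),
        ∑ k ∈ Finset.range (S.n + 1), S.ellAdj y k j t * star (S.D w k j t) := by
  have hT0 := fun j => (S.T_pos j).le
  have hle : ∀ {k}, k ∈ Finset.range (S.n + 1) → k ≤ S.n := fun hk => by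
    simpa [Nat.lt_succ_iff] using hk
  have ib : ∀ k ∈ Finset.range (S.n + 1), ∀ j, IntervalIntegrable (fun t => S.ell y j t *
      star (S.b k j t * S.D w k j t)) volume 0 (S.T j) := fun k hk j => by
    rw [intervalIntegrable_iff_Ioo (hT0 j), ← memLp_one_iff_integrable]
    exact (MemLp.star' (memLp_b_mul hτ hS hw.memW (hle hk) j)).mul (memLp_ell hτ hT hS hy j)
  have ic : ∀ k ∈ Finset.range (S.n + 1), ∀ j, IntervalIntegrable (fun t => S.ell y j t *
      star (S.c k j t * S.delayed w k j t)) volume 0 (S.T j) := fun k hk j => by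
    rw [intervalIntegrable_iff_Ioo (hT0 j), ← memLp_one_iff_integrable]
    exact (MemLp.star' (memLp_c_mul hτ hT hS hw.memW (hle hk) j)).mul (memLp_ell hτ hT hS hy j)
  have h1 : ∀ j, ∫ t in (0 : ℝ)..(S.T j), S.ell y j t * star (S.ell w j t) =
      ∑ k ∈ Finset.range (S.n + 1),
        ((∫ t in (0 : ℝ)..(S.T j), S.ell y j t * star (S.b k j t * S.D w k j t)) +
        ∫ t in (0 : ℝ)..(S.T j), S.ell y j t * star (S.c k j t * S.delayed w k j t)) := by
    intro j
    rw [Finset.sum_congr rfl fun k hk =>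
      (intervalIntegral.integral_add (ib k hk j) (ic k hk j)).symm,
      ← intervalIntegral.integral_finsetSum fun k hk => (ib k hk j).add (ic k hk j)]
    congr 1; ext t
    conv_lhs => arg 2; rw [ell, star_sum]
    rw [Finset.mul_sum]
    exact Finset.sum_congr rfl fun k _ => by rw [star_add, mul_add]
  have iadj : ∀ k ∈ Finset.range (S.n + 1), ∀ j, IntervalIntegrable (fun t => S.ellAdj y k j t *
      star (S.D w k j t)) volume 0 (S.T j) := fun k hk j =>
    (intervalIntegrable_iff_Ioo (hT0 j)).2 (integrable_mul_star_D hτ hw.memW (hle hk) le_rfl le_rfl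
      ((memLp_b_ell hτ hT hS hy (hle hk) j).add (memLp_adjDel hτ hT hS hy (hle hk) j)))
  have h2 : ∀ j, ∫ t in (0 : ℝ)..(S.len j),
        ∑ k ∈ Finset.range (S.n + 1), S.ellAdj y k j t * star (S.D w k j t) =
      ∑ k ∈ Finset.range (S.n + 1),
        ∫ t in (0 : ℝ)..(S.T j), S.ellAdj y k j t * star (S.D w k j t) := by
    intro j
    rw [intervalIntegral.integral_finsetSum fun k hk => (iadj k hk j).mono_set (by
      rw [uIcc_of_le (len_pos hT j).le, uIcc_of_le (hT0 j)]
      exact Icc_subset_Icc le_rfl (len_le hτ j))]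
    exact Finset.sum_congr rfl fun k hk => (integral_len_eq hτ hT hw j (iadj k hk j)).symm
  rw [Finset.sum_congr rfl fun j _ => h1 j, Finset.sum_congr rfl fun j _ => h2 j, Finset.sum_comm]
  conv_rhs => rw [Finset.sum_comm]
  refine Finset.sum_congr rfl fun k hk => ?_
  rw [Finset.sum_add_distrib, sum_integral_delayed hτ hT hS hy hw (hle hk),
    ← Finset.sum_add_distrib]
  refine Finset.sum_congr rfl fun j _ => ?_
  have i1 : IntervalIntegrable (fun t => star (S.b k j t) * S.ell y j t * star (S.D w k j t))
      volume 0 (S.T j) := (intervalIntegrable_iff_Ioo (hT0 j)).2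
    (integrable_mul_star_D hτ hw.memW (hle hk) le_rfl le_rfl (memLp_b_ell hτ hT hS hy (hle hk) j))
  have i2 : IntervalIntegrable (fun t => S.adjDel y k j t * star (S.D w k j t))
      volume 0 (S.T j) := (intervalIntegrable_iff_Ioo (hT0 j)).2
    (integrable_mul_star_D hτ hw.memW (hle hk) le_rfl le_rfl (memLp_adjDel hτ hT hS hy (hle hk) j))
  have e : ∀ t, S.ell y j t * star (S.b k j t * S.D w k j t) =
      star (S.b k j t) * S.ell y j t * star (S.D w k j t) := fun t => by rw [star_mul']; ring
  simp only [e, ellAdj_eq, add_mul]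
  rw [intervalIntegral.integral_add i1 i2]

end Adjoint

/-! ### Systems of quasi-derivatives -/

/-- The functions `R k = y^⟨2 n - k⟩` are quasi-derivatives that satisfy the conditions of Kirchhoff
type at the inner vertices. -/
structure IsKirchhoff (S : DelaySystem E) (L R : ℕ → E → ℝ → ℂ) : Prop where
  zero : ∀ j t, R 0 j t = 0
  prim : ∀ k < S.n, ∀ j, IsPrim 0 (S.len j) (R (k + 1) j) (fun t => L k j t - R k j t)
  vertex : ∀ j, ¬ S.IsLeaf j → ∀ k < S.n,
    R (k + 1) j (S.len j) = ∑ i ∈ S.next j, R (k + 1) i 0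

/-- Solution of the system of quasi-derivatives on an edge from its end. -/
def edgeSol (l : ℝ) (L : ℕ → ℝ → ℂ) (β : ℕ → ℂ) : ℕ → ℝ → ℂ
  | 0 => fun _ => 0
  | k + 1 => fun t => β k + ∫ s in l..t, (L k s - edgeSol l L β k s)

theorem edgeSol_isPrim {n : ℕ} {l : ℝ} (hl : 0 ≤ l) {L : ℕ → ℝ → ℂ} (β : ℕ → ℂ)
    (hL : ∀ k < n, IntervalIntegrable (L k) volume 0 l) {k : ℕ} (hk : k < n) :
    IsPrim 0 l (edgeSol l L β (k + 1)) (fun t => L k t - edgeSol l L β k t) := by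
  induction k with
  | zero =>
    exact IsPrim.primitive (β 0) ⟨hl, le_rfl⟩ ((hL 0 hk).sub (by simp [edgeSol]))
  | succ k ih =>
    exact IsPrim.primitive (β (k + 1)) ⟨hl, le_rfl⟩
      ((hL _ hk).sub ((ih (by omega)).intervalIntegrable hl))

theorem edgeSol_end (l : ℝ) (L : ℕ → ℝ → ℂ) (β : ℕ → ℂ) (k : ℕ) :
    edgeSol l L β (k + 1) l = β k := by simp [edgeSol]

/-- The system is solved from the leaves to the root. End values at leaves are free; at an inner
vertex they are the sums of the initial values already found on the outgoing edges. -/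
theorem exists_isKirchhoff (hT : ∀ j, S.τ < S.T j) {L : ℕ → E → ℝ → ℂ}
    (hL : ∀ k < S.n, ∀ j, IntervalIntegrable (L k j) volume 0 (S.len j)) (α : ℕ → E → ℂ) :
    ∃ R, S.IsKirchhoff L R ∧ ∀ j, S.IsLeaf j → ∀ k < S.n, R (k + 1) j (S.len j) = α k j := by
  obtain ⟨a, ha⟩ := S.toTimeTree.exists_backward (α := ℕ → ℝ → ℂ)
    (fun j a => edgeSol (S.len j) (fun k => L k j)
      (fun k => if S.next j = ∅ then α k j else ∑ i ∈ S.next j, a i (k + 1) 0))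
    (fun j a a' h => by
      have : (fun k => if S.next j = ∅ then α k j else ∑ i ∈ S.next j, a i (k + 1) 0) =
          fun k => if S.next j = ∅ then α k j else ∑ i ∈ S.next j, a' i (k + 1) 0 := by
        ext k
        split_ifs
        · rfl
        · exact Finset.sum_congr rfl fun i hi => by rw [h i hi]
      rw [this])
  refine ⟨fun k j => a j k, ⟨fun j t => ?_, fun k hk j => ?_, fun j hj k hk => ?_⟩,
    fun j hj k hk => ?_⟩
  · simp only [ha j]; rfl
  · simp only [ha j]
    exact edgeSol_isPrim (len_pos hT j).le _ (fun k hk => hL k hk j) hk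
  · rw [ha j, edgeSol_end]
    exact if_neg hj
  · change a j (k + 1) (S.len j) = _
    rw [ha j, edgeSol_end]
    exact if_pos hj

/-- Homogeneous solutions are the freedom available for repairing the equation of order `n`. -/
theorem IsKirchhoff.add_sum {L R : ℕ → E → ℝ → ℂ} (hR : S.IsKirchhoff L R) {ι : Type*}
    [Fintype ι] {P : ι → ℕ → E → ℝ → ℂ} (hP : ∀ i, S.IsKirchhoff (fun _ _ _ => 0) (P i))
    (c : ι → ℂ) :
    S.IsKirchhoff L (fun k j t => R k j t + ∑ i, c i * P i k j t) := by
  refine ⟨fun j t => ?_, fun k hk j => ?_, fun j hj k hk => ?_⟩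
  · simp [hR.zero, (hP _).zero]
  · have h1 := (hR.prim k hk j).add
      (IsPrim.sum Finset.univ fun i _ => ((hP i).prim k hk j).const_mul (c i))
    convert h1 using 2 with t
    simp only [zero_sub, mul_neg, Finset.sum_neg_distrib]
    ring
  · rw [hR.vertex j hj k hk, Finset.sum_add_distrib, Finset.sum_comm]
    congr 1
    exact Finset.sum_congr rfl fun i _ => by rw [(hP i).vertex j hj k hk, Finset.mul_sum]

/-- On each edge, differentiating `∑ R (k + 1) * star (w^(k))` produces a telescoping sum, and `R 0
= 0` removes its lower end. The boundary terms cancel at inner vertices by the Kirchhoff conditions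
and vanish at the root by the initial conditions, so only the leaves remain. -/
theorem IsKirchhoff.sum_integral {L R : ℕ → E → ℝ → ℂ} (hτ : 0 < S.τ) (hT : ∀ j, S.τ < S.T j)
    (hR : S.IsKirchhoff L R) {w : E → ℝ → ℂ} (hw : S.ZeroHist w) :
    ∑ j, ∫ t in (0 : ℝ)..(S.len j), (R S.n j t * star (S.D w S.n j t) +
        ∑ k ∈ Finset.range S.n, L k j t * star (S.D w k j t)) =
      ∑ j, if S.next j = ∅ then
        ∑ k ∈ Finset.range S.n, R (k + 1) j (S.len j) * star (S.D w k j (S.len j)) else 0 := by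
  have hedge : ∀ j, ∫ t in (0 : ℝ)..(S.len j), (R S.n j t * star (S.D w S.n j t) +
        ∑ k ∈ Finset.range S.n, L k j t * star (S.D w k j t)) =
      ∑ k ∈ Finset.range S.n, R (k + 1) j (S.len j) * star (S.D w k j (S.len j)) -
        ∑ k ∈ Finset.range S.n, R (k + 1) j 0 * star (S.D w k j 0) := by
    intro j
    have hl := (len_pos hT j).le
    have h := IsPrim.sum (Finset.range S.n) fun k hk =>
      (hR.prim k (Finset.mem_range.1 hk) j).mul
        (((hw.memW.isPrim_zero hτ (Finset.mem_range.1 hk) j).mono le_rfl hl (len_le hτ j)).star) hl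
    rw [h.sub_eq ⟨le_rfl, hl⟩ ⟨hl, le_rfl⟩]
    congr 1; ext t
    have h2 := Finset.sum_range_sub (fun k => R k j t * star (S.D w k j t)) S.n
    rw [hR.zero, zero_mul, sub_zero] at h2
    rw [← h2, ← Finset.sum_add_distrib]
    exact Finset.sum_congr rfl fun k _ => by ring
  have hstart : ∀ j, ∑ k ∈ Finset.range S.n, R (k + 1) j 0 * star (S.D w k j 0) =
      if j = S.root then 0 else ∑ k ∈ Finset.range S.n,
        R (k + 1) j 0 * star (S.D w k (S.prev j) (S.T (S.prev j))) := by
    intro j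
    split_ifs with hj
    · exact Finset.sum_eq_zero fun k hk => by
        rw [hj, hw.initial k (Finset.mem_range.1 hk)]; simp
    · exact Finset.sum_congr rfl fun k hk => by rw [hw.glue j hj k (Finset.mem_range.1 hk)]
  rw [Finset.sum_congr rfl fun j _ => hedge j, Finset.sum_sub_distrib,
    Finset.sum_congr rfl fun j _ => hstart j, S.toTimeTree.sum_ne_root
      (fun j => ∑ k ∈ Finset.range S.n,
        R (k + 1) j 0 * star (S.D w k (S.prev j) (S.T (S.prev j)))), ← Finset.sum_sub_distrib]
  refine Finset.sum_congr rfl fun j _ => ?_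
  have h2 : ∑ i ∈ S.next j, ∑ k ∈ Finset.range S.n,
        R (k + 1) i 0 * star (S.D w k (S.prev i) (S.T (S.prev i))) =
      ∑ k ∈ Finset.range S.n, (∑ i ∈ S.next j, R (k + 1) i 0) * star (S.D w k j (S.T j)) := by
    rw [Finset.sum_comm]
    refine Finset.sum_congr rfl fun k _ => ?_
    rw [Finset.sum_mul]
    exact Finset.sum_congr rfl fun i hi => by rw [(S.toTimeTree.mem_next.1 hi).2]
  rw [h2]
  split_ifs with hj
  · simp [hj]
  · rw [sub_eq_zero]
    exact Finset.sum_congr rfl fun k hk => by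
      rw [← hR.vertex j hj k (Finset.mem_range.1 hk), len_of_not_leaf hj]

/-- The boundary value problem in terms of systems of quasi-derivatives. -/
theorem solvesBVP_iff (hn : 1 ≤ S.n) (hT : ∀ j, S.τ < S.T j) {φ : ℝ → ℂ} {y : E → ℝ → ℂ} :
    S.SolvesBVP φ y ↔ S.Admissible φ y ∧ ∃ R, S.IsKirchhoff (S.ellAdj y) R ∧
      ∀ j, ∀ᵐ t ∂volume.restrict (Ioo 0 (S.len j)), R S.n j t = S.ellAdj y S.n j t := by
  refine and_congr_right fun _ => ⟨?_, ?_⟩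
  · rintro ⟨q, hq, h0, hv⟩
    -- The quasi-derivative of order `2 n` vanishes only almost everywhere, so it is replaced by the
    -- zero function.
    refine ⟨fun k j t => if k = 0 then 0 else q (2 * S.n - k) j t,
      ⟨fun j t => if_pos rfl, fun k hk j => ?_, fun j hj k hk => ?_⟩, fun j => ?_⟩
    · have hac := (hq.memW11 (2 * S.n - (k + 1)) (by omega) (by omega) j).1 0 one_pos
      rw [iteratedDerivWithin_zero] at hac
      refine (IsPrim.of_ac (len_pos hT j).le hac).congr (len_pos hT j).le
        (fun t _ => if_neg (Nat.succ_ne_zero k)) ?_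
      have hs := hq.step (S.n - k) (by omega) (by omega) j
      rw [show S.n + (S.n - k) = 2 * S.n - k by omega, show S.n - (S.n - k) = k by omega] at hs
      filter_upwards [hs, h0 j] with t ht1 ht2
      rw [show 2 * S.n - (k + 1) = 2 * S.n - k - 1 by omega]
      split_ifs with hk0
      · subst hk0
        rw [Nat.sub_zero, ht2] at ht1
        rw [Nat.sub_zero]
        linear_combination ht1
      · linear_combination ht1
    · simpa using hv j hj (2 * S.n - (k + 1)) (by omega) (by omega)
    · filter_upwards [hq.base j] with t ht
      rw [if_neg (by omega), show 2 * S.n - S.n = S.n by omega, ht]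
  · rintro ⟨R, hR, hb⟩
    refine ⟨fun k j => R (2 * S.n - k) j, ⟨fun k hk1 hk2 j => ?_, fun j => ?_,
      fun l hl1 hl2 j => ?_⟩, fun j => ?_, fun j hj k hk1 hk2 => ?_⟩
    · obtain ⟨m, hm, hmn⟩ : ∃ m, 2 * S.n - k = m + 1 ∧ m < S.n := ⟨2 * S.n - k - 1, by omega, by omega⟩
      have hp := hR.prim m hmn j
      rw [hm]
      refine IsJet.memSobolev (F := fun i => if i = 0 then R (m + 1) j else
        fun t => S.ellAdj y m j t - R m j t) (len_pos hT j) (fun i hi => ?_) (fun t _ => rfl) ?_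
      · obtain rfl : i = 0 := by omega
        exact hp
      · exact memLp_one_iff_integrable.2 ((intervalIntegrable_iff_Ioo (len_pos hT j).le).1 hp.int)
    · filter_upwards [hb j] with t ht
      rw [show 2 * S.n - S.n = S.n by omega, ht]
    · have hp := hR.prim (S.n - l) (by omega) j
      filter_upwards [hp.ae_derivWithin (len_pos hT j).le] with t ht
      rw [show 2 * S.n - (S.n + l - 1) = S.n - l + 1 by omega, ← ht,
        show 2 * S.n - (S.n + l) = S.n - l by omega]
      ring
    · exact Filter.Eventually.of_forall fun t => by
        change R (2 * S.n - 2 * S.n) j t = 0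
        rw [Nat.sub_self, hR.zero]
    · obtain ⟨m, hm, hmn⟩ : ∃ m, 2 * S.n - k = m + 1 ∧ m < S.n := ⟨2 * S.n - k - 1, by omega, by omega⟩
      simp only [hm]
      exact hR.vertex j hj m hmn

end DelaySystem
end TreeDamping

namespace TreeDamping

/-! ### Extension of the history -/

theorem IsPrim.of_contDiff {g : ℝ → ℝ} (hg : ContDiff ℝ (⊤ : ℕ∞) g) (k : ℕ) (a b : ℝ) :
    IsPrim a b (fun t => ((iteratedDeriv k g t : ℝ) : ℂ))
      (fun t => ((iteratedDeriv (k + 1) g t : ℝ) : ℂ)) := by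
  have hc : ∀ m : ℕ, Continuous (iteratedDeriv m g) := fun m =>
    hg.continuous_iteratedDeriv m (by exact_mod_cast le_top)
  have hd : Differentiable ℝ (iteratedDeriv k g) :=
    hg.differentiable_iteratedDeriv k (by exact_mod_cast WithTop.coe_lt_top _)
  refine ⟨(Complex.continuous_ofReal.comp (hc (k + 1))).intervalIntegrable _ _, fun x _ => ?_⟩
  rw [intervalIntegral.integral_ofReal, iteratedDeriv_succ,
    intervalIntegral.integral_deriv_eq_sub' _ rfl (fun y _ => hd y)
      (by rw [← iteratedDeriv_succ]; exact (hc (k + 1)).continuousOn)]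
  push_cast; ring

/-- Primitives on adjacent intervals can be glued together. -/
theorem IsPrim.glue {a b c : ℝ} (hac : a ≤ c) (hcb : c ≤ b) {u u' v v' : ℝ → ℂ}
    (hu : IsPrim a c u u') (hv : IsPrim c b v v') (h : u c = v c) :
    IsPrim a b (fun t => if t ≤ c then u t else v t) (fun t => if t ≤ c then u' t else v' t) := by
  have h1 : IsPrim a c (fun t => if t ≤ c then u t else v t)
      (fun t => if t ≤ c then u' t else v' t) := by
    refine hu.congr hac (fun t ht => if_pos ht.2) ?_
    filter_upwards [ae_restrict_mem measurableSet_Ioo] with t ht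
    rw [if_pos ht.2.le]
  have h2 : IsPrim c b (fun t => if t ≤ c then u t else v t)
      (fun t => if t ≤ c then u' t else v' t) := by
    refine hv.congr hcb (fun t ht => ?_) ?_
    · rcases ht.1.lt_or_eq with h' | h'
      · exact if_neg (not_le.2 h')
      · subst h'; simp [h]
    · filter_upwards [ae_restrict_mem measurableSet_Ioo] with t ht
      rw [if_neg (not_le.2 ht.1)]
  have hi := h1.int.trans h2.int
  refine IsPrim.of_base (c := c) ⟨hac, hcb⟩ hi fun x hx => ?_
  rcases le_total x c with hxc | hxc
  · have := h1.sub_eq (x := c) (y := x) ⟨hac, le_rfl⟩ ⟨hx.1, hxc⟩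
    rw [← this]; ring
  · exact h2.eq x ⟨hxc, hx.2⟩

/-- Smooth functions with prescribed derivatives at `0` that vanish to the right of `l`. -/
theorem exists_smooth_basis {l : ℝ} (hl : 0 < l) (i : ℕ) :
    ∃ g : ℝ → ℝ, ContDiff ℝ (⊤ : ℕ∞) g ∧ (∀ k, iteratedDeriv k g 0 = if k = i then 1 else 0) ∧
      ∀ k, ∀ t > l / 2, iteratedDeriv k g t = 0 := by
  -- A cutoff equal to `1` for `t ≤ l / 4` and to `0` for `t ≥ l / 2`; it multiplies the monomial `t
  -- ^ i / i!`.
  set χ : ℝ → ℝ := fun t => Real.smoothTransition (2 - 4 * t / l) with hχ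
  refine ⟨fun t => ((i.factorial : ℝ)⁻¹ * t ^ i) * χ t, ?_, fun k => ?_, fun k t ht => ?_⟩
  · have h1 : ContDiff ℝ (⊤ : ℕ∞) χ := by
      refine Real.smoothTransition.contDiff.comp ?_
      fun_prop
    exact (contDiff_const.mul (contDiff_id.pow i)).mul h1
  · have e : (fun t : ℝ => ((i.factorial : ℝ)⁻¹ * t ^ i) * χ t) =ᶠ[nhds 0]
        fun t => (i.factorial : ℝ)⁻¹ * t ^ i := by
      filter_upwards [Iio_mem_nhds (show (0 : ℝ) < l / 4 by positivity)] with t ht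
      have ht : t < l / 4 := ht
      have : χ t = 1 := Real.smoothTransition.one_of_one_le (by
        have : 4 * t / l ≤ 1 := by rw [div_le_one hl]; linarith
        linarith)
      rw [this, mul_one]
    rw [e.iteratedDeriv_eq, iteratedDeriv_const_mul_field, iteratedDeriv_fun_pow_zero]
    split_ifs with h
    · subst h
      exact inv_mul_cancel₀ (by exact_mod_cast (Nat.factorial_pos k).ne')
    · simp
  · have e : (fun t : ℝ => ((i.factorial : ℝ)⁻¹ * t ^ i) * χ t) =ᶠ[nhds t] fun _ => 0 := by
      filter_upwards [Ioi_mem_nhds ht] with s hs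
      have hs : l / 2 < s := hs
      have : χ s = 0 := Real.smoothTransition.zero_of_nonpos (by
        have : 2 ≤ 4 * s / l := by rw [le_div_iff₀ hl]; linarith
        linarith)
      rw [this, mul_zero]
    rw [e.iteratedDeriv_eq]
    simp

variable {E : Type*} [Fintype E] [DecidableEq E]

namespace DelaySystem

variable {S : DelaySystem E}

theorem sobolevNormSq_eq_of_ae {n : ℕ} {a b : ℝ} (hab : a ≤ b) {f : ℝ → ℂ} {F : ℕ → ℝ → ℂ}
    (h : ∀ k ≤ n, ∀ᵐ t ∂volume.restrict (Ioo a b), iteratedDerivWithin k f (Icc a b) t = F k t) :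
    sobolevNormSq n a b f = ∑ k ∈ Finset.range (n + 1), ∫ t in a..b, ‖F k t‖ ^ 2 := by
  refine Finset.sum_congr rfl fun k hk => intervalIntegral_congr_Ioo hab ?_
  filter_upwards [h k (by simpa [Nat.lt_succ_iff] using hk)] with t ht
  rw [ht]

/-- Every history extends to an admissible function, with control of the norm. -/
theorem exists_extension (hn : 1 ≤ S.n) (hτ : 0 < S.τ) (hT : ∀ j, S.τ < S.T j) :
    ∃ C : ℝ, 0 ≤ C ∧ ∀ φ, MemSobolev 2 S.n (-S.τ) 0 φ →
      ∃ y, S.Admissible φ y ∧ S.normSqW y ≤ C * sobolevNormSq S.n (-S.τ) 0 φ := by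
  -- With `l = T root - τ` the extension dies out before the final piece of the root edge. It can
  -- then be zero on all other edges, and the vertex and rest conditions hold whether or not the
  -- root edge ends in a leaf.
  have hl : 0 < S.T S.root - S.τ := sub_pos.2 (hT _)
  have hTr := S.T_pos S.root
  choose g hg hg0 hgl using exists_smooth_basis hl
  obtain ⟨K, hK0, hK⟩ := exists_trace_bound (n := S.n) (show -S.τ < 0 by linarith)
  set G : ℕ → ℝ → ℝ := fun k t => ∑ i ∈ Finset.range S.n, iteratedDeriv k (g i) t ^ 2 with hG
  have hGc : ∀ k, Continuous (G k) := fun k => continuous_finsetSum _ fun i _ =>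
    ((hg i).continuous_iteratedDeriv k (by exact_mod_cast le_top)).pow 2
  have hGn : ∀ k t, 0 ≤ G k t := fun k t => Finset.sum_nonneg fun i _ => sq_nonneg _
  set Γ : ℕ → ℝ := fun k => ∫ t in (0 : ℝ)..(S.T S.root), G k t with hΓ
  have hΓ0 : ∀ k, 0 ≤ Γ k := fun k => intervalIntegral.integral_nonneg hTr.le fun t _ => hGn k t
  refine ⟨∑ k ∈ Finset.range (S.n + 1), (1 + S.n * K * Γ k), Finset.sum_nonneg fun k _ => by
    have := hΓ0 k; positivity, fun φ hφ => ?_⟩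
  set N := sobolevNormSq S.n (-S.τ) 0 φ with hN
  have hN0 : 0 ≤ N := sobolevNormSq_nonneg (by linarith) φ
  set d : ℕ → ℝ → ℂ := fun k => iteratedDerivWithin k φ (Icc (-S.τ) 0) with hd
  -- The Taylor polynomial of the history at `0`, cut off, together with its derivatives.
  set p : ℕ → ℝ → ℂ := fun k t => ∑ i ∈ Finset.range S.n, d i 0 * ((iteratedDeriv k (g i) t : ℝ) : ℂ)
    with hp
  set R : ℕ → ℝ → ℂ := fun k t => if t ≤ 0 then d k t else p k t with hR
  have hpP : ∀ k, IsPrim 0 (S.T S.root) (p k) (p (k + 1)) := fun k =>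
    IsPrim.sum _ fun i _ => (IsPrim.of_contDiff (hg i) k _ _).const_mul (d i 0)
  have hp0 : ∀ k < S.n, p k 0 = d k 0 := by
    intro k hk
    simp only [hp, hg0]
    rw [Finset.sum_eq_single k]
    · simp
    · intro i _ hik
      simp [Ne.symm hik]
    · intro h; exact absurd (Finset.mem_range.2 hk) h
  have hpl : ∀ k, ∀ t ≥ S.T S.root - S.τ, p k t = 0 := by
    intro k t ht
    simp only [hp]
    exact Finset.sum_eq_zero fun i _ => by rw [hgl i k t (by linarith)]; simp
  have hdP : ∀ k < S.n, IsPrim (-S.τ) 0 (d k) (d (k + 1)) := fun k hk =>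
    hφ.isPrim (by linarith) hk
  have hdm : ∀ k ≤ S.n, MemLp (d k) 2 (volume.restrict (Ioo (-S.τ) 0)) := by
    intro k hk
    rcases hk.lt_or_eq with hk | rfl
    · exact (hdP k hk).memLp 2
    · exact hφ.2
  have hRneg : ∀ k, ∀ᵐ t ∂volume.restrict (Ioo (-S.τ) 0), d k t = R k t := fun k => by
    filter_upwards [ae_restrict_mem measurableSet_Ioo] with t ht
    simp only [hR]; rw [if_pos ht.2.le]
  have hRpos : ∀ k, ∀ᵐ t ∂volume.restrict (Ioo 0 (S.T S.root)), p k t = R k t := fun k => by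
    filter_upwards [ae_restrict_mem measurableSet_Ioo] with t ht
    simp only [hR]; rw [if_neg (not_le.2 ht.1)]
  set F : ℕ → E → ℝ → ℂ := fun k j => if j = S.root then R k else fun _ => 0 with hF
  have hFr : ∀ k, F k S.root = R k := fun k => if_pos rfl
  have hFn : ∀ k, ∀ {j}, j ≠ S.root → F k j = fun _ => 0 := fun k j hj => if_neg hj
  have hRm : ∀ k ≤ S.n, MemLp (R k) 2 (volume.restrict (Ioo (-S.τ) (S.T S.root))) := fun k hk =>
    memLp_Ioo_union (c := 0) ((hdm k hk).ae_eq (hRneg k)) (((hpP k).memLp 2).ae_eq (hRpos k))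
  obtain ⟨h1, h2, h3⟩ := memW_of_jet hτ (y := F 0) (F := F)
    (fun j k hk => by
      by_cases hj : j = S.root
      · subst hj
        simp only [hFr, lo_root]
        exact (hdP k hk).glue (by linarith) hTr.le (hpP k) (hp0 k hk).symm
      · simp only [hFn _ hj]
        exact IsPrim.zero)
    (fun j => by
      by_cases hj : j = S.root
      · subst hj
        rw [hFr, lo_root]; exact hRm S.n le_rfl
      · rw [hFn _ hj]; exact MemLp.zero')
    (fun j t _ => rfl)
  have m0 : ∀ j, (0 : ℝ) ∈ S.dom j := fun j => mem_dom_of_mem hτ ⟨le_rfl, (S.T_pos j).le⟩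
  have mT : ∀ j, S.T j ∈ S.dom j := fun j => mem_dom_of_mem hτ ⟨(S.T_pos j).le, le_rfl⟩
  have hFrest : ∀ k j, ∀ t ∈ Icc (S.T j - S.τ) (S.T j), F k j t = 0 := by
    intro k j t ht
    by_cases hj : j = S.root
    · subst hj
      simp only [hFr, hR]
      rw [if_neg (not_le.2 (by linarith [ht.1])), hpl k t ht.1]
    · rw [hFn _ hj]
  refine ⟨F 0, ⟨h1, fun j hj k hk => ?_, fun t ht => ?_, fun k hk => ?_, fun j _ t ht =>
    hFrest 0 j t ht⟩, ?_⟩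
  · rw [h2 k hk j (m0 j), h2 k hk _ (mT _), hFn _ hj, hFrest k _ _ ⟨by linarith, le_rfl⟩]
  · simp [hFr, hR, ht.2.le, hd]
  · rw [h2 k hk _ (m0 _), hFr]
    simp [hR, hd]
  · have hsum : S.normSqW (F 0) =
        ∑ k ∈ Finset.range (S.n + 1), ∫ t in (-S.τ)..(S.T S.root), ‖R k t‖ ^ 2 := by
      have e : ∀ j, sobolevNormSq S.n (S.lo j) (S.T j) (F 0 j) =
          ∑ k ∈ Finset.range (S.n + 1), ∫ t in (S.lo j)..(S.T j), ‖F k j t‖ ^ 2 := fun j =>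
        sobolevNormSq_eq_of_ae (F := fun k => F k j) (lo_lt hτ j).le fun k hk => h3 k hk j
      rw [normSqW, Finset.sum_eq_single S.root]
      · rw [e, lo_root]; simp only [hFr]
      · intro j _ hj
        rw [e]; simp [hFn _ hj]
      · intro h; exact absurd (Finset.mem_univ _) h
    rw [hsum, Finset.sum_mul]
    refine Finset.sum_le_sum fun k hk => ?_
    have hk : k ≤ S.n := by simpa [Nat.lt_succ_iff] using hk
    have hi : IntervalIntegrable (fun t => ‖R k t‖ ^ 2) volume (-S.τ) (S.T S.root) :=
      (intervalIntegrable_real_iff (by linarith)).2 (memLp_two_integrable_sq (hRm k hk))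
    have hsub : ∀ x ∈ Icc (-S.τ) (S.T S.root), ∀ z ∈ Icc (-S.τ) (S.T S.root),
        IntervalIntegrable (fun t => ‖R k t‖ ^ 2) volume x z := fun x hx z hz =>
      hi.mono_set ((uIcc_subset_Icc hx hz).trans Icc_subset_uIcc)
    have mz : (0 : ℝ) ∈ Icc (-S.τ) (S.T S.root) := ⟨by linarith, hTr.le⟩
    rw [← intervalIntegral.integral_add_adjacent_intervals
      (hsub _ ⟨le_rfl, by linarith⟩ 0 mz) (hsub 0 mz _ ⟨by linarith, le_rfl⟩), add_mul, one_mul]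
    refine add_le_add ?_ ?_
    · rw [intervalIntegral_congr_Ioo (g := fun t => ‖d k t‖ ^ 2) (by linarith) (by
        filter_upwards [hRneg k] with t ht
        rw [ht])]
      exact Finset.single_le_sum
        (f := fun k => ∫ t in (-S.τ)..0, ‖iteratedDerivWithin k φ (Icc (-S.τ) 0) t‖ ^ 2)
        (fun i _ => integral_sq_nonneg (by linarith)) (Finset.mem_range.2 (Nat.lt_succ_of_le hk))
    -- The Taylor coefficients are controlled by the norm of the history through the trace
    -- inequality at `0`.
    · have hb : ∀ t, ‖p k t‖ ^ 2 ≤ S.n * K * N * G k t := by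
        intro t
        refine (norm_sum_range_sq_le _ _).trans ?_
        have e : S.n * K * N * G k t =
            S.n * ∑ i ∈ Finset.range S.n, K * N * iteratedDeriv k (g i) t ^ 2 := by
          rw [← Finset.mul_sum]; simp only [hG]; ring
        rw [e]
        refine mul_le_mul_of_nonneg_left (Finset.sum_le_sum fun i hi => ?_) (Nat.cast_nonneg _)
        rw [norm_mul, mul_pow, Complex.norm_real, Real.norm_eq_abs, sq_abs]
        gcongr
        exact hK φ hφ i (Finset.mem_range.1 hi) 0 ⟨by linarith, le_rfl⟩
      calc ∫ t in (0 : ℝ)..(S.T S.root), ‖R k t‖ ^ 2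
          ≤ ∫ t in (0 : ℝ)..(S.T S.root), S.n * K * N * G k t := by
            refine intervalIntegral_mono_Ioo hTr.le
              (Filter.Eventually.of_forall fun t => by positivity)
              ((intervalIntegrable_real_iff hTr.le).1
                ((continuous_const.mul (hGc k)).intervalIntegrable _ _)) ?_
            filter_upwards [hRpos k] with t ht
            rw [← ht]; exact hb t
        _ = _ := by rw [intervalIntegral.integral_const_mul]; simp only [hΓ]; ring

end DelaySystem
end TreeDamping

namespace TreeDamping

variable {E : Type*} [Fintype E] [DecidableEq E]

/-! ### The Hilbert space of controls -/

/-- The orthogonal sum of the spaces `L_2(0, l j)`. -/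
abbrev EdgeL2 (l : E → ℝ) : Type _ := PiLp 2 fun j : E => Lp ℂ 2 (volume.restrict (Ioo 0 (l j)))

/-- The element of the Hilbert space given by a family of square integrable functions. -/
def toL2 (l : E → ℝ) (f : E → ℝ → ℂ) (hf : ∀ j, MemLp (f j) 2 (volume.restrict (Ioo 0 (l j)))) :
    EdgeL2 l := WithLp.toLp 2 fun j => (hf j).toLp (f j)

/-- A finite-dimensional subspace equals its double orthogonal complement, even in an incomplete
space. -/
theorem mem_span_range_of_forall_orthogonal {H ι : Type*} [NormedAddCommGroup H]
    [InnerProductSpace ℂ H] [Finite ι] {p : ι → H} {g : H}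
    (h : ∀ x, (∀ i, inner ℂ x (p i) = 0) → inner ℂ x g = 0) :
    g ∈ Submodule.span ℂ (Set.range p) := by
  have : FiniteDimensional ℂ (Submodule.span ℂ (Set.range p)) :=
    FiniteDimensional.span_of_finite ℂ (Set.finite_range p)
  rw [← Submodule.orthogonal_orthogonal (Submodule.span ℂ (Set.range p)),
    Submodule.mem_orthogonal]
  exact fun x hx => h x fun i =>
    (Submodule.mem_orthogonal' _ _).1 hx _ (Submodule.subset_span ⟨i, rfl⟩)

section L2

variable {l : E → ℝ} {f g : E → ℝ → ℂ}
  (hf : ∀ j, MemLp (f j) 2 (volume.restrict (Ioo 0 (l j))))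
  (hg : ∀ j, MemLp (g j) 2 (volume.restrict (Ioo 0 (l j))))

theorem inner_toL2 (hl : ∀ j, 0 ≤ l j) :
    inner ℂ (toL2 l f hf) (toL2 l g hg) = ∑ j, ∫ t in (0 : ℝ)..(l j), g j t * star (f j t) := by
  rw [PiLp.inner_apply]
  refine Finset.sum_congr rfl fun j _ => ?_
  rw [L2.inner_def, intervalIntegral.integral_of_le (hl j), ← restrict_Ioo_eq_restrict_Ioc]
  refine integral_congr_ae ?_
  filter_upwards [(hf j).coeFn_toLp, (hg j).coeFn_toLp] with t h1 h2
  simp only [toL2, RCLike.inner_apply]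
  rw [h1, h2]
  rfl

theorem norm_sq_toL2 (hl : ∀ j, 0 ≤ l j) :
    ‖toL2 l f hf‖ ^ 2 = ∑ j, ∫ t in (0 : ℝ)..(l j), ‖f j t‖ ^ 2 := by
  have h := inner_self_eq_norm_sq_to_K (𝕜 := ℂ) (toL2 l f hf)
  rw [inner_toL2 hf hf hl] at h
  have e : ∀ j t, f j t * star (f j t) = ((‖f j t‖ ^ 2 : ℝ) : ℂ) := fun j t => by
    rw [Complex.star_def, Complex.mul_conj, Complex.normSq_eq_norm_sq]
  simp only [e, intervalIntegral.integral_ofReal] at h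
  have h2 := congrArg Complex.re h
  rw [← Complex.ofReal_sum, Complex.ofReal_re] at h2
  rw [h2, ← RCLike.ofReal_pow]
  rfl

theorem toL2_eq_iff : toL2 l f hf = toL2 l g hg ↔
    ∀ j, ∀ᵐ t ∂volume.restrict (Ioo 0 (l j)), f j t = g j t := by
  refine ⟨fun h j => (MemLp.toLp_eq_toLp_iff (hf j) (hg j)).1 (congrArg (fun x => x j) h),
    fun h => ?_⟩
  unfold toL2
  congr 1
  ext1 j
  exact (MemLp.toLp_eq_toLp_iff _ _).2 (h j)

theorem toL2_add_mul (c : ℂ) {u : E → ℝ → ℂ}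
    (hu : ∀ j, MemLp (u j) 2 (volume.restrict (Ioo 0 (l j))))
    (h : ∀ j, ∀ᵐ t ∂volume.restrict (Ioo 0 (l j)), u j t = f j t + c * g j t) :
    toL2 l u hu = toL2 l f hf + c • toL2 l g hg := by
  rw [(toL2_eq_iff hu fun j => (hf j).add ((hg j).const_smul c)).2 h]
  rfl

theorem sum_smul_toL2 {ι : Type*} (s : Finset ι) (c : ι → ℂ) {P : ι → E → ℝ → ℂ}
    (hP : ∀ i j, MemLp (P i j) 2 (volume.restrict (Ioo 0 (l j)))) :
    ∑ i ∈ s, c i • toL2 l (P i) (hP i) = toL2 l (fun j t => ∑ i ∈ s, c i * P i j t) fun j =>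
      memLp_finsetSum s fun i _ => (hP i j).const_mul (c i) := by
  classical
  induction s using Finset.induction_on with
  | empty =>
    simp only [Finset.sum_empty]
    rfl
  | insert a s ha ih =>
    rw [Finset.sum_insert ha, ih, add_comm, ← toL2_add_mul]
    exact fun j => Filter.Eventually.of_forall fun t => by rw [Finset.sum_insert ha, add_comm]

theorem exists_rep (x : EdgeL2 l) : ∃ f, ∃ hf : ∀ j, MemLp (f j) 2 (volume.restrict (Ioo 0 (l j))),
    x = toL2 l f hf := by
  refine ⟨fun j => x j, fun j => Lp.memLp (x j), ?_⟩
  ext1 j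
  exact (Lp.toLp_coeFn (x j) (Lp.memLp (x j))).symm

end L2

namespace DelaySystem

variable {S : DelaySystem E}

/-- `ℓ y` as an element of the Hilbert space. -/
def ellL2 (hτ : 0 < S.τ) (hT : ∀ j, S.τ < S.T j) (hS : S.RegularCoefficients) {y : E → ℝ → ℂ}
    (hy : S.MemW y) : EdgeL2 S.T := toL2 S.T (S.ell y) fun j => memLp_ell hτ hT hS hy j

/-- The derivatives of order `n` as an element of the Hilbert space. -/
def topL2 (hτ : 0 < S.τ) {y : E → ℝ → ℂ} (hy : S.MemW y) : EdgeL2 S.T :=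
  toL2 S.T (S.D y S.n) fun j => hy.memLp_zero hτ le_rfl j

theorem norm_sq_ellL2 (hτ : 0 < S.τ) (hT : ∀ j, S.τ < S.T j) (hS : S.RegularCoefficients)
    {y : E → ℝ → ℂ} (hy : S.MemW y) : ‖ellL2 hτ hT hS hy‖ ^ 2 = S.energy y :=
  norm_sq_toL2 _ fun j => (S.T_pos j).le

theorem norm_sq_topL2 (hτ : 0 < S.τ) {y : E → ℝ → ℂ} (hy : S.MemW y) :
    ‖topL2 hτ hy‖ ^ 2 = S.topSq y := norm_sq_toL2 _ fun j => (S.T_pos j).le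

theorem ellL2_add_mul (hτ : 0 < S.τ) (hT : ∀ j, S.τ < S.T j) (hS : S.RegularCoefficients)
    {y z : E → ℝ → ℂ} (hy : S.MemW y) (hz : S.MemW z) (c : ℂ)
    (h : S.MemW fun j t => y j t + c * z j t) :
    ellL2 hτ hT hS h = ellL2 hτ hT hS hy + c • ellL2 hτ hT hS hz :=
  toL2_add_mul _ _ c _ fun j => ell_add_mul hτ hT hy hz c j

theorem topL2_add_mul (hτ : 0 < S.τ) {y z : E → ℝ → ℂ} (hy : S.MemW y) (hz : S.MemW z) (c : ℂ)
    (h : S.MemW fun j t => y j t + c * z j t) :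
    topL2 hτ h = topL2 hτ hy + c • topL2 hτ hz :=
  toL2_add_mul _ _ c _ fun j =>
    ae_Ioo_mono (lo_nonpos hτ j) le_rfl ((D_add_mul hτ hy hz c).2.2 S.n le_rfl j)

theorem admissible_zero (hτ : 0 < S.τ) : S.Admissible (fun _ => 0) fun _ _ => 0 := by
  obtain ⟨h1, h2, -⟩ := memW_of_jet (S := S) hτ (y := fun _ _ => 0) (F := fun _ _ _ => 0)
    (fun j k hk => IsPrim.zero) (fun j => MemLp.zero') (fun j t _ => rfl)
  have m0 : ∀ j, (0 : ℝ) ∈ S.dom j := fun j => mem_dom_of_mem hτ ⟨le_rfl, (S.T_pos j).le⟩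
  have mT : ∀ j, S.T j ∈ S.dom j := fun j => mem_dom_of_mem hτ ⟨(S.T_pos j).le, le_rfl⟩
  exact ZeroHist.admissible ⟨h1, fun j hj k hk => by rw [h2 k hk j (m0 j), h2 k hk _ (mT _)],
    fun _ _ => rfl, fun k hk => h2 k hk _ (m0 _)⟩ fun _ _ _ _ => rfl

/-- The space of all `ℓ w`, where `w` satisfies the homogeneous conditions. -/
def controlSpace (hτ : 0 < S.τ) (hT : ∀ j, S.τ < S.T j) (hS : S.RegularCoefficients) :
    Submodule ℂ (EdgeL2 S.T) where
  carrier := {x | ∃ w, ∃ hw : S.Admissible (fun _ => 0) w, x = ellL2 hτ hT hS hw.memW}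
  zero_mem' := by
    refine ⟨_, admissible_zero hτ, ?_⟩
    have h := (admissible_zero (S := S) hτ).memW
    -- Here and below the linear structure is reached through combinations `y + c z`: zero is `z +
    -- (-1) z`, and a multiple `c x` is `x + (c - 1) x`.
    have := ellL2_add_mul hτ hT hS h h (-1) (by simpa using h)
    rw [neg_one_smul, add_neg_cancel] at this
    rw [← this]
    refine (toL2_eq_iff _ _).2 fun j => Filter.Eventually.of_forall fun t => ?_
    simp
  add_mem' := by
    rintro x y ⟨w, hw, rfl⟩ ⟨z, hz, rfl⟩
    exact ⟨_, hw.add_mul hτ hz 1, by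
      rw [ellL2_add_mul hτ hT hS hw.memW hz.memW 1 (hw.add_mul hτ hz 1).memW, one_smul]⟩
  smul_mem' := by
    rintro c x ⟨w, hw, rfl⟩
    refine ⟨_, hw.add_mul hτ hw (c - 1), ?_⟩
    rw [ellL2_add_mul hτ hT hS hw.memW hw.memW (c - 1) (hw.add_mul hτ hw (c - 1)).memW,
      sub_smul, one_smul]
    abel

theorem norm_le_of_sq_le {X Y : Type*} [NormedAddCommGroup X] [NormedAddCommGroup Y] {x : X} {y : Y}
    {C : ℝ} (hC : 0 ≤ C) (h : ‖x‖ ^ 2 ≤ C * ‖y‖ ^ 2) : ‖x‖ ≤ √C * ‖y‖ := by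
  rw [← Real.sqrt_sq (norm_nonneg x), ← Real.sqrt_sq (norm_nonneg y), ← Real.sqrt_mul hC]
  exact Real.sqrt_le_sqrt h

theorem eq_zero_of_forall_sq_le {X : Type*} [NormedAddCommGroup X] {x : X} {u : ℕ → ℝ} {C : ℝ}
    (hu : Filter.Tendsto u Filter.atTop (nhds 0)) (h : ∀ m, ‖x‖ ^ 2 ≤ C * u m ^ 2) : x = 0 := by
  have h1 : Filter.Tendsto (fun m => C * u m ^ 2) Filter.atTop (nhds 0) := by
    simpa using (hu.pow 2).const_mul C
  have h2 : ‖x‖ ^ 2 ≤ 0 := ge_of_tendsto' h1 h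
  exact norm_eq_zero.1 (pow_eq_zero_iff two_ne_zero |>.1 (le_antisymm h2 (sq_nonneg _)))

/-- By coercivity, convergence of `ℓ w_m` makes the top derivatives a Cauchy sequence in `L_2`.
Their limit is integrated to a function `w0` with zero history. The pointwise estimates pass the
rest conditions to `w0`, and boundedness of the energy identifies the limit as `ℓ w0`. -/
theorem isClosed_controlSpace (hn : 1 ≤ S.n) (hτ : 0 < S.τ) (hT : ∀ j, S.τ < S.T j)
    (hS : S.RegularCoefficients) :
    IsClosed (controlSpace hτ hT hS : Set (EdgeL2 S.T)) := by
  obtain ⟨C1, hC1, h1⟩ := exists_topSq_le hτ hT hS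
  obtain ⟨C2, hC2, h2⟩ := exists_le_topSq (S := S) hτ
  obtain ⟨C3, hC3, h3⟩ := exists_energy_le hτ hT hS
  refine IsSeqClosed.isClosed fun x a hx ha => ?_
  choose w hw hxw using hx
  set v : ℕ → EdgeL2 S.T := fun m => topL2 hτ (hw m).memW with hv
  have hdist : ∀ m m', ‖v m - v m'‖ ≤ √C1 * ‖x m - x m'‖ := by
    intro m m'
    have hd := ZeroHist.sub hτ (hw m).zeroHist (hw m').zeroHist
    refine norm_le_of_sq_le hC1 ?_
    have e1 := topL2_add_mul hτ (hw m).memW (hw m').memW (-1) hd.memW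
    have e2 := ellL2_add_mul hτ hT hS (hw m).memW (hw m').memW (-1) hd.memW
    rw [neg_one_smul, ← sub_eq_add_neg] at e1 e2
    rw [hv, hxw, hxw]
    simp only
    rw [← e1, ← e2, norm_sq_topL2, norm_sq_ellL2]
    exact h1 _ hd
  have hcau : CauchySeq v := by
    have hxc := ha.cauchySeq
    rw [Metric.cauchySeq_iff] at hxc ⊢
    intro ε hε
    obtain ⟨N, hN⟩ := hxc (ε / (√C1 + 1)) (by positivity)
    refine ⟨N, fun m hm m' hm' => ?_⟩
    have := hN m hm m' hm'
    rw [lt_div_iff₀ (by positivity), dist_eq_norm] at this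
    rw [dist_eq_norm]
    refine (hdist m m').trans_lt ?_
    nlinarith [norm_nonneg (x m - x m')]
  obtain ⟨v0, hv0⟩ := cauchySeq_tendsto_of_complete hcau
  obtain ⟨f, hf, rfl⟩ := exists_rep v0
  obtain ⟨w0, hw0, hw0f⟩ := exists_zeroHist hn hτ hf
  have hv0' : toL2 S.T f hf = topL2 hτ hw0.memW :=
    (toL2_eq_iff _ _).2 fun j => (hw0f j).mono fun t ht => ht.symm
  rw [hv0'] at hv0
  have hu : Filter.Tendsto (fun m => ‖v m - topL2 hτ hw0.memW‖) Filter.atTop (nhds 0) :=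
    tendsto_iff_norm_sub_tendsto_zero.1 hv0
  have hsub : ∀ m, S.ZeroHist fun j t => w m j t + (-1) * w0 j t := fun m =>
    ZeroHist.sub hτ (hw m).zeroHist hw0
  have htop : ∀ m, S.topSq (fun j t => w m j t + (-1) * w0 j t) =
      ‖v m - topL2 hτ hw0.memW‖ ^ 2 := fun m => by
    rw [← norm_sq_topL2 hτ (hsub m).memW,
      topL2_add_mul hτ (hw m).memW hw0.memW (-1) (hsub m).memW, neg_one_smul, ← sub_eq_add_neg]
  have hadm : S.Admissible (fun _ => 0) w0 := by
    refine hw0.admissible fun j hj t ht => ?_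
    refine eq_zero_of_forall_sq_le (C := C2) hu fun m => ?_
    have := (h2 _ (hsub m)).1 0 (by omega) j t ⟨by linarith [ht.1, hT j], ht.2⟩
    rw [htop] at this
    simpa [D, (hw m).rest j hj t ht] using this
  refine ⟨w0, hadm, ?_⟩
  have hlim : Filter.Tendsto x Filter.atTop (nhds (ellL2 hτ hT hS hadm.memW)) := by
    rw [tendsto_iff_norm_sub_tendsto_zero]
    have hle : ∀ m, ‖x m - ellL2 hτ hT hS hadm.memW‖ ≤
        √(C3 * C2) * ‖v m - topL2 hτ hw0.memW‖ := by
      intro m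
      refine norm_le_of_sq_le (by positivity) ?_
      have e2 := ellL2_add_mul hτ hT hS (hw m).memW hw0.memW (-1) (hsub m).memW
      rw [neg_one_smul, ← sub_eq_add_neg] at e2
      rw [hxw, ← e2, norm_sq_ellL2, ← htop, mul_assoc]
      exact (h3 _ (hsub m).memW).trans (mul_le_mul_of_nonneg_left (h2 _ (hsub m)).2 hC3)
    refine squeeze_zero (fun _ => norm_nonneg _) hle ?_
    simpa using hu.const_mul (√(C3 * C2))
  exact tendsto_nhds_unique ha hlim

/-! ### The variational equation and the boundary value problem -/

/-- The first variation of the energy at `y` vanishes. -/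
def IsStationary (S : DelaySystem E) (y : E → ℝ → ℂ) : Prop :=
  ∀ w, S.Admissible (fun _ => 0) w →
    ∑ j, ∫ t in (0 : ℝ)..(S.T j), S.ell y j t * star (S.ell w j t) = 0

/-- The adjoint formula followed by integration by parts leaves only terms at the leaves, where the
derivatives of `w` of order below `n` vanish. -/
theorem SolvesBVP.isStationary (hn : 1 ≤ S.n) (hτ : 0 < S.τ) (hT : ∀ j, S.τ < S.T j)
    (hS : S.RegularCoefficients) {φ : ℝ → ℂ} {y : E → ℝ → ℂ} (hy : S.SolvesBVP φ y) :
    S.IsStationary y := by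
  obtain ⟨hadm, R, hR, hb⟩ := (solvesBVP_iff hn hT).1 hy
  intro w hw
  rw [sum_integral_ell_mul_star hτ hT hS hadm.memW hw]
  have h := hR.sum_integral hτ hT hw.zeroHist
  rw [Finset.sum_eq_zero (s := Finset.univ) (f := fun j => if S.next j = ∅ then _ else _)] at h
  · rw [← h]
    refine Finset.sum_congr rfl fun j _ => intervalIntegral_congr_Ioo (len_pos hT j).le ?_
    filter_upwards [hb j] with t ht
    rw [Finset.sum_range_succ, ht, add_comm]
  · intro j _
    split_ifs with hj
    · exact Finset.sum_eq_zero fun k hk => by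
        rw [hw.D_len hτ hT hj (Finset.mem_range.1 hk)]; simp
    · rfl

/-- The lemma of du Bois-Reymond on the tree. -/
theorem IsStationary.solvesBVP (hn : 1 ≤ S.n) (hτ : 0 < S.τ) (hT : ∀ j, S.τ < S.T j)
    (hS : S.RegularCoefficients) {φ : ℝ → ℂ} {y : E → ℝ → ℂ} (hadm : S.Admissible φ y)
    (hy : S.IsStationary y) : S.SolvesBVP φ y := by
  have hl := fun j => (len_pos (S := S) hT j).le
  have hL : ∀ k < S.n, ∀ j, IntervalIntegrable (S.ellAdj y k j) volume 0 (S.len j) := by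
    intro k hk j
    have := memLp_ellAdj hτ hT hS hadm.memW hk.le j
    rw [expo, if_pos hk] at this
    exact (intervalIntegrable_iff_Ioo (hl j)).2 (memLp_one_iff_integrable.1 this)
  -- A particular solution with zero data at the leaves; it need not satisfy `R n = ℓ_{n,j} y`.
  obtain ⟨R, hR, hR0⟩ := exists_isKirchhoff hT hL fun _ _ => 0
  -- Homogeneous solutions with a single unit datum at one leaf. For an index whose edge is not a
  -- leaf, all leaf data are zero, which does no harm.
  choose P hP hP1 using fun i : E × Fin S.n => exists_isKirchhoff (S := S) hT
    (L := fun _ _ _ => 0) (fun k hk j => intervalIntegrable_const)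
    (fun k j => if j = i.1 ∧ k = i.2 then 1 else 0)
  have hRn : ∀ {L R}, S.IsKirchhoff L R → ∀ j,
      MemLp (R S.n j) 2 (volume.restrict (Ioo 0 (S.len j))) := by
    intro L R hR j
    obtain ⟨m, hm⟩ : ∃ m, S.n = m + 1 := ⟨S.n - 1, by omega⟩
    have := (hR.prim m (by omega) j).memLp 2
    rwa [← hm] at this
  have hgm : ∀ j, MemLp (fun t => S.ellAdj y S.n j t - R S.n j t) 2
      (volume.restrict (Ioo 0 (S.len j))) := by
    intro j
    have := memLp_ellAdj hτ hT hS hadm.memW le_rfl j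
    rw [expo, if_neg (lt_irrefl _)] at this
    exact this.sub (hRn hR j)
  set g := toL2 S.len (fun j t => S.ellAdj y S.n j t - R S.n j t) hgm with hg
  set p : E × Fin S.n → EdgeL2 S.len := fun i => toL2 S.len (P i S.n) (hRn (hP i)) with hp
  have hmem : g ∈ Submodule.span ℂ (Set.range p) := by
    refine mem_span_range_of_forall_orthogonal fun x hxp => ?_
    obtain ⟨v, hv, rfl⟩ := exists_rep x
    -- A vector orthogonal to all `p i` becomes the top derivative of a test function, extended by
    -- zero to the rest pieces.
    obtain ⟨w, hw, hwv⟩ := exists_zeroHist (S := S) hn hτ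
      (v := fun j => (Ioo 0 (S.len j)).indicator (v j)) fun j => memLp_indicator_Ioo (hv j)
    have hwin : ∀ j, ∀ᵐ t ∂volume.restrict (Ioo 0 (S.len j)), S.D w S.n j t = v j t := by
      intro j
      filter_upwards [ae_Ioo_mono le_rfl (len_le hτ j) (hwv j),
        ae_restrict_mem measurableSet_Ioo] with t ht htm
      rw [ht, indicator_of_mem htm]
    have hwout : ∀ j, ∀ᵐ t ∂volume.restrict (Ioo (S.len j) (S.T j)), S.D w S.n j t = 0 := by
      intro j
      filter_upwards [ae_Ioo_mono (hl j) le_rfl (hwv j),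
        ae_restrict_mem measurableSet_Ioo] with t ht htm
      rw [ht, indicator_of_notMem fun h => lt_asymm h.2 htm.1]
    -- Integration by parts against the homogeneous solution of index `(j, k)` leaves the conjugate
    -- of `w^(k)` at the leaf `j`. Orthogonality thus says that this value is zero, and `w` stays
    -- zero on the rest piece.
    have hend : ∀ j, S.IsLeaf j → ∀ k < S.n, S.D w k j (S.len j) = 0 := by
      intro j hj k hk
      have h := (hP (j, ⟨k, hk⟩)).sum_integral hτ hT hw
      have h0 := hxp (j, ⟨k, hk⟩)
      rw [hp, inner_toL2 _ _ hl] at h0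
      have e : ∀ i, ∫ t in (0 : ℝ)..(S.len i), (P (j, ⟨k, hk⟩) S.n i t * star (S.D w S.n i t) +
          ∑ k' ∈ Finset.range S.n, 0 * star (S.D w k' i t)) =
          ∫ t in (0 : ℝ)..(S.len i), P (j, ⟨k, hk⟩) S.n i t * star (v i t) := by
        intro i
        refine intervalIntegral_congr_Ioo (hl i) ?_
        filter_upwards [hwin i] with t ht
        simp [ht]
      rw [Finset.sum_congr rfl fun i _ => e i, h0, Finset.sum_eq_single j, if_pos (show S.next j = ∅ from hj),
        Finset.sum_eq_single k] at h
      · rw [hP1 _ j hj k hk] at h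
        simpa using h.symm
      · intro k' hk' hne
        rw [hP1 _ j hj k' (Finset.mem_range.1 hk')]
        simp [hne]
      · intro h; exact absurd (Finset.mem_range.2 hk) h
      · intro i _ hne
        split_ifs with hi
        · refine Finset.sum_eq_zero fun k' hk' => ?_
          rw [hP1 _ i hi k' (Finset.mem_range.1 hk')]
          simp [hne]
        · rfl
      · intro h; exact absurd (Finset.mem_univ _) h
    have hw0 : S.Admissible (fun _ => 0) w := by
      refine hw.admissible fun j hj t ht => ?_
      rw [← len_of_leaf hj] at ht
      have hjet : IsJet S.n (S.len j) (S.T j) fun k => S.D w k j := fun k hk =>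
        (hw.memW.isPrim_zero hτ hk j).mono (hl j) (len_le hτ j) le_rfl
      have := hjet.eq_zero (c := S.len j) ⟨le_rfl, len_le hτ j⟩ (hend j hj) (hwout j)
        (k := 0) (by omega) t ht
      simpa [D] using this
    have h1 := hy w hw0
    rw [sum_integral_ell_mul_star hτ hT hS hadm.memW hw0] at h1
    have h2 := hR.sum_integral hτ hT hw
    rw [Finset.sum_eq_zero (s := Finset.univ) (f := fun j => if S.next j = ∅ then _ else _)
      fun j _ => by
        split_ifs with hj
        · exact Finset.sum_eq_zero fun k hk => by
            rw [hR0 j hj k (Finset.mem_range.1 hk), zero_mul]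
        · rfl] at h2
    rw [hg, inner_toL2 _ _ hl]
    -- Stationarity and integration by parts both give zero. In the difference of the integrands
    -- only the defect of order `n` survives.
    rw [← sub_eq_zero.2 (h1.trans h2.symm), ← Finset.sum_sub_distrib]
    refine Finset.sum_congr rfl fun j _ => ?_
    have i1 : ∀ k ∈ Finset.range (S.n + 1), IntervalIntegrable
        (fun t => S.ellAdj y k j t * star (S.D w k j t)) volume 0 (S.len j) := fun k hk =>
      (intervalIntegrable_iff_Ioo (hl j)).2 (integrable_mul_star_D hτ hw.memW
        (by simpa [Nat.lt_succ_iff] using hk) le_rfl (len_le hτ j)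
        (memLp_ellAdj hτ hT hS hadm.memW (by simpa [Nat.lt_succ_iff] using hk) j))
    have i2 : IntervalIntegrable (fun t => R S.n j t * star (S.D w S.n j t)) volume
        0 (S.len j) := by
      refine (intervalIntegrable_iff_Ioo (hl j)).2 (integrable_mul_star_D hτ hw.memW
        le_rfl le_rfl (len_le hτ j) ?_)
      rw [expo, if_neg (lt_irrefl _)]
      exact hRn hR j
    have i3 : IntervalIntegrable (fun t => ∑ k ∈ Finset.range (S.n + 1),
        S.ellAdj y k j t * star (S.D w k j t)) volume 0 (S.len j) := by
      have := IntervalIntegrable.sum (Finset.range (S.n + 1)) i1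
      simpa only [Finset.sum_fn] using this
    have i4 : IntervalIntegrable (fun t => ∑ k ∈ Finset.range S.n,
        S.ellAdj y k j t * star (S.D w k j t)) volume 0 (S.len j) := by
      have := IntervalIntegrable.sum (Finset.range S.n) fun k hk =>
        i1 k (Finset.mem_range.2 ((Finset.mem_range.1 hk).trans (Nat.lt_succ_self _)))
      simpa only [Finset.sum_fn] using this
    rw [← intervalIntegral.integral_sub i3 (i2.add i4)]
    refine intervalIntegral_congr_Ioo (hl j) ?_
    filter_upwards [hwin j] with t ht
    rw [Finset.sum_range_succ, ← ht]
    ring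
  obtain ⟨c, hc⟩ := (Submodule.mem_span_range_iff_exists_fun ℂ).1 hmem
  -- Adding the combination of homogeneous solutions found above cancels the defect.
  refine (solvesBVP_iff hn hT).2 ⟨hadm, _, hR.add_sum hP c, fun j => ?_⟩
  rw [hp, sum_smul_toL2 Finset.univ c fun i => hRn (hP i), hg] at hc
  filter_upwards [(toL2_eq_iff _ _).1 hc j] with t ht
  rw [ht]
  ring

end DelaySystem
end TreeDamping

namespace TreeDamping

variable {E : Type*} [Fintype E] [DecidableEq E]

namespace DelaySystem

variable {S : DelaySystem E}

/-! ### Existence and uniqueness -/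

theorem normSqW_sub_le (hτ : 0 < S.τ) {y z : E → ℝ → ℂ} (hy : S.MemW y) (hz : S.MemW z) :
    S.normSqW (fun j t => y j t + (-1) * z j t) ≤ 2 * (S.normSqW y + S.normSqW z) := by
  have hD := (D_add_mul hτ hy hz (-1)).2.2
  simp only [normSqW, ← Finset.sum_add_distrib, Finset.mul_sum]
  refine Finset.sum_le_sum fun j _ => ?_
  have hab := (lo_lt hτ j).le
  rw [sobolevNormSq_eq_of_ae hab (F := fun k t => S.D y k j t + (-1) * S.D z k j t)
    fun k hk => hD k hk j]
  simp only [sobolevNormSq, ← Finset.sum_add_distrib, Finset.mul_sum]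
  refine Finset.sum_le_sum fun k hk => ?_
  have hk' : k ≤ S.n := by simpa [Nat.lt_succ_iff] using hk
  have hi : ∀ {x : E → ℝ → ℂ}, S.MemW x →
      Integrable (fun t => ‖S.D x k j t‖ ^ 2) (volume.restrict (Ioo (S.lo j) (S.T j))) :=
    fun hx => (hx.memLp hτ hk' j).integrable_norm_pow two_ne_zero
  calc ∫ t in (S.lo j)..(S.T j), ‖S.D y k j t + (-1) * S.D z k j t‖ ^ 2
      ≤ ∫ t in (S.lo j)..(S.T j), 2 * (‖S.D y k j t‖ ^ 2 + ‖S.D z k j t‖ ^ 2) := by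
        refine intervalIntegral_mono_Ioo hab (Filter.Eventually.of_forall fun t => by positivity)
          (((hi hy).add (hi hz)).const_mul 2) (Filter.Eventually.of_forall fun t => ?_)
        refine (norm_add_sq_le _ _).trans_eq ?_
        simp
    _ = _ := by
        rw [intervalIntegral.integral_const_mul, intervalIntegral.integral_add
          ((intervalIntegrable_real_iff hab).2 (hi hy)) ((intervalIntegrable_real_iff hab).2 (hi hz))]
        rfl

/-- Functions with zero history and zero energy vanish. -/
theorem ZeroHist.eq_zero (hn : 1 ≤ S.n) (hτ : 0 < S.τ) (hT : ∀ j, S.τ < S.T j)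
    (hS : S.RegularCoefficients) {w : E → ℝ → ℂ} (hw : S.ZeroHist w) (h : S.energy w ≤ 0)
    (j : E) {t : ℝ} (ht : t ∈ S.dom j) : w j t = 0 := by
  obtain ⟨C1, hC1, h1⟩ := exists_topSq_le hτ hT hS
  obtain ⟨C2, hC2, h2⟩ := exists_le_topSq (S := S) hτ
  have hpos : ∀ t ∈ Icc 0 (S.T j), w j t = 0 := fun t ht => by
    have h3 : ‖S.D w 0 j t‖ ^ 2 ≤ 0 := ((h2 w hw).1 0 (by omega) j t ht).trans
      (mul_nonpos_of_nonneg_of_nonpos hC2 ((h1 w hw).trans (mul_nonpos_of_nonneg_of_nonpos hC1 h)))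
    have h4 := pow_eq_zero_iff two_ne_zero |>.1 (le_antisymm h3 (sq_nonneg _))
    simpa [D] using h4
  rcases le_or_gt 0 t with h0 | h0
  · exact hpos t ⟨h0, ht.2⟩
  · by_cases hj : j = S.root
    · subst hj
      have := ht.1
      rw [lo_root] at this
      simpa [D] using hw.D_neg_closed hτ (k := 0) (by omega) ⟨this, h0.le⟩
    · have := ht.1
      rw [lo, if_neg hj] at this
      linarith

theorem Admissible.eqOnTree (hn : 1 ≤ S.n) (hτ : 0 < S.τ) (hT : ∀ j, S.τ < S.T j)
    (hS : S.RegularCoefficients) {φ : ℝ → ℂ} {y z : E → ℝ → ℂ} (hz : S.Admissible φ z)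
    (hy : S.Admissible φ y) (h : S.energy (fun j t => z j t + (-1) * y j t) ≤ 0) :
    S.EqOnTree z y := fun j t ht => by
  have := (hz.sub hτ hy).zeroHist.eq_zero hn hτ hT hS h j ht
  simp only [neg_one_mul, ← sub_eq_add_neg] at this
  exact sub_eq_zero.1 this

theorem isStationary_iff {hτ : 0 < S.τ} {hT : ∀ j, S.τ < S.T j} {hS : S.RegularCoefficients}
    {y : E → ℝ → ℂ} (hy : S.MemW y) :
    S.IsStationary y ↔ ∀ x ∈ controlSpace hτ hT hS, inner ℂ x (ellL2 hτ hT hS hy) = 0 := by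
  have e : ∀ w (hw : S.MemW w), inner ℂ (ellL2 hτ hT hS hw) (ellL2 hτ hT hS hy) =
      ∑ j, ∫ t in (0 : ℝ)..(S.T j), S.ell y j t * star (S.ell w j t) := fun w hw =>
    inner_toL2 _ _ fun j => (S.T_pos j).le
  refine ⟨?_, fun h w hw => (e w hw.memW).symm.trans (h _ ⟨w, hw, rfl⟩)⟩
  rintro h x ⟨w, hw, rfl⟩
  exact (e w hw.memW).trans (h w hw)

/-- Pythagoras: `z - y` has zero history and satisfies the rest conditions, so `ℓ (z - y)` lies in
`controlSpace`, to which `ℓ y` is orthogonal. -/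
theorem IsStationary.energy_eq (hτ : 0 < S.τ) (hT : ∀ j, S.τ < S.T j)
    (hS : S.RegularCoefficients) {φ : ℝ → ℂ} {y z : E → ℝ → ℂ} (hst : S.IsStationary y)
    (hy : S.Admissible φ y) (hz : S.Admissible φ z) :
    S.energy z = S.energy y + S.energy (fun j t => z j t + (-1) * y j t) := by
  have hd := hz.sub hτ hy
  have h0 := (isStationary_iff (hτ := hτ) (hT := hT) (hS := hS) hy.memW).1 hst _ ⟨_, hd, rfl⟩
  have e := ellL2_add_mul hτ hT hS hz.memW hy.memW (-1) hd.memW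
  rw [neg_one_smul, ← sub_eq_add_neg, eq_sub_iff_add_eq] at e
  rw [← norm_sq_ellL2 hτ hT hS hz.memW, ← norm_sq_ellL2 hτ hT hS hy.memW,
    ← norm_sq_ellL2 hτ hT hS hd.memW, ← e]
  have := norm_add_sq_eq_norm_sq_add_norm_sq_of_inner_eq_zero _ _ h0
  nlinarith

/-- Subtraction of the orthogonal projection makes an admissible function stationary. -/
theorem Admissible.exists_isStationary (hn : 1 ≤ S.n) (hτ : 0 < S.τ) (hT : ∀ j, S.τ < S.T j)
    (hS : S.RegularCoefficients) {φ : ℝ → ℂ} {y : E → ℝ → ℂ} (hy : S.Admissible φ y) :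
    ∃ w, S.Admissible (fun _ => 0) w ∧ S.energy w ≤ S.energy y ∧
      S.Admissible φ (fun j t => y j t + (-1) * w j t) ∧
      S.IsStationary fun j t => y j t + (-1) * w j t := by
  have : CompleteSpace (controlSpace hτ hT hS) :=
    (isClosed_controlSpace hn hτ hT hS).completeSpace_coe
  set K := controlSpace hτ hT hS with hK
  set x := ellL2 hτ hT hS hy.memW with hx
  -- The projection lies in `controlSpace`, so it is `ℓ w` for an admissible `w` with zero history.
  obtain ⟨w, hw, hwx⟩ := Submodule.starProjection_apply_mem K x
  refine ⟨w, hw, ?_, hy.add_mul hτ hw (-1), ?_⟩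
  · rw [← norm_sq_ellL2 hτ hT hS hw.memW, ← norm_sq_ellL2 hτ hT hS hy.memW, ← hwx]
    gcongr
    exact Submodule.norm_starProjection_apply_le K x
  · refine (isStationary_iff (hτ := hτ) (hT := hT) (hS := hS) (hy.add_mul hτ hw (-1)).memW).2
      fun u hu => ?_
    rw [ellL2_add_mul hτ hT hS hy.memW hw.memW, ← hwx, neg_one_smul, ← sub_eq_add_neg]
    exact (Submodule.mem_orthogonal _ _).1 (K.sub_starProjection_mem_orthogonal x) u hu

theorem exists_isStationary_le (hn : 1 ≤ S.n) (hτ : 0 < S.τ) (hT : ∀ j, S.τ < S.T j)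
    (hS : S.RegularCoefficients) : ∃ C : ℝ, ∀ φ, MemSobolev 2 S.n (-S.τ) 0 φ →
      ∃ y, S.Admissible φ y ∧ S.IsStationary y ∧
        S.normW y ≤ C * sobolevNorm S.n (-S.τ) 0 φ := by
  obtain ⟨C1, hC1, h1⟩ := exists_topSq_le hτ hT hS
  obtain ⟨C2, hC2, h2⟩ := exists_le_topSq (S := S) hτ
  obtain ⟨C3, hC3, h3⟩ := exists_energy_le hτ hT hS
  obtain ⟨C4, hC4, h4⟩ := exists_extension hn hτ hT
  -- `C4` bounds the extension and `C3` its energy, which dominates the energy of the projection;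
  -- `C1` and `C2` return from energy to norm. The `2` comes from squaring a difference.
  refine ⟨√(2 * (1 + C2 * C1 * C3) * C4), fun φ hφ => ?_⟩
  obtain ⟨y, hy, hyφ⟩ := h4 φ hφ
  obtain ⟨w, hw, hwy, hadm, hst⟩ := hy.exists_isStationary hn hτ hT hS
  refine ⟨_, hadm, hst, ?_⟩
  rw [normW, sobolevNorm, ← Real.sqrt_mul (by positivity)]
  refine Real.sqrt_le_sqrt ?_
  have hwn : S.normSqW w ≤ C2 * C1 * C3 * S.normSqW y :=
    calc S.normSqW w ≤ C2 * S.topSq w := (h2 w hw.zeroHist).2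
      _ ≤ C2 * (C1 * S.energy w) := by gcongr; exact h1 w hw.zeroHist
      _ ≤ C2 * (C1 * (C3 * S.normSqW y)) := by gcongr; exact hwy.trans (h3 y hy.memW)
      _ = _ := by ring
  calc S.normSqW (fun j t => y j t + (-1) * w j t)
      ≤ 2 * (S.normSqW y + S.normSqW w) := normSqW_sub_le hτ hy.memW hw.memW
    _ ≤ 2 * (S.normSqW y + C2 * C1 * C3 * S.normSqW y) := by gcongr
    _ = 2 * (1 + C2 * C1 * C3) * S.normSqW y := by ring
    _ ≤ 2 * (1 + C2 * C1 * C3) * (C4 * sobolevNormSq S.n (-S.τ) 0 φ) := by gcongr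
    _ = _ := by ring

end DelaySystem
end TreeDamping

end

/-! ### The main theorem -/

theorem mainTheorem2 {E : Type*} [Fintype E] [DecidableEq E] (S : TreeDamping.DelaySystem E)
    (hn : 1 ≤ S.n) (hτ : 0 < S.τ) (hT : ∀ j, S.τ < S.T j) (hS : S.RegularCoefficients) :
    ∃ C : ℝ, ∀ φ : ℝ → ℂ, TreeDamping.MemSobolev 2 S.n (-S.τ) 0 φ →
      ∃ y : E → ℝ → ℂ,
        S.SolvesBVP φ y ∧
        (∀ z : E → ℝ → ℂ, S.SolvesBVP φ z → S.EqOnTree z y) ∧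
        S.normW y ≤ C * TreeDamping.sobolevNorm S.n (-S.τ) 0 φ ∧
        S.SolvesVariational φ y ∧
        (∀ z : E → ℝ → ℂ, S.SolvesVariational φ z → S.EqOnTree z y) := by
  obtain ⟨C, hC⟩ := TreeDamping.DelaySystem.exists_isStationary_le hn hτ hT hS
  refine ⟨C, fun φ hφ => ?_⟩
  obtain ⟨y, hy, hst, hle⟩ := hC φ hφ
  have hnonneg : ∀ z, 0 ≤ S.energy z := fun z =>
    Finset.sum_nonneg fun j _ => TreeDamping.DelaySystem.integral_sq_nonneg (S.T_pos j).le
  -- Both uniqueness claims reduce to this: if `z` has no more energy than `y`, then `z - y` has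
  -- energy zero and vanishes by coercivity. A solution of the boundary value problem qualifies
  -- because it is stationary, hence a minimizer.
  have huniq : ∀ z, S.Admissible φ z → S.energy z ≤ S.energy y → S.EqOnTree z y := fun z hz h =>
    hz.eqOnTree hn hτ hT hS hy (by linarith [hst.energy_eq hτ hT hS hy hz])
  have hmin : ∀ {y z}, S.IsStationary y → S.Admissible φ y → S.Admissible φ z →
      S.energy y ≤ S.energy z := fun hst hy hz => by
    rw [hst.energy_eq hτ hT hS hy hz]
    exact le_add_of_nonneg_right (hnonneg _)
  exact ⟨y, hst.solvesBVP hn hτ hT hS hy,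
    fun z hz => huniq z hz.1 (hmin (hz.isStationary hn hτ hT hS) hz.1 hy), hle,
    ⟨hy, fun z hz => hmin hst hy hz⟩, fun z hz => huniq z hz.1 (hz.2 y hy)⟩
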